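/- Setting. Let $\mathcal X,\mathcal Y$ be finite sets and let $Q_1,\dots,Q_L$ be discrete memoryless channels from $\mathcal X$ to $\mathcal Y$. All logarithms are to base $2$. Write $C_\ell$ for the capacity of $Q_\ell$ and $B_\ell=\max_{x_A,x_R}D(Q_\ell(\cdot|x_A)\,\|\,Q_\ell(\cdot|x_R))$; assume $B_\ell<\infty$ and let $R=(R_1,\dots,R_L)$ satisfy $0\le R_\ell<C_\ell$ for all $\ell$. Coding schemes. A variable-rate variable-length coding scheme with feedback consists of message sizes $M_1,\dots,M_L\ge1$, encoding functions $f_t:\prod_\ell\{1,\dots,M_\ell\}\times\mathcal Y^{t-1}\to\mathcal X$, decoding functions $g_t:\mathcal Y^t\to\bigcup_\ell\{(\ell,1),\dots,(\ell,M_\ell)\}$ and a stopping time $\tau\ge1$ of the output process. The components of the compound message $W=(W_1,\dots,W_L)$ are uniformly distributed, with any joint law; $X_t=f_t(W,Y^{t-1})$ and $(\hat L,\hat W)=g_\tau(Y^\tau)$. Under channel $Q_\ell$ (law $\mathbb P_\ell$), the error probability is $P_\ell=\mathbb P_\ell(\hat W\ne W_{\hat L})$ and the rate is $\mathbb E_\ell[\log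 M_{\hat L}]/\mathbb E_\ell[\tau]$. A sequence of schemes achieves $R$ if, for every $\ell$, $\mathbb E_\ell[\tau^{(n)}]$ is finite for large $n$ and tends to $\infty$, $P_\ell^{(n)}\to0$, and its rate under $Q_\ell$ tends to $R_\ell$. The error exponent region $\mathcal E(R)$ is the set of all $E=(E_1,\dots,E_L)$ for which some sequence of schemes, for every choice of joint laws of the messages with uniform marginals, achieves $R$ and satisfies $-\log P_\ell^{(n)}/\mathbb E_\ell[\tau^{(n)}]\to E_\ell$ for every $\ell$. Training. For training sequences $\sigma^{(N)}\in\mathcal X^N$ and estimation rules $\hat\theta:\mathcal Y^N\to\{1,\dots,L\}$, $N\ge 0$, say that $T=(T_1,\dots,T_L)\in\mathbb R^L$ is attained if $\liminf_{N\to\infty}-\frac1N\log\mathbb P_\ell(\hat\theta(Y^N)\ne\ell\mid X^N=\sigma^{(N)})\ge T_\ell$ for all $\ell$. The estimation exponent region $\mathcal T$ is the set of all vectors attained by some training sequences and rule. The scheme. Let $\hat\theta_c$ with training sequences $\sigma_c^{(N)}$ attain $T_c=(T_{c,1},\dots,T_{c,L})$ with all $T_{c,\ell}>0$. Put $\kappa_\ell=T_{c,\ell}/B_\ell$,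 $\gamma_\ell=R_\ell/C_\ell$, $\zeta_\ell=(1-\gamma_\ell)/(1+\kappa_\ell)$, fix a reference channel $*\in\{1,\dots,L\}$ and put $\xi_\ell=\zeta_*/\zeta_\ell$. For every $n$ let $M_\ell=\lfloor2^{n\xi_\ell R_\ell}\rfloor$ and choose positive integers $a_m,b_{m,\ell},a_c,b_{c,\ell}$ with $a_m\to\infty$, $a_m/n\to0$, $b_{m,\ell}>n\xi_\ell\gamma_\ell$, $b_{m,\ell}/n\to\xi_\ell\gamma_\ell$, $a_c/n\to\zeta_*$, $b_{c,\ell}/n\to\kappa_\ell\zeta_*$. Each epoch has four phases: (1) a training sequence of length $a_m$ is sent and gives a channel estimate $\hat L_m$, where $\mathbb P_\ell(\hat L_m\ne\ell)\to0$ for every $\ell$; (2) $W_{\hat L_m}$ is sent with codebook $\hat L_m$ and decoded as $\hat W_m$, where codebook $\ell$ (possibly using feedback) has length $b_{m,\ell}$, $M_\ell$ messages, and maximal error probability over $Q_\ell$ tending to $0$; (3) the sequence $\sigma_c^{(a_c)}$ is sent and $\hat\theta_c$ gives a second estimate $\hat L_c$; (4) the symbol $x_{A,\hat L_c}$ (ACCEPT)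 if $\hat W_m=W_{\hat L_m}$, and $x_{R,\hat L_c}$ (REJECT) otherwise, is sent $b_{c,\hat L_c}$ times, where $D(Q_\ell(\cdot|x_{A,\ell})\|Q_\ell(\cdot|x_{R,\ell}))=B_\ell$, and the receiver decodes ACCEPT or REJECT by a test for channel $\hat L_c$; over $Q_\ell$, the test for channel $\ell$ mistakes ACCEPT for REJECT with probability tending to $0$, and REJECT for ACCEPT with probability of exponent $B_\ell$, i.e. $-\frac1{b_{c,\ell}}\log(\cdot)\to B_\ell$. Transmission stops at the end of the first epoch in which ACCEPT is decoded, with decision $(\hat L_m,\hat W_m)$ of that epoch; otherwise a new epoch starts with the same $W$. Proposition. (i) For all $\sigma_c,\hat\theta_c,T_c,*$ as above such schemes exist. Every such sequence of schemes, with any joint laws of the messages with uniform marginals, achieves $R$, and for every $\ell$ $$E_\ell:=\liminf_{n\to\infty}\frac{-\log P_\ell^{(n)}}{\mathbb E_\ell[\tau^{(n)}]}\ \ge\ \frac{T_{c,\ell}}{T_{c,\ell}+B_\ell}\,B_\ell\Big(1-\frac{R_\ell}{C_\ell}\Big).$$ (ii) $$\mathcal E(R)\ \supseteq\bigcup_{\substack{(T_{c,1},\dots,T_{c,L})\in\mathcal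 T\\ T_{c,\ell}>0\ \forall\ell}}\Big\{\Big(\tfrac{T_{c,1}}{T_{c,1}+B_1}B_1\big(1-\tfrac{R_1}{C_1}\big),\dots,\tfrac{T_{c,L}}{T_{c,L}+B_L}B_L\big(1-\tfrac{R_L}{C_L}\big)\Big)\Big\}.$$ -/

import Mathlib

open Filter Topology
open scoped ENNReal

noncomputable section

namespace CompoundFeedback

variable {L : ℕ} {X Y : Type*} [Fintype X] [Fintype Y]

/-- A discrete memoryless channel: `Q x` is the output distribution `Q(· | x)`. -/
abbrev DMC (X Y : Type*) [Fintype Y] : Type _ := X → stdSimplex ℝ Y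

/-- Logarithm to the base 2 on `[0, ∞]`, with value `-∞` at `0`. -/
def log2 (p : ℝ≥0∞) : EReal := ENNReal.log p / ((Real.log 2 : ℝ) : EReal)

/-! ### Information quantities (logarithms to the base 2) -/

/-- Mutual information between input and output, for input distribution `p` and channel `Q`. -/
def mutualInfo (p : stdSimplex ℝ X) (Q : DMC X Y) : ℝ :=
  ∑ x, ∑ y, p.1 x * (Q x).1 y *
    Real.logb 2 ((Q x).1 y / ∑ x', p.1 x' * (Q x').1 y)

/-- Capacity `C_Q`. -/
def capacity (Q : DMC X Y) : ℝ := ⨆ p : stdSimplex ℝ X, mutualInfo p Q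

open Classical in
/-- Kullback–Leibler divergence `D(p ‖ q)`; infinite unless `p ≪ q`. -/
def divergence (p q : stdSimplex ℝ Y) : ℝ≥0∞ :=
  if ∀ y, q.1 y = 0 → p.1 y = 0 then
    ENNReal.ofReal (∑ y, p.1 y * Real.logb 2 (p.1 y / q.1 y))
  else ⊤

/-- Zero-rate Burnashev exponent `B_Q = max_{x_A, x_R} D(Q(·|x_A) ‖ Q(·|x_R))`. -/
def burnashev (Q : DMC X Y) : ℝ≥0∞ := ⨆ (xA : X) (xR : X), divergence (Q xA) (Q xR)

/-! ### Using a channel with feedback for a fixed number of steps -/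

/-- Probability that the outputs of `Q` are `y 0, …, y (t-1)` when the input at each time is the
function `u` of the list of previous outputs. -/
def pathProb (Q : DMC X Y) (u : List Y → X) {t : ℕ} (y : Fin t → Y) : ℝ :=
  ∏ i : Fin t, (Q (u ((List.ofFn y).take i))).1 (y i)

open Classical in
/-- Probability that the list of the first `t` outputs belongs to `A`. -/
def blockProb (Q : DMC X Y) (u : List Y → X) (t : ℕ) (A : Set (List Y)) : ℝ :=
  ∑ y : Fin t → Y, if List.ofFn y ∈ A then pathProb Q u y else 0

/-! ### Variable-rate variable-length coding schemes -/

/-- Output histories `y^t` are lists in chronological order, so one function on lists is the whole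
family of functions on `Y^t`, `t = 0, 1, …`. The stopping time `τ` is the first `t ≥ 1` at which
the history satisfies `halt`. -/
structure CodingScheme (L : ℕ) (X : Type*) (Y : Type*) where
  M : Fin L → ℕ
  M_pos : ∀ l, 0 < M l
  f : (∀ l, Fin (M l)) → List Y → X
  g : List Y → Σ l, Fin (M l)
  halt : List Y → Prop

/-- A joint law of the compound message whose components are uniform. -/
def UniformMarginals {M : Fin L → ℕ} (μ : stdSimplex ℝ (∀ l, Fin (M l))) : Prop :=
  ∀ (l : Fin L) (m : Fin (M l)), ∑ w with w l = m, μ.1 w = 1 / (M l : ℝ)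

namespace CodingScheme

variable (S : CodingScheme L X Y)

/-- `τ > t`, where `t` is the length of the history `h`. -/
def Running (h : List Y) : Prop := ∀ s, 0 < s → s ≤ h.length → ¬ S.halt (h.take s)

/-- `τ = t`, where `t` is the length of the history `h`. -/
def StopsAt (h : List Y) : Prop :=
  0 < h.length ∧ S.halt h ∧ ∀ s, 0 < s → s < h.length → ¬ S.halt (h.take s)

/-- `E[τ] = ∑_{t ≥ 0} P(τ > t)` over the channel `Q`, for the message law `μ`. -/
def expectedLength (Q : DMC X Y) (μ : stdSimplex ℝ (∀ l, Fin (S.M l))) : ℝ≥0∞ :=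
  ∑' t : ℕ, ENNReal.ofReal (∑ w, μ.1 w * blockProb Q (S.f w) t {h | S.Running h})

/-- `P(τ < ∞, A(W, Y^τ)) = ∑_t P(τ = t, A(W, Y^t))`. -/
def stoppedProb (Q : DMC X Y) (μ : stdSimplex ℝ (∀ l, Fin (S.M l)))
    (A : (∀ l, Fin (S.M l)) → List Y → Prop) : ℝ≥0∞ :=
  ∑' t : ℕ, ENNReal.ofReal
    (∑ w, μ.1 w * blockProb Q (S.f w) t {h | S.StopsAt h ∧ A w h})

/-- Probability of error `P(Ŵ ≠ W_{L̂})`, where `(L̂, Ŵ) = g(Y^τ)`. -/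
def errorProb (Q : DMC X Y) (μ : stdSimplex ℝ (∀ l, Fin (S.M l))) : ℝ≥0∞ :=
  S.stoppedProb Q μ fun w h => (S.g h).2 ≠ w (S.g h).1

/-- Rate `E[log M_{L̂}] / E[τ]`. -/
def rate (Q : DMC X Y) (μ : stdSimplex ℝ (∀ l, Fin (S.M l))) : ℝ :=
  (∑ k, (S.stoppedProb Q μ fun _ h => (S.g h).1 = k).toReal * Real.logb 2 (S.M k)) /
    (S.expectedLength Q μ).toReal

/-- `-log P(error) / E[τ]`; it is `+∞` if the probability of error vanishes. -/
def exponent (Q : DMC X Y) (μ : stdSimplex ℝ (∀ l, Fin (S.M l))) : EReal :=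
  -log2 (S.errorProb Q μ) / (((S.expectedLength Q μ).toReal : ℝ) : EReal)

end CodingScheme

/-- The sequence `S n` of coding schemes (with message laws `μ n`) opportunistically achieves the
rate vector `R` over the compound channel `Q`. -/
def AchievesRate (Q : Fin L → DMC X Y) (R : Fin L → ℝ) (S : ℕ → CodingScheme L X Y)
    (μ : ∀ n, stdSimplex ℝ (∀ l, Fin ((S n).M l))) : Prop :=
  ∀ l, (∀ᶠ n in atTop, (S n).expectedLength (Q l) (μ n) ≠ ⊤) ∧
    Tendsto (fun n => ((S n).expectedLength (Q l) (μ n)).toReal) atTop atTop ∧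
    Tendsto (fun n => (S n).errorProb (Q l) (μ n)) atTop (𝓝 0) ∧
    Tendsto (fun n => (S n).rate (Q l) (μ n)) atTop (𝓝 (R l))

/-- Error exponent region at rate vector `R`. The joint law of the components of the compound
message is left unspecified by a coding scheme, so a sequence of schemes counts only if it
performs as required for every choice of joint laws with uniform marginals. -/
def errorExponentRegion (Q : Fin L → DMC X Y) (R : Fin L → ℝ) : Set (Fin L → EReal) :=
  {E | ∃ S : ℕ → CodingScheme L X Y,
    ∀ μ : (∀ n, stdSimplex ℝ (∀ l, Fin ((S n).M l))), (∀ n, UniformMarginals (μ n)) →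
      AchievesRate Q R S μ ∧
      ∀ l, Tendsto (fun n => (S n).exponent (Q l) (μ n)) atTop (𝓝 (E l))}

/-! ### Channel estimation by training -/

/-- The training sequence of length `N` is `σ N 0, …, σ N (N-1)` and the channel estimate is the
function `θ` of the `N` outputs. This says that the estimation error exponents
`lim -(1/N) log P_l(θ(Y^N) ≠ l)` are at least `T l` (with `liminf`, in case they do not exist). -/
def AttainsExponents (Q : Fin L → DMC X Y) (σ : ℕ → ℕ → X) (θ : List Y → Fin L)
    (T : Fin L → ℝ) : Prop :=
  ∀ l, ((T l : ℝ) : EReal) ≤ liminf (fun N : ℕ =>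
    -log2 (ENNReal.ofReal (blockProb (Q l) (fun h => σ N h.length) N {h | θ h ≠ l})) /
      (((N : ℕ) : ℝ) : EReal)) atTop

/-- Estimation error exponent region: vectors of exponents that are attained by some training
sequences and estimation rule. -/
def estimationRegion (Q : Fin L → DMC X Y) : Set (Fin L → ℝ) :=
  {T | ∃ (σ : ℕ → ℕ → X) (θ : List Y → Fin L), AttainsExponents Q σ θ T}

/-! ### The training based scheme with epochs of four phases -/

/-- Ingredients of the scheme for one value of `n`:
training (`am`, `σm`, `θm`), codebooks (`bm`, `enc`, `dec`; the encoders may use feedback),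
re-training (`ac`, `σc`, `θc`), control (`bc`, `xA`, `xR`, `accept`).
Lengths are in channel uses. Control sequences repeat one symbol; `accept l` is the set of
outputs of the control phase that the test for channel `l` decodes as ACCEPT. -/
structure EpochScheme (L : ℕ) (X : Type*) (Y : Type*) where
  M : Fin L → ℕ
  M_pos : ∀ l, 0 < M l
  am : ℕ
  bm : Fin L → ℕ
  ac : ℕ
  bc : Fin L → ℕ
  σm : ℕ → X
  θm : List Y → Fin L
  enc : ∀ l, Fin (M l) → List Y → X
  dec : ∀ l, List Y → Fin (M l)
  σc : ℕ → X
  θc : List Y → Fin L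
  xA : Fin L → X
  xR : Fin L → X
  accept : Fin L → Set (List Y)

namespace EpochScheme

variable (D : EpochScheme L X Y)

/-! In the next definitions `h` is the list of outputs since the beginning of an epoch. -/

/-- Channel estimate `L̂_m` of the training phase. -/
def Lm (h : List Y) : Fin L := D.θm (h.take D.am)

/-- Outputs since the beginning of the message phase. -/
def afterTraining (h : List Y) : List Y := h.drop D.am

/-- Message `Ŵ_m` decoded in the message phase. -/
def Wm (h : List Y) : Fin (D.M (D.Lm h)) :=
  D.dec (D.Lm h) ((D.afterTraining h).take (D.bm (D.Lm h)))

/-- Outputs since the beginning of the re-training phase. -/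
def afterMessage (h : List Y) : List Y := (D.afterTraining h).drop (D.bm (D.Lm h))

/-- Channel estimate `L̂_c` of the re-training phase. -/
def Lc (h : List Y) : Fin L := D.θc ((D.afterMessage h).take D.ac)

/-- Outputs since the beginning of the control phase. -/
def afterRetraining (h : List Y) : List Y := (D.afterMessage h).drop D.ac

/-- The control message is decoded as ACCEPT. -/
def Accepts (h : List Y) : Prop :=
  (D.afterRetraining h).take (D.bc (D.Lc h)) ∈ D.accept (D.Lc h)

/-- Length of the epoch. (If `h` does not contain the complete epoch, the value exceeds the
length of `h`.) -/
def epochLength (h : List Y) : ℕ := D.am + D.bm (D.Lm h) + D.ac + D.bc (D.Lc h)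

/-- Channel input for the compound message `w`, if `h` does not contain the complete epoch. -/
def epochInput (w : ∀ l, Fin (D.M l)) (h : List Y) : X :=
  if h.length < D.am then D.σm h.length
  else if (D.afterTraining h).length < D.bm (D.Lm h) then
    D.enc (D.Lm h) (w (D.Lm h)) (D.afterTraining h)
  else if (D.afterMessage h).length < D.ac then D.σc (D.afterMessage h).length
  else if D.Wm h = w (D.Lm h) then D.xA (D.Lc h)
  else D.xR (D.Lc h)

/-! From here on `h` is the list of all outputs since the beginning of transmission. -/

/-- Outputs of the current, incomplete epoch. -/
def currentEpoch (h : List Y) : List Y :=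
  if 0 < D.epochLength h ∧ D.epochLength h ≤ h.length then
    currentEpoch (h.drop (D.epochLength h))
  else h
termination_by h.length
decreasing_by simp only [List.length_drop]; omega

open Classical in
/-- The final decision `(L̂_m(K), Ŵ_m(K))` if the first epoch `K` that is decoded as ACCEPT is
complete, and `none` otherwise. -/
def decision (h : List Y) : Option (Σ l, Fin (D.M l)) :=
  if 0 < D.epochLength h ∧ D.epochLength h ≤ h.length then
    if D.Accepts h then some ⟨D.Lm h, D.Wm h⟩ else decision (h.drop (D.epochLength h))
  else none
termination_by h.length
decreasing_by simp only [List.length_drop]; omega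

/-- The scheme as a variable-rate variable-length coding scheme. -/
def toCodingScheme : CodingScheme L X Y where
  M := D.M
  M_pos := D.M_pos
  f := fun w h => D.epochInput w (D.currentEpoch h)
  g := fun h => (D.decision h).getD ⟨D.Lm h, D.Wm h⟩
  halt := fun h => (D.decision h).isSome

end EpochScheme

/-! ### Choice of parameters -/

/-- `κ_l = T_{c,l} / B_l`. -/
def kappa (Q : Fin L → DMC X Y) (T : Fin L → ℝ) (l : Fin L) : ℝ :=
  T l / (burnashev (Q l)).toReal

/-- `γ_l = R_l / C_l`. -/
def gam (Q : Fin L → DMC X Y) (R : Fin L → ℝ) (l : Fin L) : ℝ := R l / capacity (Q l)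

/-- `ζ_l = (1 - γ_l) / (1 + κ_l)`. -/
def zeta (Q : Fin L → DMC X Y) (R T : Fin L → ℝ) (l : Fin L) : ℝ :=
  (1 - gam Q R l) / (1 + kappa Q T l)

/-- `ξ_l = ζ_* / ζ_l`, where `*` is the reference channel `r`. -/
def xi (Q : Fin L → DMC X Y) (R T : Fin L → ℝ) (r l : Fin L) : ℝ :=
  zeta Q R T r / zeta Q R T l

/-- The schemes `D n` follow the prescribed choices for the rate vector `R`, the training
exponents `T`, the reference channel `r`, and the re-training sequences and rule `σc`, `θc`. -/
structure IsTrainingScheme (Q : Fin L → DMC X Y) (R T : Fin L → ℝ) (r : Fin L)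
    (σc : ℕ → ℕ → X) (θc : List Y → Fin L) (D : ℕ → EpochScheme L X Y) : Prop where
  /-- Message sizes `2^(n ξ_l R_l)`, rounded to integers. -/
  M_eq : ∀ n l, (D n).M l = ⌊(2 : ℝ) ^ ((n : ℝ) * xi Q R T r l * R l)⌋₊
  am_pos : ∀ n, 0 < (D n).am
  am_lim : Tendsto (fun n => ((D n).am : ℝ) / n) atTop (𝓝 0)
  am_atTop : Tendsto (fun n => (D n).am) atTop atTop
  bm_gt : ∀ (n : ℕ) (l : Fin L), (n : ℝ) * (xi Q R T r l * gam Q R l) < (D n).bm l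
  bm_lim : ∀ l, Tendsto (fun n => ((D n).bm l : ℝ) / n) atTop (𝓝 (xi Q R T r l * gam Q R l))
  ac_pos : ∀ n, 0 < (D n).ac
  ac_lim : Tendsto (fun n => ((D n).ac : ℝ) / n) atTop (𝓝 (zeta Q R T r))
  bc_pos : ∀ n l, 0 < (D n).bc l
  bc_lim : ∀ l, Tendsto (fun n => ((D n).bc l : ℝ) / n) atTop (𝓝 (kappa Q T l * zeta Q R T r))
  /-- The channel estimate of the training phase is reliable: `P_l(L̂_m ≠ l) → 0`. -/
  training : ∀ l, Tendsto (fun n => blockProb (Q l) (fun h => (D n).σm h.length) (D n).am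
    {h | (D n).θm h ≠ l}) atTop (𝓝 0)
  /-- Codebook `l` is reliable over `Q l`: its maximal error probability tends to `0`. -/
  codebook : ∀ l, ∀ ε > 0, ∀ᶠ n in atTop, ∀ m : Fin ((D n).M l),
    blockProb (Q l) ((D n).enc l m) ((D n).bm l) {h | (D n).dec l h ≠ m} ≤ ε
  σc_eq : ∀ n, (D n).σc = σc (D n).ac
  θc_eq : ∀ n, (D n).θc = θc
  /-- The control symbols are maximally separated. -/
  control : ∀ n l, divergence (Q l ((D n).xA l)) (Q l ((D n).xR l)) = burnashev (Q l)
  /-- The probability of decoding REJECT when ACCEPT is sent over `Q l` tends to `0`. -/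
  test_accept : ∀ l, Tendsto (fun n => blockProb (Q l) (fun _ => (D n).xA l) ((D n).bc l)
    ((D n).accept l)ᶜ) atTop (𝓝 0)
  /-- The probability of decoding ACCEPT when REJECT is sent over `Q l` has exponent `B_l`. -/
  test_reject : ∀ l, Tendsto (fun n =>
    -log2 (ENNReal.ofReal (blockProb (Q l) (fun _ => (D n).xR l) ((D n).bc l)
      ((D n).accept l))) / ((((D n).bc l : ℕ) : ℝ) : EReal))
    atTop (𝓝 ((burnashev (Q l) : ℝ≥0∞) : EReal))

/-- `T_l / (T_l + B_l) · B_l (1 - R_l / C_l)`. -/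
def exponentBound (Q : Fin L → DMC X Y) (R T : Fin L → ℝ) (l : Fin L) : ℝ :=
  T l / (T l + (burnashev (Q l)).toReal) *
    ((burnashev (Q l)).toReal * (1 - R l / capacity (Q l)))

end CompoundFeedback

end

/-!
An epoch of the scheme, started afresh with a compound message `w`, has a law that depends only on
`w` and on the channel. Hence the expected length and the probabilities of the final decisions
satisfy a renewal equation: each of them is the contribution of one epoch plus the probability of
REJECT times itself. The probability of REJECT tends to `0`, so all quantities are, up to a factor
that tends to `1`, those of a single epoch (`EpochScheme.partialSum_le` and
`EpochScheme.le_partialSum`). All bounds hold for each message `w` separately, because codebook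
errors are maximal errors; the joint law of the messages plays no role in the upper bounds.

Over the channel `Q l` both channel estimates of an epoch equal `l` with probability tending to
`1`, and then the epoch has length `n ξ_l (1 + o(1))`. A wrong decision becomes final only if the
second channel estimate is wrong, or if it is right and the test mistakes REJECT for ACCEPT. Both
probabilities have exponent `ζ_* T_l` relative to `n`, by the choice of the lengths `a_c` and
`b_c`; division by `ξ_l` gives the bound (`IsReliableSequence.le_liminf_exponent`).

Existence rests on two classical facts. The tests come from Stein's lemma for typical sets, where a
slowly vanishing tolerance makes the exponent exact (`exists_test`). The codebooks come from
Feinstein's lemma (`exists_code`, `eventually_exists_code`) and a diagonal argument that lets the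
rate tend to capacity (`exists_codebooks`).

Membership in the error exponent region requires that the exponent is attained exactly. A codebook
might err too rarely for that, or never, if there is only one message. So the message sets are taken
to have at least two elements, and the codebooks are dithered (`exists_dithered_code`): a channel
output of length about `√n` that occurs with a subexponential probability makes the decoder choose
a fixed message. Since a uniformly distributed message differs from it with probability at least
`1 / 2`, the probability of a wrong decision in the message phase is not exponentially small,
and the exponent is that of the test (`IsNearTrainingScheme.eventually_le_errorProb`). Such outputs
exist because a finite Burnashev exponent makes all rows of the channel mutually absolutely
continuous, and positive capacity makes two of them different.
-/

noncomputable section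

namespace CompoundFeedback

variable {L : ℕ} {X Y : Type*} [Fintype Y]

/-! ### Expectations over a channel used with feedback -/

/-- Expectation of `φ` of the first `t` outputs of `Q`, when the inputs are chosen by `u` as a
function of the previous outputs. The recursion is on the first output. -/
def pathExp (Q : DMC X Y) : ℕ → (List Y → X) → (List Y → ℝ) → ℝ
  | 0, _, φ => φ []
  | t + 1, u, φ =>
    ∑ y, (Q (u [])).1 y * pathExp Q t (fun h => u (y :: h)) (fun h => φ (y :: h))

theorem DMC.nonneg (Q : DMC X Y) (x : X) (y : Y) : 0 ≤ (Q x).1 y := (Q x).2.1 y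

theorem DMC.sum_eq_one (Q : DMC X Y) (x : X) : ∑ y, (Q x).1 y = 1 := (Q x).2.2

theorem pathExp_eq_sum (Q : DMC X Y) (t : ℕ) (u : List Y → X) (φ : List Y → ℝ) :
    pathExp Q t u φ = ∑ y : Fin t → Y, pathProb Q u y * φ (List.ofFn y) := by
  induction t generalizing u φ with
  | zero => simp [pathExp, pathProb]
  | succ t ih =>
    rw [← (Fin.consEquiv (fun _ => Y)).sum_comp, Fintype.sum_prod_type]
    simp only [pathExp, ih, Finset.mul_sum]
    refine Finset.sum_congr rfl fun y _ => Finset.sum_congr rfl fun z _ => ?_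
    simp [pathProb, Fin.consEquiv, Fin.prod_univ_succ, List.ofFn_succ, mul_assoc]

theorem blockProb_eq_pathExp (Q : DMC X Y) (u : List Y → X) (t : ℕ) (A : Set (List Y)) :
    blockProb Q u t A = pathExp Q t u (A.indicator 1) := by
  classical
  rw [pathExp_eq_sum, blockProb]
  refine Finset.sum_congr rfl fun y _ => ?_
  by_cases h : List.ofFn y ∈ A <;> simp [h]

/-- Monotonicity, for strategies that need to agree only on histories shorter than `t`. -/
theorem pathExp_mono' (Q : DMC X Y) {t : ℕ} {u v : List Y → X} {φ ψ : List Y → ℝ}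
    (huv : ∀ h, h.length < t → u h = v h) (h : ∀ h, h.length = t → φ h ≤ ψ h) :
    pathExp Q t u φ ≤ pathExp Q t v ψ := by
  induction t generalizing u v φ ψ with
  | zero => exact h _ rfl
  | succ t ih =>
    simp only [pathExp, huv [] (by simp)]
    refine Finset.sum_le_sum fun y _ => mul_le_mul_of_nonneg_left (ih ?_ ?_) (Q.nonneg _ _)
    · intro g hg; exact huv _ (by simpa using hg)
    · intro g hg; exact h _ (by simpa using hg)

theorem pathExp_congr (Q : DMC X Y) {t : ℕ} {u v : List Y → X} {φ ψ : List Y → ℝ}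
    (huv : ∀ h, h.length < t → u h = v h) (h : ∀ h, h.length = t → φ h = ψ h) :
    pathExp Q t u φ = pathExp Q t v ψ :=
  le_antisymm (pathExp_mono' Q huv fun g hg => (h g hg).le)
    (pathExp_mono' Q (fun g hg => (huv g hg).symm) fun g hg => (h g hg).ge)

theorem pathExp_mono (Q : DMC X Y) {t : ℕ} {u : List Y → X} {φ ψ : List Y → ℝ}
    (h : ∀ h, h.length = t → φ h ≤ ψ h) : pathExp Q t u φ ≤ pathExp Q t u ψ :=
  pathExp_mono' Q (fun _ _ => rfl) h

@[simp] theorem pathExp_const (Q : DMC X Y) (t : ℕ) (u : List Y → X) (c : ℝ) :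
    pathExp Q t u (fun _ => c) = c := by
  induction t generalizing u with
  | zero => rfl
  | succ t ih => simp [pathExp, ih, ← Finset.sum_mul, Q.sum_eq_one]

theorem pathExp_add (Q : DMC X Y) (t : ℕ) (u : List Y → X) (φ ψ : List Y → ℝ) :
    pathExp Q t u (fun h => φ h + ψ h) = pathExp Q t u φ + pathExp Q t u ψ := by
  simp only [pathExp_eq_sum, mul_add, Finset.sum_add_distrib]

theorem pathExp_const_mul (Q : DMC X Y) (t : ℕ) (u : List Y → X) (c : ℝ) (φ : List Y → ℝ) :
    pathExp Q t u (fun h => c * φ h) = c * pathExp Q t u φ := by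
  simp only [pathExp_eq_sum, Finset.mul_sum, mul_left_comm]

theorem pathExp_mul_const (Q : DMC X Y) (t : ℕ) (u : List Y → X) (c : ℝ) (φ : List Y → ℝ) :
    pathExp Q t u (fun h => φ h * c) = pathExp Q t u φ * c := by
  simp only [pathExp_eq_sum, Finset.sum_mul, mul_assoc]

theorem pathExp_le (Q : DMC X Y) {t : ℕ} {u : List Y → X} {φ : List Y → ℝ} {c : ℝ}
    (h : ∀ h, h.length = t → φ h ≤ c) : pathExp Q t u φ ≤ c :=
  (pathExp_mono Q h).trans_eq (pathExp_const Q t u c)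

theorem le_pathExp (Q : DMC X Y) {t : ℕ} {u : List Y → X} {φ : List Y → ℝ} {c : ℝ}
    (h : ∀ h, h.length = t → c ≤ φ h) : c ≤ pathExp Q t u φ :=
  (pathExp_const Q t u c).symm.trans_le (pathExp_mono Q h)

/-- Tower property: condition on the first `s` outputs. -/
theorem pathExp_split (Q : DMC X Y) (s t : ℕ) (u : List Y → X) (φ : List Y → ℝ) :
    pathExp Q (s + t) u φ =
      pathExp Q s u (fun h => pathExp Q t (fun g => u (h ++ g)) (fun g => φ (h ++ g))) := by
  induction s generalizing u φ with
  | zero => simp [pathExp]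
  | succ s ih =>
    rw [Nat.succ_add]
    simp only [pathExp, ih, List.cons_append]

theorem pathExp_take (Q : DMC X Y) (s t : ℕ) (u : List Y → X) (φ : List Y → ℝ) :
    pathExp Q (s + t) u (fun h => φ (h.take s)) = pathExp Q s u φ := by
  rw [pathExp_split]
  refine pathExp_congr Q (fun _ _ => rfl) fun h hh => ?_
  simp [List.take_append_of_le_length hh.ge, List.take_of_length_le hh.le]

theorem blockProb_nonneg (Q : DMC X Y) (u : List Y → X) (t : ℕ) (A : Set (List Y)) :
    0 ≤ blockProb Q u t A := by
  rw [blockProb_eq_pathExp]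
  exact le_pathExp Q fun h _ => Set.indicator_nonneg (by simp) h

theorem blockProb_le_one (Q : DMC X Y) (u : List Y → X) (t : ℕ) (A : Set (List Y)) :
    blockProb Q u t A ≤ 1 := by
  rw [blockProb_eq_pathExp]
  exact pathExp_le Q fun h _ => Set.indicator_le_self' (by simp) h

theorem blockProb_compl (Q : DMC X Y) (u : List Y → X) (t : ℕ) (A : Set (List Y)) :
    blockProb Q u t Aᶜ = 1 - blockProb Q u t A := by
  rw [eq_sub_iff_add_eq, blockProb_eq_pathExp, blockProb_eq_pathExp, ← pathExp_add]
  refine (pathExp_congr Q (fun _ _ => rfl) fun h _ => ?_).trans (pathExp_const Q t u 1)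
  by_cases hA : h ∈ A <;> simp [hA]

end CompoundFeedback
end

noncomputable section

namespace CompoundFeedback

variable {L : ℕ} {X Y : Type*}

/-! ### Parsing of an epoch -/

namespace EpochScheme

variable (D : EpochScheme L X Y)

/-- The decision `(L̂_m, Ŵ_m)` of an epoch. -/
def estimate (h : List Y) : Σ l, Fin (D.M l) := ⟨D.Lm h, D.Wm h⟩

/-- The outputs of the message phase. -/
def messageBlock (h : List Y) : List Y := (D.afterTraining h).take (D.bm (D.Lm h))

/-- The outputs of the control phase. -/
def controlBlock (h : List Y) : List Y := (D.afterRetraining h).take (D.bc (D.Lc h))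

theorem Lm_congr {a b : List Y} (h : a.take D.am = b.take D.am) : D.Lm a = D.Lm b := by
  simp [Lm, h]

theorem messageBlock_eq (h : List Y) :
    D.messageBlock h = (h.take (D.am + D.bm (D.Lm h))).drop D.am := by
  simp [messageBlock, afterTraining, List.drop_take]

theorem afterRetraining_eq (h : List Y) :
    D.afterRetraining h = h.drop (D.am + D.bm (D.Lm h) + D.ac) := by
  simp [afterRetraining, afterMessage, afterTraining, List.drop_drop, add_assoc]

theorem Lc_eq (h : List Y) : D.Lc h =
    D.θc ((h.take (D.am + D.bm (D.Lm h) + D.ac)).drop (D.am + D.bm (D.Lm h))) := by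
  simp [Lc, afterMessage, afterTraining, List.drop_drop, List.drop_take]

theorem controlBlock_eq (h : List Y) :
    D.controlBlock h = (h.take (D.epochLength h)).drop (D.am + D.bm (D.Lm h) + D.ac) := by
  simp [controlBlock, afterRetraining_eq, epochLength, List.drop_take]

theorem estimate_eq (h : List Y) :
    D.estimate h = ⟨D.Lm h, D.dec (D.Lm h) (D.messageBlock h)⟩ := rfl

theorem accepts_iff (h : List Y) : D.Accepts h ↔ D.controlBlock h ∈ D.accept (D.Lc h) := Iff.rfl

/-- An epoch is determined by its own outputs. -/
theorem blocks_congr {a b : List Y} {n : ℕ} (hn : D.epochLength a ≤ n)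
    (hab : a.take n = b.take n) :
    D.Lm b = D.Lm a ∧ D.messageBlock b = D.messageBlock a ∧ D.Lc b = D.Lc a ∧
      D.controlBlock b = D.controlBlock a ∧ D.epochLength b = D.epochLength a := by
  have take_eq : ∀ m ≤ n, b.take m = a.take m := fun m hm => by
    have := congrArg (List.take m) hab
    simpa [List.take_take, hm] using this.symm
  have h1 : D.Lm b = D.Lm a :=
    D.Lm_congr (take_eq _ (by unfold epochLength at hn; omega))
  have h2 : D.messageBlock b = D.messageBlock a := by
    rw [messageBlock_eq, messageBlock_eq, h1, take_eq _ (by unfold epochLength at hn; omega)]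
  have h3 : D.Lc b = D.Lc a := by
    rw [Lc_eq, Lc_eq, h1, take_eq _ (by unfold epochLength at hn; omega)]
  have h4 : D.epochLength b = D.epochLength a := by simp only [epochLength, h1, h3]
  refine ⟨h1, h2, h3, ?_, h4⟩
  rw [controlBlock_eq, controlBlock_eq, h4, h1, take_eq _ hn]

theorem blocks_append {a : List Y} (ha : D.epochLength a ≤ a.length) (g : List Y) :
    D.Lm (a ++ g) = D.Lm a ∧ D.messageBlock (a ++ g) = D.messageBlock a ∧
      D.Lc (a ++ g) = D.Lc a ∧ D.controlBlock (a ++ g) = D.controlBlock a ∧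
      D.epochLength (a ++ g) = D.epochLength a :=
  D.blocks_congr ha (by simp)

theorem epochLength_append {a : List Y} (ha : D.epochLength a ≤ a.length) (g : List Y) :
    D.epochLength (a ++ g) = D.epochLength a := (D.blocks_append ha g).2.2.2.2

theorem estimate_append {a : List Y} (ha : D.epochLength a ≤ a.length) (g : List Y) :
    D.estimate (a ++ g) = D.estimate a := by
  obtain ⟨h1, h2, -⟩ := D.blocks_append ha g
  rw [estimate_eq, estimate_eq, h1, h2]

theorem accepts_append {a : List Y} (ha : D.epochLength a ≤ a.length) (g : List Y) :
    D.Accepts (a ++ g) ↔ D.Accepts a := by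
  obtain ⟨-, -, h3, h4, -⟩ := D.blocks_append ha g
  rw [accepts_iff, accepts_iff, h3, h4]

/-- A prefix of an incomplete epoch does not look complete in hindsight. -/
theorem length_lt_epochLength_append {a : List Y} (ha : a.length < D.epochLength a)
    (g : List Y) : a.length < D.epochLength (a ++ g) := by
  by_contra! hlt
  have := (D.blocks_congr hlt (b := a) (by simp)).2.2.2.2
  omega

/-- An upper bound on the length of an epoch. -/
def maxLength : ℕ := D.am + ∑ l, D.bm l + D.ac + ∑ l, D.bc l

theorem epochLength_le (h : List Y) : D.epochLength h ≤ D.maxLength := by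
  have h1 := Finset.single_le_sum (f := D.bm) (fun _ _ => Nat.zero_le _)
    (Finset.mem_univ (D.Lm h))
  have h2 := Finset.single_le_sum (f := D.bc) (fun _ _ => Nat.zero_le _)
    (Finset.mem_univ (D.Lc h))
  unfold epochLength maxLength
  omega

/-! ### Renewal at the end of a rejected epoch -/

theorem currentEpoch_of_lt {h : List Y} (hh : h.length < D.epochLength h) :
    D.currentEpoch h = h := by
  rw [currentEpoch, if_neg (by omega)]

theorem decision_of_lt {h : List Y} (hh : h.length < D.epochLength h) :
    D.decision h = none := by
  rw [decision, if_neg (by omega)]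

theorem currentEpoch_append {a : List Y} (h0 : 0 < a.length) (ha : D.epochLength a = a.length)
    (g : List Y) : D.currentEpoch (a ++ g) = D.currentEpoch g := by
  rw [currentEpoch, D.epochLength_append ha.le, if_pos (by simp; omega), ha]
  simp

open Classical in
theorem decision_append {a : List Y} (h0 : 0 < a.length) (ha : D.epochLength a = a.length)
    (g : List Y) : D.decision (a ++ g) =
      if D.Accepts a then some (D.estimate a) else D.decision g := by
  rw [decision, D.epochLength_append ha.le, if_pos (by simp; omega), ha]
  have h1 : (⟨D.Lm (a ++ g), D.Wm (a ++ g)⟩ : Σ l, Fin (D.M l)) = D.estimate a :=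
    D.estimate_append ha.le g
  by_cases hacc : D.Accepts a
  · rw [if_pos hacc, if_pos ((D.accepts_append ha.le g).2 hacc), h1]
  · rw [if_neg hacc, if_neg fun h => hacc ((D.accepts_append ha.le g).1 h)]
    simp

end EpochScheme
end CompoundFeedback
end

noncomputable section

namespace CompoundFeedback

variable {L : ℕ} {X Y : Type*}

namespace EpochScheme

variable (D : EpochScheme L X Y)

theorem epochLength_pos (hD : 0 < D.am) (h : List Y) : 0 < D.epochLength h := by
  unfold epochLength; omega

theorem decision_take_of_lt {h : List Y} (hh : h.length < D.epochLength h) (s : ℕ) :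
    D.decision (h.take s) = none := by
  refine D.decision_of_lt ?_
  by_contra! hle
  have := D.epochLength_append hle (h.drop s)
  rw [List.take_append_drop] at this
  have := List.length_take_le s h
  have := List.length_take_le' s h
  omega

theorem decision_take_of_lt_length {a : List Y} (ha : D.epochLength a = a.length) {s : ℕ}
    (hs : s < a.length) : D.decision (a.take s) = none := by
  refine D.decision_of_lt ?_
  by_contra! hle
  have := D.epochLength_append hle (a.drop s)
  rw [List.take_append_drop] at this
  have := List.length_take_le s a
  omega

theorem running_of_lt {h : List Y} (hh : h.length < D.epochLength h) :
    D.toCodingScheme.Running h := fun s _ _ => by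
  simp [toCodingScheme, D.decision_take_of_lt hh]

theorem not_stopsAt_of_lt {h : List Y} (hh : h.length < D.epochLength h) :
    ¬ D.toCodingScheme.StopsAt h := fun hs => by
  simpa [toCodingScheme, D.decision_of_lt hh] using hs.2.1

variable {D}

theorem decision_nil (hD : 0 < D.am) : D.decision [] = none :=
  D.decision_of_lt (D.epochLength_pos hD [])

section Complete

variable {a : List Y} (h0 : 0 < a.length) (ha : D.epochLength a = a.length)
include h0 ha

theorem not_running_append (hacc : D.Accepts a) (g : List Y) :
    ¬ D.toCodingScheme.Running (a ++ g) := fun hr => by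
  refine hr a.length h0 (by simp) ?_
  have := D.decision_append h0 ha []
  rw [List.append_nil, if_pos hacc] at this
  simp [toCodingScheme, this]

theorem running_append_iff (hD : 0 < D.am) (hrej : ¬ D.Accepts a) (g : List Y) :
    D.toCodingScheme.Running (a ++ g) ↔ D.toCodingScheme.Running g := by
  constructor
  · intro hr s hs hsg
    have := hr (a.length + s) (by omega) (by simp; omega)
    simpa [toCodingScheme, List.take_length_add_append, D.decision_append h0 ha, hrej] using this
  · intro hr s hs hsg
    rcases lt_trichotomy s a.length with hlt | rfl | hgt
    · rw [List.take_append_of_le_length hlt.le]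
      simp [toCodingScheme, D.decision_take_of_lt_length ha hlt]
    · have := D.decision_append h0 ha []
      rw [List.append_nil, if_neg hrej, decision_nil hD] at this
      simp [toCodingScheme, this]
    · obtain ⟨k, rfl⟩ := Nat.exists_eq_add_of_lt hgt
      have := hr (k + 1) (by omega) (by simp at hsg; omega)
      rw [add_assoc, List.take_length_add_append]
      simpa [toCodingScheme, D.decision_append h0 ha, hrej] using this

theorem stopsAt_append_iff_eq_nil (hacc : D.Accepts a) (g : List Y) :
    D.toCodingScheme.StopsAt (a ++ g) ↔ g = [] := by
  have hdec := D.decision_append h0 ha []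
  rw [List.append_nil, if_pos hacc] at hdec
  constructor
  · intro hs
    by_contra hg
    refine hs.2.2 a.length h0 (by simpa using List.length_pos_iff.2 hg) ?_
    simp [toCodingScheme, hdec]
  · rintro rfl
    rw [List.append_nil]
    refine ⟨h0, by simp [toCodingScheme, hdec], fun s _ hs' => ?_⟩
    simp [toCodingScheme, D.decision_take_of_lt_length ha hs']

theorem stopsAt_append_iff (hD : 0 < D.am) (hrej : ¬ D.Accepts a) (g : List Y) :
    D.toCodingScheme.StopsAt (a ++ g) ↔ D.toCodingScheme.StopsAt g := by
  rcases eq_or_ne g [] with rfl | hg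
  · refine iff_of_false (fun hs => ?_) fun hs => by simpa using hs.1
    have := D.decision_append h0 ha []
    rw [if_neg hrej, decision_nil hD, List.append_nil] at this
    simpa [toCodingScheme, this] using hs.2.1
  have hdec : ∀ g, D.decision (a ++ g) = D.decision g := fun g => by
    rw [D.decision_append h0 ha, if_neg hrej]
  constructor
  · rintro ⟨-, h1, h2⟩
    refine ⟨List.length_pos_iff.2 hg, by simpa [toCodingScheme, hdec] using h1, fun s hs hs' => ?_⟩
    have := h2 (a.length + s) (by omega) (by simpa using hs')
    simpa [toCodingScheme, List.take_length_add_append, hdec] using this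
  · rintro ⟨h0', h1, h2⟩
    refine ⟨by simp; omega, by simpa [toCodingScheme, hdec] using h1, fun s hs hs' => ?_⟩
    rcases lt_trichotomy s a.length with hlt | rfl | hgt
    · rw [List.take_append_of_le_length hlt.le]
      simp [toCodingScheme, D.decision_take_of_lt_length ha hlt]
    · have := hdec []
      rw [List.append_nil, decision_nil hD] at this
      simp [toCodingScheme, this]
    · obtain ⟨k, rfl⟩ := Nat.exists_eq_add_of_lt hgt
      have := h2 (k + 1) (by omega) (by simp at hs'; omega)
      rw [add_assoc, List.take_length_add_append]
      simpa [toCodingScheme, hdec] using this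

end Complete

/-- The function `a` of the output history is compatible with the renewal structure of the
epochs: it equals `ρ` during the first epoch, it starts afresh after a rejected epoch, and after
an accepted epoch it is a reward `G` of the decision, received once. -/
structure IsRenewalReward (D : EpochScheme L X Y) (ρ : ℝ) (G : (Σ l, Fin (D.M l)) → ℝ)
    (a : List Y → ℝ) : Prop where
  incomplete : ∀ h, h.length < D.epochLength h → a h = ρ
  accepted : ∀ h, 0 < h.length → D.epochLength h = h.length → D.Accepts h →
    a h = G (D.estimate h) ∧ ∀ g, g ≠ [] → a (h ++ g) = 0
  rejected : ∀ h, 0 < h.length → D.epochLength h = h.length → ¬ D.Accepts h →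
    ∀ g, a (h ++ g) = a g

open Classical in
theorem isRenewalReward_running (hD : 0 < D.am) :
    D.IsRenewalReward 1 0 ({h | D.toCodingScheme.Running h}.indicator 1) where
  incomplete h hh := by simp [D.running_of_lt hh]
  accepted h h0 hh hacc := by
    refine ⟨?_, fun g _ => by simp [not_running_append h0 hh hacc g]⟩
    have := not_running_append h0 hh hacc []
    rw [List.append_nil] at this
    simp [this]
  rejected h h0 hh hrej g := by
    simp only [Set.indicator, Set.mem_ofPred_eq, running_append_iff h0 hh hD hrej g]
    rfl

open Classical in
theorem isRenewalReward_stopsAt (hD : 0 < D.am) (P : (Σ l, Fin (D.M l)) → Prop) :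
    D.IsRenewalReward 0 ({e | P e}.indicator 1)
      ({h | D.toCodingScheme.StopsAt h ∧ P (D.toCodingScheme.g h)}.indicator 1) where
  incomplete h hh := by simp [D.not_stopsAt_of_lt hh]
  accepted h h0 hh hacc := by
    refine ⟨?_, fun g hg => by simp [stopsAt_append_iff_eq_nil h0 hh hacc g, hg]⟩
    have h1 := (stopsAt_append_iff_eq_nil h0 hh hacc []).2 rfl
    have h2 := D.decision_append h0 hh []
    rw [List.append_nil] at h1 h2
    have h3 : D.toCodingScheme.g h = D.estimate h := by simp [toCodingScheme, h2, hacc]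
    simp only [Set.indicator, Set.mem_ofPred_eq, h1, h3, true_and]
    rfl
  rejected h h0 hh hrej g := by
    have h1 : D.toCodingScheme.StopsAt g → D.toCodingScheme.g (h ++ g) = D.toCodingScheme.g g := by
      intro hs
      obtain ⟨x, hx⟩ := Option.isSome_iff_exists.1 hs.2.1
      simp [toCodingScheme, D.decision_append h0 hh, hrej, hx]
    by_cases hs : D.toCodingScheme.StopsAt g
    · by_cases hP : P (D.toCodingScheme.g g) <;>
        simp [stopsAt_append_iff h0 hh hD hrej g, hs, h1 hs, hP]
    · simp [stopsAt_append_iff h0 hh hD hrej g, hs]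

open Classical in
/-- What the renewal argument collects at the end of the first epoch: `ρ` per channel use, and
either the reward of the decision or, after a rejection, the value `c` of starting afresh. -/
def epochValue (D : EpochScheme L X Y) (ρ : ℝ) (G : (Σ l, Fin (D.M l)) → ℝ) (c : ℝ)
    (h : List Y) : ℝ :=
  ρ * D.epochLength h + if D.Accepts h then G (D.estimate h) else c

theorem epochValue_append (ρ : ℝ) (G : (Σ l, Fin (D.M l)) → ℝ) (c : ℝ) {h : List Y}
    (hh : D.epochLength h ≤ h.length) (g : List Y) :
    D.epochValue ρ G c (h ++ g) = D.epochValue ρ G c h := by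
  simp only [epochValue, D.epochLength_append hh, D.estimate_append hh]
  by_cases hacc : D.Accepts h
  · rw [if_pos hacc, if_pos ((D.accepts_append hh g).2 hacc)]
  · rw [if_neg hacc, if_neg fun h' => hacc ((D.accepts_append hh g).1 h')]

variable [Fintype Y] (Q : DMC X Y)

/-- The expected sum of `a` over the times `0, …, T - 1` counted from the history `h`, for the
channel inputs `u`. -/
def partialSum (u : List Y → X) (a : List Y → ℝ) (T : ℕ) (h : List Y) : ℝ :=
  ∑ t ∈ Finset.range T, pathExp Q t (fun g => u (h ++ g)) (fun g => a (h ++ g))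

theorem partialSum_succ (u : List Y → X) (a : List Y → ℝ) (T : ℕ) (h : List Y) :
    partialSum Q u a (T + 1) h =
      a h + ∑ y, (Q (u h)).1 y * partialSum Q u a T (h ++ [y]) := by
  simp only [partialSum, Finset.sum_range_succ', pathExp, List.append_nil, Finset.mul_sum]
  rw [Finset.sum_comm, add_comm]
  simp

/-- Conditional expectation of `φ` given the history `h`, where `φ` is a function of the first
`D.maxLength` outputs and the inputs are those of the first epoch. -/
def condExp (D : EpochScheme L X Y) (w : ∀ l, Fin (D.M l)) (φ : List Y → ℝ) (h : List Y) : ℝ :=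
  pathExp Q (D.maxLength - h.length) (fun g => D.epochInput w (h ++ g)) (fun g => φ (h ++ g))

theorem condExp_step (w : ∀ l, Fin (D.M l)) (φ : List Y → ℝ) {h : List Y}
    (hh : h.length < D.maxLength) :
    condExp Q D w φ h = ∑ y, (Q (D.epochInput w h)).1 y * condExp Q D w φ (h ++ [y]) := by
  obtain ⟨k, hk⟩ := Nat.exists_eq_add_of_lt hh
  have e1 : D.maxLength - h.length = k + 1 := by omega
  have e2 : ∀ y : Y, D.maxLength - (h ++ [y]).length = k := fun y => by simp; omega
  simp only [condExp, e1, e2, pathExp, List.append_nil, List.append_assoc, List.cons_append,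
    List.nil_append]

theorem condExp_of_forall_append (w : ∀ l, Fin (D.M l)) {φ : List Y → ℝ} {h : List Y}
    (hφ : ∀ g, φ (h ++ g) = φ h) : condExp Q D w φ h = φ h := by
  simp [condExp, hφ]

section Renewal

variable {Q} {ρ : ℝ} {G : (Σ l, Fin (D.M l)) → ℝ} {a : List Y → ℝ}

theorem partialSum_of_rejected (w : ∀ l, Fin (D.M l))
    (ha : D.IsRenewalReward ρ G a) {h : List Y}
    (h0 : 0 < h.length) (hh : D.epochLength h = h.length) (hrej : ¬ D.Accepts h) (T : ℕ) :
    partialSum Q (D.toCodingScheme.f w) a T h =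
      partialSum Q (D.toCodingScheme.f w) a T [] := by
  simp only [partialSum, toCodingScheme, D.currentEpoch_append h0 hh, List.nil_append,
    ha.rejected h h0 hh hrej]

theorem partialSum_succ_of_accepted (u : List Y → X) (ha : D.IsRenewalReward ρ G a) {h : List Y}
    (h0 : 0 < h.length) (hh : D.epochLength h = h.length) (hacc : D.Accepts h) (T : ℕ) :
    partialSum Q u a (T + 1) h = G (D.estimate h) := by
  rw [partialSum_succ, (ha.accepted h h0 hh hacc).1, add_eq_left]
  refine Finset.sum_eq_zero fun y _ => mul_eq_zero_of_right _ (Finset.sum_eq_zero fun t _ => ?_)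
  simp [(ha.accepted h h0 hh hacc).2]

theorem length_le_condExp_epochValue (w : ∀ l, Fin (D.M l)) (hρ : 0 ≤ ρ) (hG : ∀ e, 0 ≤ G e)
    {c : ℝ} (hc : 0 ≤ c) {h : List Y} (hh : h.length < D.epochLength h) :
    ρ * h.length ≤ condExp Q D w (D.epochValue ρ G c) h := by
  refine le_pathExp Q fun g _ => ?_
  have h1 := D.length_lt_epochLength_append hh g
  have h2 : (h.length : ℝ) ≤ D.epochLength (h ++ g) := by exact_mod_cast h1.le
  refine (mul_le_mul_of_nonneg_left h2 hρ).trans (le_add_of_nonneg_right ?_)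
  split_ifs
  · exact hG _
  · exact hc

/-- Renewal argument, upper bound: if starting afresh is worth at most `c` under the assumption
that starting afresh after one epoch is worth `c`, then it is worth at most `c`. -/
theorem partialSum_le (hD : 0 < D.am) (w : ∀ l, Fin (D.M l)) (ha : D.IsRenewalReward ρ G a)
    (hρ : 0 ≤ ρ) (hG : ∀ e, 0 ≤ G e) {c : ℝ} (hc : 0 ≤ c)
    (hfix : condExp Q D w (D.epochValue ρ G c) [] ≤ c) (T : ℕ) :
    partialSum Q (D.toCodingScheme.f w) a T [] ≤ c := by
  suffices H : ∀ T h, h.length < D.epochLength h →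
      partialSum Q (D.toCodingScheme.f w) a T h ≤
        condExp Q D w (D.epochValue ρ G c) h - ρ * h.length by
    have := H T [] (D.epochLength_pos hD [])
    simp only [List.length_nil, Nat.cast_zero, mul_zero, sub_zero] at this
    exact this.trans hfix
  intro T
  induction T with
  | zero =>
    intro h hh
    simpa [partialSum] using length_le_condExp_epochValue (Q := Q) w hρ hG hc hh
  | succ T ih =>
    intro h hh
    have h1 : D.toCodingScheme.f w h = D.epochInput w h := by
      simp [toCodingScheme, D.currentEpoch_of_lt hh]
    rw [partialSum_succ, ha.incomplete h hh, h1,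
      condExp_step Q w _ (hh.trans_le (D.epochLength_le h))]
    have key : ∀ y, partialSum Q (D.toCodingScheme.f w) a T (h ++ [y]) ≤
        condExp Q D w (D.epochValue ρ G c) (h ++ [y]) - ρ * (h.length + 1) := by
      intro y
      have hlen : (h ++ [y]).length = h.length + 1 := by simp
      rcases lt_or_ge (h ++ [y]).length (D.epochLength (h ++ [y])) with hlt | hge
      · simpa using ih (h ++ [y]) hlt
      · have hex : D.epochLength (h ++ [y]) = (h ++ [y]).length := by
          have := D.length_lt_epochLength_append hh [y]
          omega
        rw [condExp_of_forall_append Q w (D.epochValue_append ρ G c hge)]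
        by_cases hacc : D.Accepts (h ++ [y])
        · have h2 : partialSum Q (D.toCodingScheme.f w) a T (h ++ [y]) ≤
              G (D.estimate (h ++ [y])) := by
            cases T with
            | zero => simpa [partialSum] using hG _
            | succ T => exact (partialSum_succ_of_accepted _ ha (by omega) hex hacc T).le
          simpa [epochValue, hacc, hex] using h2
        · rw [partialSum_of_rejected w ha (by omega) hex hacc]
          have h2 := (ih [] (D.epochLength_pos hD []))
          simp only [List.length_nil, Nat.cast_zero, mul_zero, sub_zero] at h2
          simpa [epochValue, hacc, hex] using h2.trans hfix
    have h2 := Finset.sum_le_sum fun y (_ : y ∈ Finset.univ) =>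
      mul_le_mul_of_nonneg_left (key y) (Q.nonneg (D.epochInput w h) y)
    simp only [mul_sub, Finset.sum_sub_distrib, ← Finset.sum_mul, Q.sum_eq_one, one_mul] at h2
    linarith

/-- Renewal argument, lower bound: what is collected in the first epoch. -/
theorem le_partialSum (hD : 0 < D.am) (w : ∀ l, Fin (D.M l)) (ha : D.IsRenewalReward ρ G a)
    (hnn : ∀ h, 0 ≤ a h) {T : ℕ} (hT : D.maxLength < T) :
    condExp Q D w (D.epochValue ρ G 0) [] ≤ partialSum Q (D.toCodingScheme.f w) a T [] := by
  suffices H : ∀ T h, h.length < D.epochLength h → D.maxLength < T + h.length →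
      condExp Q D w (D.epochValue ρ G 0) h - ρ * h.length ≤
        partialSum Q (D.toCodingScheme.f w) a T h by
    simpa using H T [] (D.epochLength_pos hD []) (by simpa using hT)
  intro T
  induction T with
  | zero =>
    intro h hh hT
    have := D.epochLength_le h
    omega
  | succ T ih =>
    intro h hh hT
    have hle := D.epochLength_le h
    have h1 : D.toCodingScheme.f w h = D.epochInput w h := by
      simp [toCodingScheme, D.currentEpoch_of_lt hh]
    rw [partialSum_succ, ha.incomplete h hh, h1, condExp_step Q w _ (hh.trans_le hle)]
    have key : ∀ y, condExp Q D w (D.epochValue ρ G 0) (h ++ [y]) - ρ * (h.length + 1) ≤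
        partialSum Q (D.toCodingScheme.f w) a T (h ++ [y]) := by
      intro y
      have hlen : (h ++ [y]).length = h.length + 1 := by simp
      rcases lt_or_ge (h ++ [y]).length (D.epochLength (h ++ [y])) with hlt | hge
      · simpa using ih (h ++ [y]) hlt (by omega)
      · have hex : D.epochLength (h ++ [y]) = (h ++ [y]).length := by
          have := D.length_lt_epochLength_append hh [y]
          omega
        rw [condExp_of_forall_append Q w (D.epochValue_append ρ G 0 hge)]
        by_cases hacc : D.Accepts (h ++ [y])
        · obtain ⟨T, rfl⟩ : ∃ T', T = T' + 1 := ⟨T - 1, by omega⟩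
          rw [partialSum_succ_of_accepted _ ha (by omega) hex hacc T]
          simp [epochValue, hacc, hex]
        · have : 0 ≤ partialSum Q (D.toCodingScheme.f w) a T (h ++ [y]) :=
            Finset.sum_nonneg fun t _ => le_pathExp Q fun g _ => hnn _
          simpa [epochValue, hacc, hex] using this
    have h2 := Finset.sum_le_sum fun y (_ : y ∈ Finset.univ) =>
      mul_le_mul_of_nonneg_left (key y) (Q.nonneg (D.epochInput w h) y)
    simp only [mul_sub, Finset.sum_sub_distrib, ← Finset.sum_mul, Q.sum_eq_one, one_mul] at h2
    linarith

end Renewal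

end EpochScheme
end CompoundFeedback
end

noncomputable section

namespace CompoundFeedback

variable {L : ℕ} {X Y : Type*}

namespace EpochScheme

/-! ### The four phases of one epoch -/

section Phases

variable (D : EpochScheme L X Y) {h₁ h₂ h₃ : List Y}

theorem Lm_append (h1 : h₁.length = D.am) (g : List Y) : D.Lm (h₁ ++ g) = D.θm h₁ := by
  simp [Lm, ← h1]

theorem afterTraining_append (h1 : h₁.length = D.am) (g : List Y) :
    D.afterTraining (h₁ ++ g) = g := by
  simp [afterTraining, ← h1]

theorem messageBlock_append (h1 : h₁.length = D.am) (h2 : h₂.length = D.bm (D.θm h₁))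
    (g : List Y) : D.messageBlock (h₁ ++ (h₂ ++ g)) = h₂ := by
  simp [messageBlock, D.afterTraining_append h1, D.Lm_append h1, ← h2]

theorem afterMessage_append (h1 : h₁.length = D.am) (h2 : h₂.length = D.bm (D.θm h₁))
    (g : List Y) : D.afterMessage (h₁ ++ (h₂ ++ g)) = g := by
  simp [afterMessage, D.afterTraining_append h1, D.Lm_append h1, ← h2]

theorem Lc_append (h1 : h₁.length = D.am) (h2 : h₂.length = D.bm (D.θm h₁))
    (h3 : h₃.length = D.ac) (g : List Y) : D.Lc (h₁ ++ (h₂ ++ (h₃ ++ g))) = D.θc h₃ := by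
  simp [Lc, D.afterMessage_append h1 h2, ← h3]

theorem controlBlock_append (h1 : h₁.length = D.am) (h2 : h₂.length = D.bm (D.θm h₁))
    (h3 : h₃.length = D.ac) (g : List Y) :
    D.controlBlock (h₁ ++ (h₂ ++ (h₃ ++ g))) = g.take (D.bc (D.θc h₃)) := by
  simp [controlBlock, afterRetraining, D.afterMessage_append h1 h2, D.Lc_append h1 h2 h3, ← h3]

variable (w : ∀ l, Fin (D.M l))

theorem epochInput_training {h : List Y} (hh : h.length < D.am) :
    D.epochInput w h = D.σm h.length := by simp [epochInput, hh]

theorem epochInput_message (h1 : h₁.length = D.am) {h : List Y}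
    (hh : h.length < D.bm (D.θm h₁)) :
    D.epochInput w (h₁ ++ h) = D.enc (D.θm h₁) (w (D.θm h₁)) h := by
  have h3 : (D.afterTraining (h₁ ++ h)).length < D.bm (D.Lm (h₁ ++ h)) := by
    rwa [D.afterTraining_append h1, D.Lm_append h1]
  rw [epochInput, if_neg (by simp [h1]), if_pos h3, D.afterTraining_append h1, D.Lm_append h1]

theorem epochInput_retraining (h1 : h₁.length = D.am) (h2 : h₂.length = D.bm (D.θm h₁))
    {h : List Y} (hh : h.length < D.ac) :
    D.epochInput w (h₁ ++ (h₂ ++ h)) = D.σc h.length := by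
  simp [epochInput, D.afterTraining_append h1, D.Lm_append h1, hh, h1, h2,
    D.afterMessage_append h1 h2]

theorem epochInput_control (h1 : h₁.length = D.am) (h2 : h₂.length = D.bm (D.θm h₁))
    (h3 : h₃.length = D.ac) (h : List Y) :
    D.epochInput w (h₁ ++ (h₂ ++ (h₃ ++ h))) =
      if D.dec (D.θm h₁) h₂ = w (D.θm h₁) then D.xA (D.θc h₃) else D.xR (D.θc h₃) := by
  have e : (D.Wm (h₁ ++ (h₂ ++ (h₃ ++ h))) = w (D.Lm (h₁ ++ (h₂ ++ (h₃ ++ h))))) ↔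
      D.dec (D.θm h₁) h₂ = w (D.θm h₁) := by
    change D.dec (D.Lm _) (D.messageBlock _) = _ ↔ _
    rw [D.messageBlock_append h1 h2, D.Lm_append h1]
  simp only [epochInput, e, D.Lc_append h1 h2 h3, D.afterTraining_append h1, D.Lm_append h1,
    D.afterMessage_append h1 h2]
  simp [h1, h2, h3]

end Phases

variable [Fintype Y] (Q : DMC X Y)

/-- Expectation of a function of the four phases of one epoch (the two channel estimates and the
outputs of the message phase and of the control phase), computed phase by phase. -/
def phaseExp (D : EpochScheme L X Y) (w : ∀ l, Fin (D.M l))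
    (Φ : Fin L → List Y → Fin L → List Y → ℝ) : ℝ :=
  pathExp Q D.am (fun h => D.σm h.length) fun h₁ =>
    pathExp Q (D.bm (D.θm h₁)) (D.enc (D.θm h₁) (w (D.θm h₁))) fun h₂ =>
      pathExp Q D.ac (fun h => D.σc h.length) fun h₃ =>
        pathExp Q (D.bc (D.θc h₃)) (fun _ =>
          if D.dec (D.θm h₁) h₂ = w (D.θm h₁) then D.xA (D.θc h₃) else D.xR (D.θc h₃)) fun h₄ =>
            Φ (D.θm h₁) h₂ (D.θc h₃) h₄

variable {D : EpochScheme L X Y} {w : ∀ l, Fin (D.M l)}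

theorem condExp_nil_eq_phaseExp (Φ : Fin L → List Y → Fin L → List Y → ℝ) :
    condExp Q D w (fun h => Φ (D.Lm h) (D.messageBlock h) (D.Lc h) (D.controlBlock h)) [] =
      phaseExp Q D w Φ := by
  have hbm : ∀ l, D.bm l ≤ ∑ l, D.bm l := fun l =>
    Finset.single_le_sum (fun _ _ => Nat.zero_le _) (Finset.mem_univ l)
  have hbc : ∀ l, D.bc l ≤ ∑ l, D.bc l := fun l =>
    Finset.single_le_sum (fun _ _ => Nat.zero_le _) (Finset.mem_univ l)
  simp only [condExp, List.nil_append, List.length_nil, Nat.sub_zero, phaseExp]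
  rw [maxLength, add_assoc, add_assoc, pathExp_split]
  refine pathExp_congr Q (fun h hh => D.epochInput_training w hh) fun h₁ h1 => ?_
  obtain ⟨r, hr⟩ := Nat.exists_eq_add_of_le (hbm (D.θm h₁))
  rw [hr, add_assoc, pathExp_split]
  refine pathExp_congr Q (fun h hh => D.epochInput_message w h1 hh) fun h₂ h2 => ?_
  rw [add_left_comm, pathExp_split]
  refine pathExp_congr Q (fun h hh => D.epochInput_retraining w h1 h2 hh) fun h₃ h3 => ?_
  obtain ⟨r', hr'⟩ := Nat.exists_eq_add_of_le (hbc (D.θc h₃))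
  rw [hr', add_left_comm, ← pathExp_take Q (D.bc (D.θc h₃)) (r + r')]
  refine pathExp_congr Q (fun h hh => D.epochInput_control w h1 h2 h3 h) fun h₄ h4 => ?_
  simp only [D.Lm_append h1, D.messageBlock_append h1 h2, D.Lc_append h1 h2 h3,
    D.controlBlock_append h1 h2 h3]

theorem phaseExp_mono {Φ Ψ : Fin L → List Y → Fin L → List Y → ℝ}
    (h : ∀ k h₂ j h₄, Φ k h₂ j h₄ ≤ Ψ k h₂ j h₄) : phaseExp Q D w Φ ≤ phaseExp Q D w Ψ :=
  pathExp_mono Q fun _ _ => pathExp_mono Q fun _ _ => pathExp_mono Q fun _ _ =>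
    pathExp_mono Q fun _ _ => h _ _ _ _

theorem phaseExp_add (Φ Ψ : Fin L → List Y → Fin L → List Y → ℝ) :
    phaseExp Q D w (fun k h₂ j h₄ => Φ k h₂ j h₄ + Ψ k h₂ j h₄) =
      phaseExp Q D w Φ + phaseExp Q D w Ψ := by
  simp only [phaseExp, pathExp_add]

theorem phaseExp_const_mul (c : ℝ) (Φ : Fin L → List Y → Fin L → List Y → ℝ) :
    phaseExp Q D w (fun k h₂ j h₄ => c * Φ k h₂ j h₄) = c * phaseExp Q D w Φ := by
  simp only [phaseExp, pathExp_const_mul]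

theorem phaseExp_const (c : ℝ) : phaseExp Q D w (fun _ _ _ _ => c) = c := by
  simp only [phaseExp, pathExp_const]

open Classical in
/-- Probability of an event that concerns the four phases of one epoch. -/
def phaseProb (D : EpochScheme L X Y) (w : ∀ l, Fin (D.M l))
    (P : Fin L → List Y → Fin L → List Y → Prop) : ℝ :=
  phaseExp Q D w fun k h₂ j h₄ => if P k h₂ j h₄ then 1 else 0

theorem phaseProb_mono {P P' : Fin L → List Y → Fin L → List Y → Prop}
    (h : ∀ k h₂ j h₄, P k h₂ j h₄ → P' k h₂ j h₄) : phaseProb Q D w P ≤ phaseProb Q D w P' :=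
  phaseExp_mono Q fun k h₂ j h₄ => by
    by_cases hP : P k h₂ j h₄
    · simp [hP, h _ _ _ _ hP]
    · simp only [hP, if_false]; positivity

theorem phaseProb_or_le (P P' : Fin L → List Y → Fin L → List Y → Prop) :
    phaseProb Q D w (fun k h₂ j h₄ => P k h₂ j h₄ ∨ P' k h₂ j h₄) ≤
      phaseProb Q D w P + phaseProb Q D w P' := by
  rw [phaseProb, phaseProb, phaseProb, ← phaseExp_add]
  refine phaseExp_mono Q fun k h₂ j h₄ => ?_
  by_cases hP : P k h₂ j h₄ <;> by_cases hP' : P' k h₂ j h₄ <;> simp [hP, hP']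

theorem phaseProb_compl (P : Fin L → List Y → Fin L → List Y → Prop) :
    phaseProb Q D w (fun k h₂ j h₄ => ¬ P k h₂ j h₄) = 1 - phaseProb Q D w P := by
  rw [eq_sub_iff_add_eq, phaseProb, phaseProb, ← phaseExp_add]
  refine Eq.trans (congrArg _ ?_) (phaseExp_const Q (D := D) (w := w) 1)
  funext k h₂ j h₄
  by_cases hP : P k h₂ j h₄ <;> simp [hP]

theorem phaseProb_nonneg (P : Fin L → List Y → Fin L → List Y → Prop) :
    0 ≤ phaseProb Q D w P := by
  rw [← phaseExp_const Q (w := w) 0]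
  exact phaseExp_mono Q fun k h₂ j h₄ => by positivity

/-- Probability of a wrong channel estimate in the training phase. -/
def trainingError (D : EpochScheme L X Y) (l : Fin L) : ℝ :=
  blockProb Q (fun h => D.σm h.length) D.am {h | D.θm h ≠ l}

/-- Probability of a wrong channel estimate in the re-training phase. -/
def retrainingError (D : EpochScheme L X Y) (l : Fin L) : ℝ :=
  blockProb Q (fun h => D.σc h.length) D.ac {h | D.θc h ≠ l}

/-- Probability that codebook `l` decodes the message `m` wrongly. -/
def codebookError (D : EpochScheme L X Y) (l : Fin L) (m : Fin (D.M l)) : ℝ :=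
  blockProb Q (D.enc l m) (D.bm l) {h | D.dec l h ≠ m}

/-- Probability that the test for channel `l` mistakes ACCEPT for REJECT. -/
def falseReject (D : EpochScheme L X Y) (l : Fin L) : ℝ :=
  blockProb Q (fun _ => D.xA l) (D.bc l) (D.accept l)ᶜ

/-- Probability that the test for channel `l` mistakes REJECT for ACCEPT. -/
def falseAccept (D : EpochScheme L X Y) (l : Fin L) : ℝ :=
  blockProb Q (fun _ => D.xR l) (D.bc l) (D.accept l)

theorem phaseProb_Lm_ne (l : Fin L) :
    phaseProb Q D w (fun k _ _ _ => k ≠ l) = trainingError Q D l := by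
  simp only [phaseProb, phaseExp, pathExp_const, trainingError, blockProb_eq_pathExp]
  refine pathExp_congr Q (fun _ _ => rfl) fun h _ => ?_
  by_cases hh : D.θm h = l <;> simp [hh]

theorem phaseProb_Lc_ne (l : Fin L) :
    phaseProb Q D w (fun _ _ j _ => j ≠ l) = retrainingError Q D l := by
  simp only [phaseProb, phaseExp, pathExp_const, retrainingError, blockProb_eq_pathExp]
  refine pathExp_congr Q (fun _ _ => rfl) fun h _ => ?_
  by_cases hh : D.θc h = l <;> simp [hh]

theorem phaseProb_dec_ne_le (l : Fin L) :
    phaseProb Q D w (fun k h₂ _ _ => k = l ∧ D.dec k h₂ ≠ w k) ≤ codebookError Q D l (w l) := by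
  simp only [phaseProb, phaseExp, pathExp_const]
  refine pathExp_le Q fun h _ => ?_
  by_cases hh : D.θm h = l
  · subst hh
    simp only [true_and, codebookError, blockProb_eq_pathExp]
    exact pathExp_mono Q fun g _ => by simp [Set.indicator]
  · simp [hh, codebookError, blockProb_nonneg]

theorem phaseProb_reject_le (l : Fin L) :
    phaseProb Q D w (fun k h₂ j h₄ => D.dec k h₂ = w k ∧ j = l ∧ h₄ ∉ D.accept j) ≤
      falseReject Q D l := by
  refine pathExp_le Q fun h₁ _ => pathExp_le Q fun h₂ _ => pathExp_le Q fun h₃ _ => ?_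
  by_cases hh : D.θc h₃ = l
  · subst hh
    by_cases hd : D.dec (D.θm h₁) h₂ = w (D.θm h₁)
    · simp only [hd, true_and, if_true, falseReject, blockProb_eq_pathExp]
      refine pathExp_mono Q fun g _ => ?_
      by_cases hg : g ∈ D.accept (D.θc h₃) <;> simp [hg, hd]
    · simp [hd, falseReject, blockProb_nonneg]
  · simp [hh, falseReject, blockProb_nonneg]

theorem phaseProb_accept_le (l : Fin L) :
    phaseProb Q D w (fun k h₂ j h₄ => D.dec k h₂ ≠ w k ∧ j = l ∧ h₄ ∈ D.accept j) ≤
      falseAccept Q D l := by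
  refine pathExp_le Q fun h₁ _ => pathExp_le Q fun h₂ _ => pathExp_le Q fun h₃ _ => ?_
  by_cases hh : D.θc h₃ = l
  · subst hh
    by_cases hd : D.dec (D.θm h₁) h₂ = w (D.θm h₁)
    · simp [hd, falseAccept, blockProb_nonneg]
    · simp only [hd, not_false_eq_true, ne_eq, true_and, if_false, falseAccept,
        blockProb_eq_pathExp]
      refine pathExp_mono Q fun g _ => ?_
      by_cases hg : g ∈ D.accept (D.θc h₃) <;> simp [hg, hd]
  · simp [hh, falseAccept, blockProb_nonneg]

/-- A wrong decision becomes final at least if the first channel estimate is right, codebook `l`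
errs, the second channel estimate is right and the test mistakes REJECT for ACCEPT. -/
theorem le_phaseProb_error (l : Fin L) :
    (1 - trainingError Q D l) * codebookError Q D l (w l) * (1 - retrainingError Q D l) *
      falseAccept Q D l ≤
      phaseProb Q D w (fun k h₂ j h₄ => D.dec k h₂ ≠ w k ∧ h₄ ∈ D.accept j) := by
  rw [trainingError, retrainingError, ← blockProb_compl, ← blockProb_compl, codebookError,
    blockProb_eq_pathExp, blockProb_eq_pathExp, blockProb_eq_pathExp, mul_assoc, mul_assoc,
    ← pathExp_mul_const]
  refine pathExp_mono Q fun h₁ _ => ?_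
  by_cases hh : D.θm h₁ = l
  swap
  · rw [Set.indicator_of_notMem (by simpa using hh), zero_mul]
    exact le_pathExp Q fun _ _ => le_pathExp Q fun _ _ => le_pathExp Q fun _ _ => by positivity
  subst hh
  rw [Set.indicator_of_mem (by simp), Pi.one_apply, one_mul, ← pathExp_mul_const]
  refine pathExp_mono Q fun h₂ _ => ?_
  by_cases hd : D.dec (D.θm h₁) h₂ = w (D.θm h₁)
  · rw [Set.indicator_of_notMem (by simpa using hd), zero_mul]
    exact le_pathExp Q fun _ _ => le_pathExp Q fun _ _ => by positivity
  rw [Set.indicator_of_mem (by simpa using hd), Pi.one_apply, one_mul, ← pathExp_mul_const]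
  refine pathExp_mono Q fun h₃ _ => ?_
  by_cases hj : D.θc h₃ = D.θm h₁
  swap
  · rw [Set.indicator_of_notMem (by simpa using hj), zero_mul]
    exact le_pathExp Q fun _ _ => by positivity
  rw [Set.indicator_of_mem (by simpa using hj), Pi.one_apply, one_mul, falseAccept,
    blockProb_eq_pathExp]
  rw [hj]
  refine pathExp_mono' Q (fun _ _ => by rw [if_neg hd]) fun g _ => ?_
  by_cases hg : g ∈ D.accept (D.θm h₁) <;> simp [hg, hd]

end EpochScheme
end CompoundFeedback
end

noncomputable section

namespace CompoundFeedback

variable {L : ℕ} {X Y : Type*} [Fintype Y]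

/-! ### Averages over the compound message -/

section Average

variable {M : Fin L → ℕ} (μ : stdSimplex ℝ (∀ l, Fin (M l)))

theorem sum_mul_le_of_forall_le {b : (∀ l, Fin (M l)) → ℝ} {c : ℝ} (h : ∀ w, b w ≤ c) :
    ∑ w, μ.1 w * b w ≤ c := by
  calc ∑ w, μ.1 w * b w ≤ ∑ w, μ.1 w * c :=
        Finset.sum_le_sum fun w _ => mul_le_mul_of_nonneg_left (h w) (μ.2.1 w)
    _ = c := by rw [← Finset.sum_mul, μ.2.2, one_mul]

theorem le_sum_mul_of_forall_le {b : (∀ l, Fin (M l)) → ℝ} {c : ℝ} (h : ∀ w, c ≤ b w) :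
    c ≤ ∑ w, μ.1 w * b w := by
  calc c = ∑ w, μ.1 w * c := by rw [← Finset.sum_mul, μ.2.2, one_mul]
    _ ≤ ∑ w, μ.1 w * b w :=
        Finset.sum_le_sum fun w _ => mul_le_mul_of_nonneg_left (h w) (μ.2.1 w)

variable {Q : DMC X Y} {u : (∀ l, Fin (M l)) → List Y → X} {A : (∀ l, Fin (M l)) → Set (List Y)}

theorem tsum_average_le {c : ℝ}
    (h : ∀ w T, EpochScheme.partialSum Q (u w) ((A w).indicator 1) T [] ≤ c) :
    ∑' t : ℕ, ENNReal.ofReal (∑ w, μ.1 w * blockProb Q (u w) t (A w)) ≤ ENNReal.ofReal c := by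
  refine ENNReal.tsum_le_of_sum_range_le fun T => ?_
  rw [← ENNReal.ofReal_sum_of_nonneg fun t _ => Finset.sum_nonneg fun w _ =>
    mul_nonneg (μ.2.1 w) (blockProb_nonneg _ _ _ _), Finset.sum_comm]
  refine ENNReal.ofReal_le_ofReal ?_
  simp only [← Finset.mul_sum]
  refine sum_mul_le_of_forall_le μ fun w => ?_
  simpa [EpochScheme.partialSum, blockProb_eq_pathExp] using h w T

theorem le_tsum_average {c : (∀ l, Fin (M l)) → ℝ} {T : ℕ}
    (h : ∀ w, c w ≤ EpochScheme.partialSum Q (u w) ((A w).indicator 1) T []) :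
    ENNReal.ofReal (∑ w, μ.1 w * c w) ≤
      ∑' t : ℕ, ENNReal.ofReal (∑ w, μ.1 w * blockProb Q (u w) t (A w)) := by
  refine le_trans ?_ (ENNReal.sum_le_tsum (Finset.range T))
  rw [← ENNReal.ofReal_sum_of_nonneg fun t _ => Finset.sum_nonneg fun w _ =>
    mul_nonneg (μ.2.1 w) (blockProb_nonneg _ _ _ _), Finset.sum_comm]
  refine ENNReal.ofReal_le_ofReal ?_
  simp only [← Finset.mul_sum]
  refine Finset.sum_le_sum fun w _ => mul_le_mul_of_nonneg_left ?_ (μ.2.1 w)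
  simpa [EpochScheme.partialSum, blockProb_eq_pathExp] using h w

end Average

namespace EpochScheme

variable {D : EpochScheme L X Y} (Q : DMC X Y)

/-! ### Bounds for one scheme -/

section OneMessage

variable {w : ∀ l, Fin (D.M l)}

open Classical in
theorem condExp_epochValue (ρ : ℝ) (G : (Σ l, Fin (D.M l)) → ℝ) (c : ℝ) :
    condExp Q D w (D.epochValue ρ G c) [] = phaseExp Q D w fun k h₂ j h₄ =>
      ρ * (D.am + D.bm k + D.ac + D.bc j : ℝ) +
        if h₄ ∈ D.accept j then G ⟨k, D.dec k h₂⟩ else c := by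
  rw [← condExp_nil_eq_phaseExp]
  congr 1
  funext h
  simp only [epochValue, epochLength, Nat.cast_add]
  exact congrArg _ (if_congr Iff.rfl rfl rfl)

open Classical in
theorem condExp_epochValue_zero_of_indicator (P : (Σ l, Fin (D.M l)) → Prop) :
    condExp Q D w (D.epochValue 0 ({e | P e}.indicator 1) 0) [] =
      phaseProb Q D w fun k h₂ j h₄ => P ⟨k, D.dec k h₂⟩ ∧ h₄ ∈ D.accept j := by
  rw [condExp_epochValue, phaseProb]
  congr 1
  funext k h₂ j h₄
  by_cases h1 : P ⟨k, D.dec k h₂⟩ <;> by_cases h2 : h₄ ∈ D.accept j <;> simp [h1, h2]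

theorem condExp_epochValue_eq_add (ρ : ℝ) (G : (Σ l, Fin (D.M l)) → ℝ) (c : ℝ) :
    condExp Q D w (D.epochValue ρ G c) [] = condExp Q D w (D.epochValue ρ G 0) [] +
      c * phaseProb Q D w fun _ _ j h₄ => h₄ ∉ D.accept j := by
  rw [condExp_epochValue, condExp_epochValue, phaseProb, ← phaseExp_const_mul, ← phaseExp_add]
  congr 1
  funext k h₂ j h₄
  by_cases h2 : h₄ ∈ D.accept j <;> simp [h2]

variable {Q} {δ : ℝ} {l : Fin L}

/-- The renewal argument with `c = g / (1 - δ)`, where `g` bounds the contribution of one epoch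
and `δ` the probability of REJECT. -/
theorem partialSum_le_div (hD : 0 < D.am) {ρ : ℝ} {G : (Σ l, Fin (D.M l)) → ℝ} {a : List Y → ℝ}
    (ha : D.IsRenewalReward ρ G a) (hρ : 0 ≤ ρ) (hG : ∀ e, 0 ≤ G e) {g : ℝ} (hg : 0 ≤ g)
    (hδ : δ < 1) (hrej : (phaseProb Q D w fun _ _ j h₄ => h₄ ∉ D.accept j) ≤ δ)
    (hle : condExp Q D w (D.epochValue ρ G 0) [] ≤ g) (T : ℕ) :
    partialSum Q (D.toCodingScheme.f w) a T [] ≤ g / (1 - δ) := by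
  have h1 : 0 < 1 - δ := by linarith
  have hc : 0 ≤ g / (1 - δ) := by positivity
  refine partialSum_le hD w ha hρ hG hc ?_ T
  rw [condExp_epochValue_eq_add]
  have h2 := mul_le_mul_of_nonneg_left hrej hc
  have h3 : g / (1 - δ) * (1 - δ) = g := div_mul_cancel₀ _ h1.ne'
  linarith

/-- With probability at least `1 - δ` both channel estimates of an epoch are right and ACCEPT is
decoded. -/
theorem phaseProb_not_ideal_le (hδ : trainingError Q D l + codebookError Q D l (w l) +
      retrainingError Q D l + falseReject Q D l ≤ δ) :
    phaseProb Q D w (fun k _ j h₄ => ¬ (k = l ∧ j = l ∧ h₄ ∈ D.accept j)) ≤ δ := by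
  have h1 := phaseProb_Lm_ne Q (D := D) (w := w) l
  have h2 := phaseProb_dec_ne_le Q (D := D) (w := w) l
  have h3 := phaseProb_Lc_ne Q (D := D) (w := w) l
  have h4 := phaseProb_reject_le Q (D := D) (w := w) l
  have h5 := phaseProb_or_le Q (D := D) (w := w) (fun k _ _ _ => k ≠ l)
    (fun k h₂ _ _ => k = l ∧ D.dec k h₂ ≠ w k)
  have h6 := phaseProb_or_le Q (D := D) (w := w) (fun _ _ j _ => j ≠ l)
    (fun k h₂ j h₄ => D.dec k h₂ = w k ∧ j = l ∧ h₄ ∉ D.accept j)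
  have h7 := phaseProb_or_le Q (D := D) (w := w)
    (fun k h₂ _ _ => k ≠ l ∨ (k = l ∧ D.dec k h₂ ≠ w k))
    (fun k h₂ j h₄ => j ≠ l ∨ (D.dec k h₂ = w k ∧ j = l ∧ h₄ ∉ D.accept j))
  have h8 := phaseProb_mono Q (D := D) (w := w)
    (P := fun k _ j h₄ => ¬ (k = l ∧ j = l ∧ h₄ ∈ D.accept j))
    (P' := fun k h₂ j h₄ => (k ≠ l ∨ (k = l ∧ D.dec k h₂ ≠ w k)) ∨
      (j ≠ l ∨ (D.dec k h₂ = w k ∧ j = l ∧ h₄ ∉ D.accept j)))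
    (fun k h₂ j h₄ h => by tauto)
  linarith

/-- A wrong decision that becomes final is due either to the second channel estimate or to the
test. -/
theorem phaseProb_error_le :
    phaseProb Q D w (fun k h₂ j h₄ => D.dec k h₂ ≠ w k ∧ h₄ ∈ D.accept j) ≤
      retrainingError Q D l + falseAccept Q D l := by
  rw [← phaseProb_Lc_ne Q (w := w)]
  refine le_trans ?_ (add_le_add_right (phaseProb_accept_le Q (w := w) l) _)
  refine le_trans ?_ (phaseProb_or_le Q _ _)
  exact phaseProb_mono Q fun k h₂ j h₄ h => by tauto

end OneMessage

section AllMessages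

variable {Q} (l : Fin L) (μ : stdSimplex ℝ (∀ l, Fin (D.M l))) {δ : ℝ}

/-- The length of an epoch in which both channel estimates equal `l`. -/
def idealLength (D : EpochScheme L X Y) (l : Fin L) : ℕ := D.am + D.bm l + D.ac + D.bc l

variable (hD : 0 < D.am) (hδ : ∀ m, trainingError Q D l + codebookError Q D l m +
      retrainingError Q D l + falseReject Q D l ≤ δ)
include hD hδ

theorem expectedLength_le (hδ1 : δ < 1) : D.toCodingScheme.expectedLength Q μ ≤
    ENNReal.ofReal ((D.idealLength l + δ * D.maxLength) / (1 - δ)) := by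
  classical
  refine tsum_average_le μ fun w T => ?_
  have hid := phaseProb_not_ideal_le (hδ (w l))
  have hδ0 : 0 ≤ δ := (phaseProb_nonneg Q _).trans hid
  refine partialSum_le_div hD (isRenewalReward_running hD) zero_le_one (fun _ => le_rfl)
    (by positivity) hδ1 ((phaseProb_mono Q fun k h₂ j h₄ h => by tauto).trans hid) ?_ T
  rw [condExp_epochValue]
  have h1 := mul_le_mul_of_nonneg_right hid (Nat.cast_nonneg (α := ℝ) D.maxLength)
  refine le_trans ?_ (add_le_add_right h1 _)
  rw [mul_comm (phaseProb _ _ _ _), phaseProb, ← phaseExp_const_mul,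
    ← phaseExp_const Q (D := D) (w := w) (D.idealLength l : ℝ), ← phaseExp_add]
  refine phaseExp_mono Q fun k h₂ j h₄ => ?_
  have hle : (D.am + D.bm k + D.ac + D.bc j : ℝ) ≤ D.maxLength := by
    have hb := Finset.single_le_sum (f := D.bm) (fun _ _ => Nat.zero_le _) (Finset.mem_univ k)
    have hc := Finset.single_le_sum (f := D.bc) (fun _ _ => Nat.zero_le _) (Finset.mem_univ j)
    have : D.am + D.bm k + D.ac + D.bc j ≤ D.maxLength := by unfold maxLength; omega
    exact_mod_cast this
  have h0 : (0 : ℝ) ≤ D.idealLength l := Nat.cast_nonneg _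
  by_cases h : k = l ∧ j = l ∧ h₄ ∈ D.accept j
  · obtain ⟨rfl, rfl, h4⟩ := h
    simp [h4, idealLength]
  · simp only [one_mul, Pi.zero_apply, ite_self, add_zero, h, not_false_eq_true, if_true, mul_one]
    linarith

theorem le_expectedLength :
    ENNReal.ofReal ((1 - δ) * D.idealLength l) ≤ D.toCodingScheme.expectedLength Q μ := by
  classical
  refine le_trans (ENNReal.ofReal_le_ofReal (le_sum_mul_of_forall_le μ fun w => ?_))
    (le_tsum_average μ fun w => le_partialSum hD w (isRenewalReward_running hD)
      (fun h => Set.indicator_nonneg (by simp) h) (Nat.lt_succ_self _))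
  have hid := phaseProb_not_ideal_le (hδ (w l))
  rw [phaseProb_compl] at hid
  rw [condExp_epochValue]
  refine (mul_le_mul_of_nonneg_right (sub_le_comm.1 hid) (Nat.cast_nonneg _)).trans ?_
  rw [mul_comm, phaseProb, ← phaseExp_const_mul]
  refine phaseExp_mono Q fun k h₂ j h₄ => ?_
  by_cases h : k = l ∧ j = l ∧ h₄ ∈ D.accept j
  · obtain ⟨rfl, rfl, h4⟩ := h
    simp [h4, idealLength]
  · simp only [h, if_false, Pi.zero_apply, ite_self, mul_zero, add_zero, one_mul]
    positivity

theorem errorProb_le (hδ1 : δ < 1) : D.toCodingScheme.errorProb Q μ ≤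
    ENNReal.ofReal ((retrainingError Q D l + falseAccept Q D l) / (1 - δ)) := by
  classical
  refine tsum_average_le μ fun w T => ?_
  have hid := phaseProb_not_ideal_le (hδ (w l))
  refine partialSum_le_div hD
    (isRenewalReward_stopsAt hD fun e : Σ l, Fin (D.M l) => e.2 ≠ w e.1) le_rfl
    (fun e => Set.indicator_nonneg (by simp) e)
    (add_nonneg (blockProb_nonneg _ _ _ _) (blockProb_nonneg _ _ _ _)) hδ1
    ((phaseProb_mono Q fun k h₂ j h₄ h => by tauto).trans hid) ?_ T
  rw [condExp_epochValue_zero_of_indicator]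
  exact phaseProb_error_le

theorem stoppedProb_ne_le (hδ1 : δ < 1) {k : Fin L} (hk : k ≠ l) :
    D.toCodingScheme.stoppedProb Q μ (fun _ h => (D.toCodingScheme.g h).1 = k) ≤
      ENNReal.ofReal (δ / (1 - δ)) := by
  classical
  refine tsum_average_le μ fun w T => ?_
  have hid := phaseProb_not_ideal_le (hδ (w l))
  refine partialSum_le_div hD
    (isRenewalReward_stopsAt hD fun e : Σ l, Fin (D.M l) => e.1 = k) le_rfl
    (fun e => Set.indicator_nonneg (by simp) e) ((phaseProb_nonneg Q _).trans hid) hδ1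
    ((phaseProb_mono Q fun k h₂ j h₄ h => by tauto).trans hid) ?_ T
  rw [condExp_epochValue_zero_of_indicator]
  refine le_trans (phaseProb_mono Q fun k' h₂ j h₄ h => ?_) hid
  rintro ⟨rfl, -⟩
  exact hk h.1.symm

theorem stoppedProb_self_le (hδ1 : δ < 1) :
    D.toCodingScheme.stoppedProb Q μ (fun _ h => (D.toCodingScheme.g h).1 = l) ≤
      ENNReal.ofReal (1 / (1 - δ)) := by
  classical
  refine tsum_average_le μ fun w T => ?_
  have hid := phaseProb_not_ideal_le (hδ (w l))
  refine partialSum_le_div hD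
    (isRenewalReward_stopsAt hD fun e : Σ l, Fin (D.M l) => e.1 = l) le_rfl
    (fun e => Set.indicator_nonneg (by simp) e) zero_le_one hδ1
    ((phaseProb_mono Q fun k h₂ j h₄ h => by tauto).trans hid) ?_ T
  rw [condExp_epochValue_zero_of_indicator, ← sub_nonneg, ← phaseProb_compl]
  exact phaseProb_nonneg Q _

theorem le_stoppedProb_self : ENNReal.ofReal (1 - δ) ≤
    D.toCodingScheme.stoppedProb Q μ (fun _ h => (D.toCodingScheme.g h).1 = l) := by
  classical
  refine le_trans (ENNReal.ofReal_le_ofReal (le_sum_mul_of_forall_le μ fun w => ?_))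
    (le_tsum_average μ fun w => le_partialSum hD w
      (isRenewalReward_stopsAt hD fun e : Σ l, Fin (D.M l) => e.1 = l)
      (fun h => Set.indicator_nonneg (by simp) h) (Nat.lt_succ_self _))
  have hid := phaseProb_not_ideal_le (hδ (w l))
  rw [phaseProb_compl] at hid
  rw [condExp_epochValue_zero_of_indicator]
  exact (sub_le_comm.1 hid).trans (phaseProb_mono Q fun k h₂ j h₄ h => ⟨h.1, h.2.2⟩)

omit hδ in
/-- If codebook `l` errs with probability at least `q` for all messages but one, then the
scheme errs at least with probability `q / 2`, up to the probabilities of the other phases. -/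
theorem le_errorProb (hμ : UniformMarginals μ) (hM : 2 ≤ D.M l) {q : ℝ} (hq : 0 ≤ q)
    (m₀ : Fin (D.M l)) (hcb : ∀ m, m ≠ m₀ → q ≤ codebookError Q D l m) :
    ENNReal.ofReal ((1 - trainingError Q D l) * (q / 2) * (1 - retrainingError Q D l) *
      falseAccept Q D l) ≤ D.toCodingScheme.errorProb Q μ := by
  classical
  refine le_trans (ENNReal.ofReal_le_ofReal ?_)
    (le_tsum_average μ fun w => le_partialSum hD w
      (isRenewalReward_stopsAt hD fun e : Σ l, Fin (D.M l) => e.2 ≠ w e.1)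
      (fun h => Set.indicator_nonneg (by simp) h) (Nat.lt_succ_self _))
  simp only [condExp_epochValue_zero_of_indicator]
  set κ := (1 - trainingError Q D l) * q * (1 - retrainingError Q D l) * falseAccept Q D l
    with hκ
  have htr : 0 ≤ 1 - trainingError Q D l := sub_nonneg.2 (blockProb_le_one _ _ _ _)
  have hre : 0 ≤ 1 - retrainingError Q D l := sub_nonneg.2 (blockProb_le_one _ _ _ _)
  have hfa : 0 ≤ falseAccept Q D l := blockProb_nonneg _ _ _ _
  have hκ0 : 0 ≤ κ := by positivity
  have h1 : ∀ w : ∀ l, Fin (D.M l), (κ - if w l = m₀ then κ else 0) ≤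
      phaseProb Q D w fun k h₂ j h₄ => D.dec k h₂ ≠ w k ∧ h₄ ∈ D.accept j := by
    intro w
    by_cases hw : w l = m₀
    · simpa [hw] using phaseProb_nonneg Q _
    · rw [if_neg hw, sub_zero]
      refine le_trans ?_ (le_phaseProb_error Q l)
      rw [hκ]
      gcongr
      exact hcb _ hw
  refine le_trans ?_ (Finset.sum_le_sum fun w _ => mul_le_mul_of_nonneg_left (h1 w) (μ.2.1 w))
  have h2 : ∑ w, μ.1 w * (if w l = m₀ then κ else 0) = κ / D.M l := by
    have := hμ l m₀
    rw [Finset.sum_filter] at this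
    simp only [mul_ite, mul_zero]
    rw [div_eq_mul_one_div κ, ← this, Finset.mul_sum]
    refine Finset.sum_congr rfl fun w _ => ?_
    split_ifs <;> ring
  simp only [mul_sub, Finset.sum_sub_distrib, ← Finset.sum_mul, μ.2.2, one_mul]
  rw [h2]
  have h3 : κ / D.M l ≤ κ / 2 := by
    have : (2 : ℝ) ≤ D.M l := by exact_mod_cast hM
    gcongr
  have h4 : (1 - trainingError Q D l) * (q / 2) * (1 - retrainingError Q D l) *
      falseAccept Q D l = κ / 2 := by rw [hκ]; ring
  linarith

end AllMessages

end EpochScheme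
end CompoundFeedback
end

noncomputable section

namespace CompoundFeedback

/-! ### Exponential rates -/

theorem log2_strictMono : StrictMono log2 := fun _ _ h =>
  EReal.strictMono_div_right_of_pos (by exact_mod_cast Real.log_pos one_lt_two)
    (EReal.coe_ne_top _) (ENNReal.log_strictMono h)

theorem log2_ofReal_rpow (y : ℝ) : log2 (ENNReal.ofReal ((2 : ℝ) ^ y)) = y := by
  rw [log2, ENNReal.log_ofReal_of_pos (by positivity), ← EReal.coe_div, Real.log_rpow two_pos,
    mul_div_cancel_right₀ _ (Real.log_pos one_lt_two).ne']

theorem le_neg_log2_div_iff {p : ℝ≥0∞} {b c : ℝ} (hb : 0 < b) :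
    (c : EReal) ≤ -log2 p / (b : EReal) ↔ p ≤ ENNReal.ofReal (2 ^ (-(c * b))) := by
  rw [EReal.le_div_iff_mul_le (by exact_mod_cast hb) (EReal.coe_ne_top _), EReal.le_neg,
    ← log2_strictMono.le_iff_le, log2_ofReal_rpow]
  norm_cast

theorem neg_log2_div_le_iff {p : ℝ≥0∞} {b c : ℝ} (hb : 0 < b) :
    -log2 p / (b : EReal) ≤ (c : EReal) ↔ ENNReal.ofReal (2 ^ (-(c * b))) ≤ p := by
  rw [EReal.div_le_iff_le_mul (by exact_mod_cast hb) (EReal.coe_ne_top _), EReal.neg_le,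
    ← log2_strictMono.le_iff_le, log2_ofReal_rpow, mul_comm c]
  norm_cast

section Rates

variable {p : ℕ → ℝ≥0∞} {b : ℕ → ℝ} {β : ℝ}

theorem eventually_pos_of_tendsto_div (hβ : 0 < β)
    (hb : Tendsto (fun n => b n / n) atTop (𝓝 β)) : ∀ᶠ n in atTop, 0 < b n := by
  filter_upwards [hb.eventually_const_lt hβ, eventually_gt_atTop 0] with n h1 h2
  have : (0 : ℝ) < n := by exact_mod_cast h2
  exact (div_pos_iff_of_pos_right this).1 h1

theorem eventually_mul_le_of_tendsto_div (hb : Tendsto (fun n => b n / n) atTop (𝓝 β)) {a c : ℝ}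
    (h : c * β < a) : ∀ᶠ n : ℕ in atTop, c * b n ≤ n * a := by
  filter_upwards [(hb.const_mul c).eventually_lt_const h, eventually_gt_atTop 0] with n h1 h2
  have h3 : (0 : ℝ) < n := by exact_mod_cast h2
  rw [← mul_div_assoc, div_lt_iff₀ h3] at h1
  linarith

theorem eventually_le_mul_of_tendsto_div (hb : Tendsto (fun n => b n / n) atTop (𝓝 β)) {a c : ℝ}
    (h : a < c * β) : ∀ᶠ n : ℕ in atTop, n * a ≤ c * b n := by
  filter_upwards [eventually_mul_le_of_tendsto_div hb (a := -a) (c := -c) (by linarith)] with n hn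
  linarith

theorem rpow_two_le_of_le {x y : ℝ} (h : x ≤ y) :
    ENNReal.ofReal ((2 : ℝ) ^ x) ≤ ENNReal.ofReal ((2 : ℝ) ^ y) :=
  ENNReal.ofReal_le_ofReal (Real.rpow_le_rpow_of_exponent_le one_le_two h)

variable (hβ : 0 < β) (hb : Tendsto (fun n => b n / n) atTop (𝓝 β))
include hβ hb

theorem eventually_le_rpow_of_le_liminf {T a : ℝ}
    (h : (T : EReal) ≤ liminf (fun n => -log2 (p n) / (b n : EReal)) atTop) (ha : a < T * β) :
    ∀ᶠ n : ℕ in atTop, p n ≤ ENNReal.ofReal (2 ^ (-(n * a))) := by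
  obtain ⟨c, hc1, hc2⟩ := exists_between ((div_lt_iff₀ hβ).2 ha)
  have h1 : (c : EReal) < liminf (fun n => -log2 (p n) / (b n : EReal)) atTop :=
    lt_of_lt_of_le (by exact_mod_cast hc2) h
  filter_upwards [eventually_lt_of_lt_liminf h1, eventually_pos_of_tendsto_div hβ hb,
    eventually_le_mul_of_tendsto_div hb ((div_lt_iff₀ hβ).1 hc1)] with n h2 h3 h4
  exact ((le_neg_log2_div_iff h3).1 h2.le).trans (rpow_two_le_of_le (by linarith))

theorem eventually_rpow_le_of_limsup_le {T a : ℝ}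
    (h : limsup (fun n => -log2 (p n) / (b n : EReal)) atTop ≤ (T : EReal)) (ha : T * β < a) :
    ∀ᶠ n : ℕ in atTop, ENNReal.ofReal (2 ^ (-(n * a))) ≤ p n := by
  obtain ⟨c, hc1, hc2⟩ := exists_between ((lt_div_iff₀ hβ).2 ha)
  have h1 : limsup (fun n => -log2 (p n) / (b n : EReal)) atTop < (c : EReal) :=
    lt_of_le_of_lt h (by exact_mod_cast hc1)
  filter_upwards [eventually_lt_of_limsup_lt h1, eventually_pos_of_tendsto_div hβ hb,
    eventually_mul_le_of_tendsto_div hb ((lt_div_iff₀ hβ).1 hc2)] with n h2 h3 h4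
  exact (rpow_two_le_of_le (by linarith)).trans ((neg_log2_div_le_iff h3).1 h2.le)

theorem le_liminf_of_eventually_le_rpow {e : ℝ}
    (h : ∀ a < e, ∀ᶠ n : ℕ in atTop, p n ≤ ENNReal.ofReal (2 ^ (-(n * a)))) :
    ((e / β : ℝ) : EReal) ≤ liminf (fun n => -log2 (p n) / (b n : EReal)) atTop := by
  refine le_of_forall_lt fun x hx => ?_
  obtain ⟨y, hxy, hy⟩ := EReal.lt_iff_exists_real_btwn.1 hx
  refine hxy.trans_le (le_liminf_of_le (by isBoundedDefault) ?_)
  obtain ⟨a, ha1, ha2⟩ := exists_between ((lt_div_iff₀ hβ).1 (EReal.coe_lt_coe_iff.1 hy))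
  filter_upwards [h a ha2, eventually_pos_of_tendsto_div hβ hb,
    eventually_mul_le_of_tendsto_div hb ha1] with n h1 h2 h3
  exact (le_neg_log2_div_iff h2).2 (h1.trans (rpow_two_le_of_le (by linarith)))

theorem limsup_le_of_eventually_rpow_le {e : ℝ}
    (h : ∀ a > e, ∀ᶠ n : ℕ in atTop, ENNReal.ofReal (2 ^ (-(n * a))) ≤ p n) :
    limsup (fun n => -log2 (p n) / (b n : EReal)) atTop ≤ ((e / β : ℝ) : EReal) := by
  refine le_of_forall_gt fun x hx => ?_
  obtain ⟨y, hy, hxy⟩ := EReal.lt_iff_exists_real_btwn.1 hx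
  refine (limsup_le_of_le (by isBoundedDefault) ?_).trans_lt hxy
  obtain ⟨a, ha1, ha2⟩ := exists_between ((div_lt_iff₀ hβ).1 (EReal.coe_lt_coe_iff.1 hy))
  filter_upwards [h a ha1, eventually_pos_of_tendsto_div hβ hb,
    eventually_le_mul_of_tendsto_div hb ha2] with n h1 h2 h3
  exact (neg_log2_div_le_iff h2).2 ((rpow_two_le_of_le (by linarith)).trans h1)

end Rates

theorem tendsto_natCast_div_self : Tendsto (fun n : ℕ => (n : ℝ) / n) atTop (𝓝 1) := by
  refine tendsto_const_nhds.congr' ?_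
  filter_upwards [eventually_ne_atTop 0] with n hn
  exact (div_self (by exact_mod_cast hn)).symm

theorem tendsto_two_rpow_neg_mul {a : ℝ} (ha : 0 < a) :
    Tendsto (fun n : ℕ => (2 : ℝ) ^ (-(n * a))) atTop (𝓝 0) := by
  have h := (tendsto_rpow_atBot_of_base_gt_one 2 one_lt_two).comp
    (tendsto_neg_atTop_atBot.comp ((tendsto_natCast_atTop_atTop (R := ℝ)).atTop_mul_const ha))
  exact h

/-! ### Asymptotics of a sequence of epoch schemes -/

variable {L : ℕ} {X Y : Type*} [Fintype Y]

/-- The properties of a sequence of epoch schemes that determine its asymptotic performance: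
over `Q l` an epoch has length about `n ξ_l`, is accepted with probability tending to `1`, and
ends with a wrong final decision with probability of exponent at least `e_l`, relative to `n`. -/
structure IsReliableSequence (Q : Fin L → DMC X Y) (R ξ e : Fin L → ℝ)
    (D : ℕ → EpochScheme L X Y) : Prop where
  am_pos : ∀ n, 0 < (D n).am
  log_size : ∀ l, Tendsto (fun n => Real.logb 2 ((D n).M l) / n) atTop (𝓝 (ξ l * R l))
  idealLength : ∀ l, Tendsto (fun n => ((D n).idealLength l : ℝ) / n) atTop (𝓝 (ξ l))
  maxLength : ∃ c, Tendsto (fun n => ((D n).maxLength : ℝ) / n) atTop (𝓝 c)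
  failure : ∀ l, ∃ δ : ℕ → ℝ, Tendsto δ atTop (𝓝 0) ∧ ∀ n m,
    (D n).trainingError (Q l) l + (D n).codebookError (Q l) l m +
      (D n).retrainingError (Q l) l + (D n).falseReject (Q l) l ≤ δ n
  error : ∀ l, ∀ a < e l, ∀ᶠ n : ℕ in atTop,
    (D n).retrainingError (Q l) l + (D n).falseAccept (Q l) l ≤ 2 ^ (-(n * a))

namespace IsReliableSequence

variable {Q : Fin L → DMC X Y} {R ξ e : Fin L → ℝ} {D : ℕ → EpochScheme L X Y}
  (h : IsReliableSequence Q R ξ e D) (μ : ∀ n, stdSimplex ℝ (∀ l, Fin ((D n).M l)))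
include h

open EpochScheme

theorem eventually_expectedLength_ne_top (l : Fin L) :
    ∀ᶠ n in atTop, (D n).toCodingScheme.expectedLength (Q l) (μ n) ≠ ⊤ := by
  obtain ⟨δ, h0, hδ⟩ := h.failure l
  filter_upwards [h0.eventually_lt_const one_pos] with n hn
  exact ((expectedLength_le l (μ n) (h.am_pos n) (hδ n) hn).trans_lt ENNReal.ofReal_lt_top).ne

theorem tendsto_expectedLength_div (l : Fin L) :
    Tendsto (fun n => ((D n).toCodingScheme.expectedLength (Q l) (μ n)).toReal / n) atTop
      (𝓝 (ξ l)) := by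
  obtain ⟨δ, h0, hδ⟩ := h.failure l
  obtain ⟨c, hc⟩ := h.maxLength
  have hlow : Tendsto (fun n => (1 - δ n) * ((D n).idealLength l / n)) atTop (𝓝 (ξ l)) := by
    simpa using (h0.const_sub 1).mul (h.idealLength l)
  have hupp : Tendsto (fun n => ((D n).idealLength l / n + δ n * ((D n).maxLength / n)) /
      (1 - δ n)) atTop (𝓝 (ξ l)) := by
    have := ((h.idealLength l).add (h0.mul hc)).div (h0.const_sub 1) (by norm_num)
    simp only [zero_mul, add_zero, sub_zero, div_one] at this
    exact this
  refine tendsto_of_tendsto_of_tendsto_of_le_of_le' hlow hupp ?_ ?_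
  · filter_upwards [h.eventually_expectedLength_ne_top μ l] with n hn
    rw [← mul_div_assoc]
    gcongr
    exact (ENNReal.ofReal_le_iff_le_toReal hn).1 (le_expectedLength l (μ n) (h.am_pos n) (hδ n))
  · filter_upwards [h0.eventually_lt_const one_pos,
      eventually_gt_atTop 0] with n hn hn0
    have h1 : 0 < 1 - δ n := by linarith
    have hn0' : (0 : ℝ) < n := by exact_mod_cast hn0
    have e1 : ((D n).idealLength l / n + δ n * ((D n).maxLength / n)) / (1 - δ n) =
        ((D n).idealLength l + δ n * (D n).maxLength) / (1 - δ n) / n := by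
      field_simp
    rw [e1]
    gcongr
    have hδ0 : 0 ≤ δ n := by
      refine le_trans ?_ (hδ n ⟨0, (D n).M_pos l⟩)
      have := blockProb_nonneg (Q l)
      unfold trainingError codebookError retrainingError falseReject
      linarith [this (fun h => (D n).σm h.length) (D n).am {h | (D n).θm h ≠ l},
        this ((D n).enc l ⟨0, (D n).M_pos l⟩) ((D n).bm l)
          {h | (D n).dec l h ≠ ⟨0, (D n).M_pos l⟩},
        this (fun h => (D n).σc h.length) (D n).ac {h | (D n).θc h ≠ l},
        this (fun _ => (D n).xA l) ((D n).bc l) ((D n).accept l)ᶜ]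
    exact ENNReal.toReal_le_of_le_ofReal (by positivity)
      (expectedLength_le l (μ n) (h.am_pos n) (hδ n) hn)

theorem tendsto_stoppedProb (l k : Fin L) :
    Tendsto (fun n => ((D n).toCodingScheme.stoppedProb (Q l) (μ n)
      fun _ h => ((D n).toCodingScheme.g h).1 = k).toReal) atTop (𝓝 (if k = l then 1 else 0)) := by
  obtain ⟨δ, h0, hδ⟩ := h.failure l
  have hsmall : ∀ᶠ n in atTop, δ n < 1 := h0.eventually_lt_const one_pos
  split_ifs with hk
  · subst hk
    have hlow : Tendsto (fun n => 1 - δ n) atTop (𝓝 1) := by simpa using h0.const_sub 1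
    have hupp : Tendsto (fun n => 1 / (1 - δ n)) atTop (𝓝 1) := by
      have := (tendsto_const_nhds (x := (1 : ℝ))).div hlow one_ne_zero
      rw [div_one] at this
      exact this
    refine tendsto_of_tendsto_of_tendsto_of_le_of_le' hlow hupp ?_ ?_
    · filter_upwards [hsmall] with n hn
      have h1 := stoppedProb_self_le k (μ n) (h.am_pos n) (hδ n) hn
      exact (ENNReal.ofReal_le_iff_le_toReal (h1.trans_lt ENNReal.ofReal_lt_top).ne).1
        (le_stoppedProb_self k (μ n) (h.am_pos n) (hδ n))
    · filter_upwards [hsmall] with n hn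
      have h1 : 0 < 1 - δ n := by linarith
      exact ENNReal.toReal_le_of_le_ofReal (by positivity)
        (stoppedProb_self_le k (μ n) (h.am_pos n) (hδ n) hn)
  · have hupp : Tendsto (fun n => ENNReal.ofReal (δ n / (1 - δ n))) atTop (𝓝 0) := by
      have := h0.div (h0.const_sub 1) (by norm_num)
      simpa using ENNReal.tendsto_ofReal this
    have h1 : Tendsto (fun n => (D n).toCodingScheme.stoppedProb (Q l) (μ n)
        fun _ h => ((D n).toCodingScheme.g h).1 = k) atTop (𝓝 0) := by
      refine tendsto_of_tendsto_of_tendsto_of_le_of_le' tendsto_const_nhds hupp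
        (.of_forall fun n => zero_le) ?_
      filter_upwards [hsmall] with n hn
      exact stoppedProb_ne_le l (μ n) (h.am_pos n) (hδ n) hn hk
    exact (ENNReal.tendsto_toReal ENNReal.zero_ne_top).comp h1

theorem eventually_errorProb_le (l : Fin L) {a : ℝ} (ha : a < e l) :
    ∀ᶠ n : ℕ in atTop, (D n).toCodingScheme.errorProb (Q l) (μ n) ≤
      ENNReal.ofReal (2 ^ (-(n * a))) := by
  obtain ⟨δ, h0, hδ⟩ := h.failure l
  obtain ⟨a', h1, h2⟩ := exists_between ha
  -- The factor `1 / (1 - δ n) ≤ 2` is absorbed by decreasing the exponent.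
  filter_upwards [h0.eventually_lt_const one_half_pos, h.error l a' h2,
    (tendsto_two_rpow_neg_mul (sub_pos.2 h1)).eventually_lt_const one_half_pos] with n hn h3 h4
  refine (errorProb_le l (μ n) (h.am_pos n) (hδ n) (hn.trans one_half_lt_one)).trans
    (ENNReal.ofReal_le_ofReal ?_)
  rw [div_le_iff₀ (by linarith)]
  refine h3.trans ?_
  have h5 : (2 : ℝ) ^ (-(n * a')) = 2 ^ (-(n * a)) * 2 ^ (-(n * (a' - a))) := by
    rw [← Real.rpow_add two_pos]
    congr 1
    ring
  rw [h5]
  gcongr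
  linarith

theorem achievesRate (hξ : ∀ l, 0 < ξ l) (he : ∀ l, 0 < e l) :
    AchievesRate Q R (fun n => (D n).toCodingScheme) μ := fun l => by
  have hE := h.tendsto_expectedLength_div μ l
  refine ⟨h.eventually_expectedLength_ne_top μ l, ?_, ?_, ?_⟩
  · refine (hE.pos_mul_atTop (hξ l) tendsto_natCast_atTop_atTop).congr' ?_
    filter_upwards [eventually_ne_atTop 0] with n hn
    exact div_mul_cancel₀ _ (by exact_mod_cast hn)
  · refine tendsto_of_tendsto_of_tendsto_of_le_of_le' tendsto_const_nhds ?_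
      (.of_forall fun n => zero_le) (h.eventually_errorProb_le μ l (half_lt_self (he l)))
    simpa using ENNReal.tendsto_ofReal (tendsto_two_rpow_neg_mul (half_pos (he l)))
  · have h1 : Tendsto (fun n => ∑ k, ((D n).toCodingScheme.stoppedProb (Q l) (μ n)
        fun _ h => ((D n).toCodingScheme.g h).1 = k).toReal * (Real.logb 2 ((D n).M k) / n))
        atTop (𝓝 (ξ l * R l)) := by
      have := tendsto_finsetSum Finset.univ fun k (_ : k ∈ Finset.univ) =>
        (h.tendsto_stoppedProb μ l k).mul (h.log_size k)
      simpa using this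
    have h2 := h1.div hE (hξ l).ne'
    rw [mul_div_cancel_left₀ _ (hξ l).ne'] at h2
    refine h2.congr' ?_
    filter_upwards [eventually_ne_atTop 0] with n hn
    have hn' : (n : ℝ) ≠ 0 := by exact_mod_cast hn
    simp only [← mul_div_assoc, ← Finset.sum_div, CodingScheme.rate]
    exact div_div_div_cancel_right₀ hn' _ _

theorem le_liminf_exponent (hξ : ∀ l, 0 < ξ l) (l : Fin L) :
    ((e l / ξ l : ℝ) : EReal) ≤
      liminf (fun n => (D n).toCodingScheme.exponent (Q l) (μ n)) atTop :=
  le_liminf_of_eventually_le_rpow (hξ l) (h.tendsto_expectedLength_div μ l)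
    fun _ ha => h.eventually_errorProb_le μ l ha

theorem tendsto_exponent (hξ : ∀ l, 0 < ξ l) (l : Fin L)
    (hlow : ∀ a > e l, ∀ᶠ n : ℕ in atTop, ENNReal.ofReal (2 ^ (-(n * a))) ≤
      (D n).toCodingScheme.errorProb (Q l) (μ n)) :
    Tendsto (fun n => (D n).toCodingScheme.exponent (Q l) (μ n)) atTop
      (𝓝 ((e l / ξ l : ℝ) : EReal)) :=
  tendsto_of_le_liminf_of_limsup_le (h.le_liminf_exponent μ hξ l)
    (limsup_le_of_eventually_rpow_le (hξ l) (h.tendsto_expectedLength_div μ l) hlow)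

end IsReliableSequence
end CompoundFeedback
end

noncomputable section

namespace CompoundFeedback

variable {X Y : Type*} [Fintype Y]

/-! ### Weak law of large numbers -/

/-- Second moment of a sum of i.i.d. terms about an arbitrary point `c`. -/
theorem pathExp_sum_sub_sq (Q : DMC X Y) (x : X) (z : Y → ℝ) (t : ℕ) (c : ℝ) :
    pathExp Q t (fun _ => x) (fun h => ((h.map z).sum - c) ^ 2) =
      t * (∑ y, (Q x).1 y * z y ^ 2 - (∑ y, (Q x).1 y * z y) ^ 2) +
        (t * ∑ y, (Q x).1 y * z y - c) ^ 2 := by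
  induction t generalizing c with
  | zero => simp [pathExp]
  | succ t ih =>
    set m := ∑ y, (Q x).1 y * z y with hm
    set s := ∑ y, (Q x).1 y * z y ^ 2 with hs
    have h1 : ∀ y, pathExp Q t (fun _ => x) (fun h => (((y :: h).map z).sum - c) ^ 2) =
        t * (s - m ^ 2) + (t * m - (c - z y)) ^ 2 := by
      intro y
      rw [← ih]
      refine pathExp_congr Q (fun _ _ => rfl) fun h _ => ?_
      simp only [List.map_cons, List.sum_cons]
      ring
    simp only [pathExp, h1]
    have h2 : ∀ y, (Q x).1 y * (t * (s - m ^ 2) + (t * m - (c - z y)) ^ 2) =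
        (Q x).1 y * (t * (s - m ^ 2) + (t * m - c) ^ 2) +
          ((Q x).1 y * z y) * (2 * (t * m - c)) + (Q x).1 y * z y ^ 2 := fun y => by ring
    simp only [h2, Finset.sum_add_distrib, ← Finset.sum_mul, Q.sum_eq_one, ← hm, ← hs]
    push_cast
    ring

/-- Chebyshev's inequality for sums of i.i.d. terms. -/
theorem blockProb_deviation_le (Q : DMC X Y) (x : X) (z : Y → ℝ) {t : ℕ} (ht : 0 < t) {δ : ℝ}
    (hδ : 0 < δ) :
    blockProb Q (fun _ => x) t
        {h | t * δ ≤ |(h.map z).sum - t * ∑ y, (Q x).1 y * z y|} ≤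
      (∑ y, (Q x).1 y * z y ^ 2) / (t * δ ^ 2) := by
  have ht' : (0 : ℝ) < t := by exact_mod_cast ht
  set m := ∑ y, (Q x).1 y * z y with hm
  set s := ∑ y, (Q x).1 y * z y ^ 2 with hs
  have h1 := pathExp_sum_sub_sq Q x z t (t * m)
  rw [← hm, ← hs, sub_self, zero_pow two_ne_zero, add_zero] at h1
  rw [le_div_iff₀ (by positivity), blockProb_eq_pathExp]
  have h2 : pathExp Q t (fun _ => x)
      ({h : List Y | t * δ ≤ |(h.map z).sum - t * m|}.indicator 1) * (t * δ) ^ 2 ≤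
      t * (s - m ^ 2) := by
    rw [← h1, ← pathExp_mul_const]
    refine pathExp_mono Q fun h _ => ?_
    by_cases hh : t * δ ≤ |(h.map z).sum - t * m|
    · rw [Set.indicator_of_mem (by exact hh), Pi.one_apply, one_mul, ← sq_abs (_ - _)]
      gcongr
    · rw [Set.indicator_of_notMem (by exact hh), zero_mul]
      positivity
  have h3 : (t : ℝ) * (s - m ^ 2) ≤ t * s := by
    gcongr
    linarith [sq_nonneg m]
  have h4 := h2.trans h3
  rw [mul_pow, pow_two (t : ℝ), mul_assoc, mul_left_comm] at h4
  exact le_of_mul_le_mul_left h4 ht'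

/-! ### Hypothesis testing between two inputs -/

section Testing

variable (Q : DMC X Y) (a r : X)

/-- Log-likelihood ratio of the inputs `a` and `r`. -/
def logRatio (y : Y) : ℝ := Real.logb 2 ((Q a).1 y / (Q r).1 y)

variable {Q a r}

/-- Change of measure from the input `r` to the input `a`. -/
theorem pathExp_change_measure (hac : ∀ y, (Q r).1 y = 0 → (Q a).1 y = 0) (t : ℕ)
    (ψ : List Y → ℝ) :
    pathExp Q t (fun _ => r) ({h | ∀ y ∈ h, (Q a).1 y ≠ 0}.indicator ψ) =
      pathExp Q t (fun _ => a) (fun h => 2 ^ (-(h.map (logRatio Q a r)).sum) * ψ h) := by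
  induction t generalizing ψ with
  | zero => simp [pathExp]
  | succ t ih =>
    simp only [pathExp]
    refine Finset.sum_congr rfl fun y _ => ?_
    by_cases hy : (Q a).1 y = 0
    · simp [hy]
    · have hr : (Q r).1 y ≠ 0 := fun h => hy (hac y h)
      have hapos := (Q.nonneg a y).lt_of_ne' hy
      have hrpos := (Q.nonneg r y).lt_of_ne' hr
      have h1 : ∀ h : List Y, {h | ∀ y ∈ h, (Q a).1 y ≠ 0}.indicator ψ (y :: h) =
          {h | ∀ y ∈ h, (Q a).1 y ≠ 0}.indicator (fun h => ψ (y :: h)) h := fun h => by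
        by_cases hh : ∀ y ∈ h, (Q a).1 y ≠ 0
        · rw [Set.indicator_of_mem (by simpa [hy] using hh), Set.indicator_of_mem (by exact hh)]
        · rw [Set.indicator_of_notMem (by simpa [hy] using hh),
            Set.indicator_of_notMem (by exact hh)]
      have h2 : (2 : ℝ) ^ (-logRatio Q a r y) = (Q r).1 y / (Q a).1 y := by
        rw [logRatio, ← Real.logb_inv, inv_div,
          Real.rpow_logb two_pos (by norm_num) (by positivity)]
      simp only [h1, ih, List.map_cons, List.sum_cons, neg_add, Real.rpow_add two_pos, h2, mul_assoc]
      rw [pathExp_const_mul, ← mul_assoc, mul_div_cancel₀ _ hy]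

theorem pathExp_support (t : ℕ) (ψ : List Y → ℝ) :
    pathExp Q t (fun _ => a) ({h | ∀ y ∈ h, (Q a).1 y ≠ 0}.indicator ψ) =
      pathExp Q t (fun _ => a) ψ := by
  induction t generalizing ψ with
  | zero => simp [pathExp]
  | succ t ih =>
    simp only [pathExp]
    refine Finset.sum_congr rfl fun y _ => ?_
    by_cases hy : (Q a).1 y = 0
    · simp [hy]
    · rw [← ih (fun h => ψ (y :: h))]
      congr 2
      funext h
      by_cases hh : ∀ y ∈ h, (Q a).1 y ≠ 0
      · rw [Set.indicator_of_mem (by simpa [hy] using hh), Set.indicator_of_mem (by exact hh)]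
      · rw [Set.indicator_of_notMem (by simpa [hy] using hh),
          Set.indicator_of_notMem (by exact hh)]

variable (Q a r) in
/-- Typical outputs for the input `a`, of length `t` and with tolerance `δ`. -/
def typicalSet (t : ℕ) (δ : ℝ) : Set (List Y) :=
  {h | (∀ y ∈ h, (Q a).1 y ≠ 0) ∧
    |(h.map (logRatio Q a r)).sum - t * ∑ y, (Q a).1 y * logRatio Q a r y| < t * δ}

theorem blockProb_typicalSet_compl_le {t : ℕ} (ht : 0 < t) {δ : ℝ} (hδ : 0 < δ) :
    blockProb Q (fun _ => a) t (typicalSet Q a r t δ)ᶜ ≤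
      (∑ y, (Q a).1 y * logRatio Q a r y ^ 2) / (t * δ ^ 2) := by
  refine le_trans ?_ (blockProb_deviation_le Q a (logRatio Q a r) ht hδ)
  rw [blockProb_eq_pathExp, blockProb_eq_pathExp, ← pathExp_support]
  refine pathExp_mono Q fun h _ => ?_
  by_cases h1 : ∀ y ∈ h, (Q a).1 y ≠ 0
  · rw [Set.indicator_of_mem (by exact h1)]
    by_cases h2 : |(h.map (logRatio Q a r)).sum - t * ∑ y, (Q a).1 y * logRatio Q a r y| < t * δ
    · rw [Set.indicator_of_notMem (by simpa using ⟨h1, h2⟩)]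
      exact Set.indicator_nonneg (by simp) _
    · exact (Set.indicator_le_self' (by simp) _).trans_eq
        (Set.indicator_of_mem (by simpa using h2) _).symm
  · rw [Set.indicator_of_notMem (by exact h1)]
    exact Set.indicator_nonneg (by simp) _

theorem blockProb_typicalSet_eq (hac : ∀ y, (Q r).1 y = 0 → (Q a).1 y = 0) (t : ℕ) (δ : ℝ) :
    blockProb Q (fun _ => r) t (typicalSet Q a r t δ) = pathExp Q t (fun _ => a) fun h =>
      2 ^ (-(h.map (logRatio Q a r)).sum) * (typicalSet Q a r t δ).indicator 1 h := by
  rw [← pathExp_change_measure hac, blockProb_eq_pathExp, Set.indicator_indicator,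
    Set.inter_eq_right.2 fun h hh => hh.1]

theorem blockProb_typicalSet_le (hac : ∀ y, (Q r).1 y = 0 → (Q a).1 y = 0) (t : ℕ) (δ : ℝ) :
    blockProb Q (fun _ => r) t (typicalSet Q a r t δ) ≤
      2 ^ (-(t * ((∑ y, (Q a).1 y * logRatio Q a r y) - δ))) := by
  rw [blockProb_typicalSet_eq hac]
  refine pathExp_le Q fun h _ => ?_
  by_cases hh : h ∈ typicalSet Q a r t δ
  · rw [Set.indicator_of_mem hh, Pi.one_apply, mul_one]
    refine Real.rpow_le_rpow_of_exponent_le one_le_two ?_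
    linarith [(abs_lt.1 hh.2).1]
  · rw [Set.indicator_of_notMem hh, mul_zero]
    positivity

theorem le_blockProb_typicalSet (hac : ∀ y, (Q r).1 y = 0 → (Q a).1 y = 0) (t : ℕ) (δ : ℝ) :
    2 ^ (-(t * ((∑ y, (Q a).1 y * logRatio Q a r y) + δ))) *
        blockProb Q (fun _ => a) t (typicalSet Q a r t δ) ≤
      blockProb Q (fun _ => r) t (typicalSet Q a r t δ) := by
  rw [blockProb_typicalSet_eq hac, blockProb_eq_pathExp, ← pathExp_const_mul]
  refine pathExp_mono Q fun h _ => ?_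
  by_cases hh : h ∈ typicalSet Q a r t δ
  · rw [Set.indicator_of_mem hh, Pi.one_apply, mul_one, mul_one]
    refine Real.rpow_le_rpow_of_exponent_le one_le_two ?_
    linarith [(abs_lt.1 hh.2).2]
  · rw [Set.indicator_of_notMem hh, mul_zero, mul_zero]

/-- Stein's lemma for the typical-set test. The test for length `t` has tolerance `t ^ (-1/4)`,
which makes the exponent exact. -/
theorem exists_test (hac : ∀ y, (Q r).1 y = 0 → (Q a).1 y = 0) :
    ∃ A : ℕ → Set (List Y),
      Tendsto (fun t => blockProb Q (fun _ => a) t (A t)ᶜ) atTop (𝓝 0) ∧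
      Tendsto (fun t : ℕ => -log2 (ENNReal.ofReal (blockProb Q (fun _ => r) t (A t))) /
        ((t : ℝ) : EReal)) atTop
        (𝓝 ((∑ y, (Q a).1 y * logRatio Q a r y : ℝ) : EReal)) := by
  set D := ∑ y, (Q a).1 y * logRatio Q a r y with hD
  set s := ∑ y, (Q a).1 y * logRatio Q a r y ^ 2 with hs
  set δ : ℕ → ℝ := fun t => √((√(t : ℝ))⁻¹) with hδ
  have hsqrt : Tendsto (fun t : ℕ => √(t : ℝ)) atTop atTop :=
    Real.tendsto_sqrt_atTop.comp tendsto_natCast_atTop_atTop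
  have hδ0 : Tendsto δ atTop (𝓝 0) := by
    have := (Real.continuous_sqrt.tendsto 0).comp (tendsto_inv_atTop_zero.comp hsqrt)
    rw [Real.sqrt_zero] at this
    exact this
  have hδpos : ∀ t, 0 < t → 0 < δ t := fun t ht => by
    have : (0 : ℝ) < t := by exact_mod_cast ht
    positivity
  have hacc : Tendsto (fun t => blockProb Q (fun _ => a) t (typicalSet Q a r t (δ t))ᶜ) atTop
      (𝓝 0) := by
    refine tendsto_of_tendsto_of_tendsto_of_le_of_le' tendsto_const_nhds
      (hsqrt.const_div_atTop s) (.of_forall fun t => blockProb_nonneg _ _ _ _) ?_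
    filter_upwards [eventually_gt_atTop 0] with t ht
    refine (blockProb_typicalSet_compl_le ht (hδpos t ht)).trans_eq ?_
    have h1 : (0 : ℝ) < t := by exact_mod_cast ht
    rw [Real.sq_sqrt (by positivity), ← div_eq_mul_inv, Real.div_sqrt]
  refine ⟨fun t => typicalSet Q a r t (δ t), hacc, ?_⟩
  rw [← div_one D]
  refine tendsto_of_le_liminf_of_limsup_le
    (le_liminf_of_eventually_le_rpow one_pos tendsto_natCast_div_self fun c hc => ?_)
    (limsup_le_of_eventually_rpow_le one_pos tendsto_natCast_div_self fun c hc => ?_)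
  · filter_upwards [hδ0.eventually_lt_const (sub_pos.2 hc)] with t ht
    refine ENNReal.ofReal_le_ofReal ((blockProb_typicalSet_le hac t (δ t)).trans ?_)
    refine Real.rpow_le_rpow_of_exponent_le one_le_two (neg_le_neg ?_)
    gcongr
    linarith
  · have hc' : 0 < (c - D) / 2 := half_pos (sub_pos.2 hc)
    filter_upwards [hδ0.eventually_lt_const hc', hacc.eventually_lt_const one_half_pos,
      (tendsto_two_rpow_neg_mul hc').eventually_lt_const one_half_pos] with t h1 h2 h3
    rw [blockProb_compl] at h2
    refine ENNReal.ofReal_le_ofReal (le_trans ?_ (le_blockProb_typicalSet hac t (δ t)))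
    have h4 : (2 : ℝ) ^ (-(t * c)) =
        2 ^ (-(t * (D + (c - D) / 2))) * 2 ^ (-(t * ((c - D) / 2))) := by
      rw [← Real.rpow_add two_pos]
      congr 1
      ring
    rw [h4]
    refine mul_le_mul (Real.rpow_le_rpow_of_exponent_le one_le_two (neg_le_neg ?_))
      (by linarith) (by positivity) (by positivity)
    gcongr

end Testing

end CompoundFeedback
end

noncomputable section

namespace CompoundFeedback

/-! ### The channel coding theorem -/

section Feinstein

variable {A B : Type*} [Fintype A] [Fintype B]

theorem exists_le_of_sum_mul_le {p f : A → ℝ} (hp : ∀ a, 0 ≤ p a) (hp1 : ∑ a, p a = 1) {c : ℝ}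
    (h : ∑ a, p a * f a ≤ c) : ∃ a, f a ≤ c := by
  by_contra! hlt
  obtain ⟨a, ha⟩ : ∃ a, 0 < p a := by
    by_contra! hle
    have : ∑ a, p a ≤ 0 := Finset.sum_nonpos fun a _ => hle a
    linarith
  have : ∑ a, p a * c < ∑ a, p a * f a :=
    Finset.sum_lt_sum (fun a _ => mul_le_mul_of_nonneg_left (hlt a).le (hp a))
      ⟨a, Finset.mem_univ _, mul_lt_mul_of_pos_left (hlt a) ha⟩
  rw [← Finset.sum_mul, hp1, one_mul] at this
  linarith

open Classical in
/-- Feinstein's lemma. The code is built greedily: as long as the outputs that are decoded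
already have small probability under the output distribution, some input `a` has most of its
output probability in the part of `G a` that is not yet decoded. The decoder `g` takes values in
`ℕ`; outputs with value at least `M` are not decoded. -/
theorem exists_code (p : A → ℝ) (hp : ∀ a, 0 ≤ p a) (hp1 : ∑ a, p a = 1) (W : A → B → ℝ)
    (hW : ∀ a b, 0 ≤ W a b) (hW1 : ∀ a, ∑ b, W a b = 1) (G : A → Set B) {Λ ε : ℝ} (hΛ : 0 < Λ)
    (hG : ∀ a, ∀ b ∈ G a, Λ * ∑ a', p a' * W a' b ≤ W a b) (M : ℕ)
    (hε : (∑ a, p a * ∑ b with b ∉ G a, W a b) + M / Λ ≤ ε) :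
    ∃ (c : ℕ → A) (g : B → ℕ), ∀ m < M, ∑ b with g b ≠ m, W (c m) b ≤ ε := by
  set q : B → ℝ := fun b => ∑ a, p a * W a b with hq
  have hq0 : ∀ b, 0 ≤ q b := fun b => Finset.sum_nonneg fun a _ => mul_nonneg (hp a) (hW a b)
  suffices H : ∀ K ≤ M, ∃ (c : ℕ → A) (g : B → ℕ), (∀ m < K, ∑ b with g b ≠ m, W (c m) b ≤ ε) ∧
      ∑ b with g b < K, q b ≤ K / Λ by
    obtain ⟨c, g, h, -⟩ := H M le_rfl
    exact ⟨c, g, h⟩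
  intro K
  induction K with
  | zero =>
    intro _
    obtain ⟨a, -⟩ := exists_le_of_sum_mul_le (f := fun _ => 0) (c := 0) hp hp1 (by simp)
    exact ⟨fun _ => a, fun _ => 0, by simp, by simp⟩
  | succ K ih =>
    intro hK
    obtain ⟨c, g, h1, h2⟩ := ih (by omega)
    have h3 : ∑ a, p a * ∑ b with ¬ (K ≤ g b ∧ b ∈ G a), W a b ≤ ε := by
      refine le_trans ?_ hε
      have h4 : ∀ a, ∑ b with ¬ (K ≤ g b ∧ b ∈ G a), W a b ≤
          (∑ b with b ∉ G a, W a b) + ∑ b with g b < K, W a b := fun a => by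
        simp only [Finset.sum_filter, ← Finset.sum_add_distrib]
        refine Finset.sum_le_sum fun b _ => ?_
        have := hW a b
        by_cases hb : b ∈ G a <;> rcases lt_or_ge (g b) K with hk | hk <;>
          simp [hb, hk, not_le.2, not_lt.2, this]
      have h5 : ∑ a, p a * ∑ b with g b < K, W a b = ∑ b with g b < K, q b := by
        simp only [Finset.mul_sum, hq]
        rw [Finset.sum_comm]
      have h6 : (K : ℝ) / Λ ≤ M / Λ := by
        have : K ≤ M := by omega
        gcongr
      calc _ ≤ ∑ a, p a * ((∑ b with b ∉ G a, W a b) + ∑ b with g b < K, W a b) :=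
            Finset.sum_le_sum fun a _ => mul_le_mul_of_nonneg_left (h4 a) (hp a)
        _ = (∑ a, p a * ∑ b with b ∉ G a, W a b) + ∑ b with g b < K, q b := by
            simp only [mul_add, Finset.sum_add_distrib, h5]
        _ ≤ _ := by linarith
    obtain ⟨a, ha⟩ := exists_le_of_sum_mul_le hp hp1 h3
    let g' : B → ℕ := fun b => if g b < K then g b else if b ∈ G a then K else K + 1
    have hg' : ∀ b, g' b = if g b < K then g b else if b ∈ G a then K else K + 1 := fun _ => rfl
    refine ⟨fun m => if m = K then a else c m, g', fun m hm => ?_, ?_⟩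
    · rcases eq_or_ne m K with rfl | hne
      · simp only [if_true]
        refine le_trans (le_of_eq ?_) ha
        congr 1
        ext b
        simp only [Finset.mem_filter, Finset.mem_univ, true_and, hg']
        split_ifs with h4 h5 <;> (simp_all; try omega)
      · simp only [hne, if_false]
        refine le_trans (le_of_eq ?_) (h1 m (by omega))
        congr 1
        ext b
        simp only [Finset.mem_filter, Finset.mem_univ, true_and, hg']
        split_ifs <;> omega
    · have h4 : ∑ b with g' b < K + 1, q b ≤
          (∑ b with g b < K, q b) + ∑ b with b ∈ G a, q b := by
        simp only [Finset.sum_filter, ← Finset.sum_add_distrib]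
        refine Finset.sum_le_sum fun b _ => ?_
        have := hq0 b
        simp only [hg']
        split_ifs <;> first | omega | linarith
      have h5 : ∑ b with b ∈ G a, q b ≤ 1 / Λ := by
        rw [le_div_iff₀ hΛ, Finset.sum_mul, ← hW1 a]
        refine (Finset.sum_le_sum fun b hb => ?_).trans
          (Finset.sum_le_sum_of_subset_of_nonneg (Finset.filter_subset (· ∈ G a) _)
            fun b _ _ => hW a b)
        rw [mul_comm]
        exact hG a b (Finset.mem_filter.1 hb).2
      push_cast
      rw [add_div]
      linarith

end Feinstein

variable {X Y : Type*} [Fintype Y]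

theorem sum_prod_eq_one {Z : Type*} [Fintype Z] {b : ℕ} {f : Fin b → Z → ℝ}
    (hf : ∀ i, ∑ z, f i z = 1) : ∑ z : Fin b → Z, ∏ i, f i (z i) = 1 := by
  rw [← Fintype.piFinset_univ, ← Finset.prod_univ_sum]
  simp [hf]

/-- A block code without feedback, as an encoder and a decoder on lists. -/
theorem exists_enc_dec {M : ℕ} (hM : 0 < M) [Nonempty X] (Q : DMC X Y) {b : ℕ} {ε : ℝ}
    (c : ℕ → Fin b → X) (g : (Fin b → Y) → ℕ)
    (h : ∀ m < M, (∑ y : Fin b → Y, if g y ≠ m then ∏ i, (Q (c m i)).1 (y i) else 0) ≤ ε) :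
    ∃ (enc : Fin M → List Y → X) (dec : List Y → Fin M),
      ∀ m, blockProb Q (enc m) b {h | dec h ≠ m} ≤ ε := by
  classical
  obtain ⟨x₀⟩ := ‹Nonempty X›
  refine ⟨fun m h => if hl : h.length < b then c m ⟨h.length, hl⟩ else x₀,
    Function.extend List.ofFn (fun y => if hy : g y < M then ⟨g y, hy⟩ else ⟨0, hM⟩)
      (fun _ => ⟨0, hM⟩), fun m => le_trans (Finset.sum_le_sum fun y _ => ?_) (h m m.2)⟩
  have hpath : pathProb Q (fun h => if hl : h.length < b then c m ⟨h.length, hl⟩ else x₀) y =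
      ∏ i, (Q (c m i)).1 (y i) :=
    Finset.prod_congr rfl fun i _ => by simp
  have hnn : 0 ≤ ∏ i, (Q (c m i)).1 (y i) := Finset.prod_nonneg fun i _ => Q.nonneg _ _
  rw [hpath]
  by_cases hg : g y = m
  · rw [if_neg, if_neg (not_not.2 hg)]
    simp [List.ofFn_injective.extend_apply, hg]
  · rw [if_pos hg]
    split_ifs <;> [exact le_rfl; exact hnn]

variable [Fintype X]

/-- The joint law of input and output, as a channel with trivial input. -/
def jointLaw (p : stdSimplex ℝ X) (Q : DMC X Y) : DMC Unit (X × Y) := fun _ =>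
  ⟨fun z => p.1 z.1 * (Q z.1).1 z.2, fun z => mul_nonneg (p.2.1 _) (Q.nonneg _ _), by
    simp [Fintype.sum_prod_type, ← Finset.mul_sum, Q.sum_eq_one, p.2.2]⟩

/-- Information density. -/
def infoDensity (p : stdSimplex ℝ X) (Q : DMC X Y) (z : X × Y) : ℝ :=
  Real.logb 2 ((Q z.1).1 z.2 / ∑ x', p.1 x' * (Q x').1 z.2)

theorem sum_jointLaw_infoDensity (p : stdSimplex ℝ X) (Q : DMC X Y) :
    ∑ z, (jointLaw p Q ()).1 z * infoDensity p Q z = mutualInfo p Q := by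
  simp [Fintype.sum_prod_type, mutualInfo, jointLaw, infoDensity]

/-- The set of outputs whose likelihood, for the input block `x`, exceeds their probability by a
factor of at least `2 ^ (b θ)`. -/
def likelySet (p : stdSimplex ℝ X) (Q : DMC X Y) (b : ℕ) (θ : ℝ) (x : Fin b → X) :
    Set (Fin b → Y) :=
  {y | (2 : ℝ) ^ (b * θ) * ∏ i, ∑ x', p.1 x' * (Q x').1 (y i) ≤ ∏ i, (Q (x i)).1 (y i)}

open Classical in
/-- By the weak law of large numbers, the likelihood ratio of a random block is seldom below
`2 ^ (b (I - δ))`, where `I` is the mutual information. -/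
theorem sum_likelySet_compl_le (p : stdSimplex ℝ X) (Q : DMC X Y) {b : ℕ} (hb : 0 < b) {δ : ℝ}
    (hδ : 0 < δ) :
    (∑ x : Fin b → X, (∏ i, p.1 (x i)) *
        ∑ y with y ∉ likelySet p Q b (mutualInfo p Q - δ) x, ∏ i, (Q (x i)).1 (y i)) ≤
      (∑ z, (jointLaw p Q ()).1 z * infoDensity p Q z ^ 2) / (b * δ ^ 2) := by
  refine le_trans ?_ (blockProb_deviation_le (jointLaw p Q) () (infoDensity p Q) hb hδ)
  rw [sum_jointLaw_infoDensity, blockProb, ← (Equiv.arrowProdEquivProdArrow _ _ _).symm.sum_comp,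
    Fintype.sum_prod_type]
  refine Finset.sum_le_sum fun x _ => ?_
  rw [Finset.mul_sum, Finset.sum_filter]
  refine Finset.sum_le_sum fun y _ => ?_
  have hpath : pathProb (jointLaw p Q) (fun _ => ())
      ((Equiv.arrowProdEquivProdArrow (Fin b) (fun _ => X) fun _ => Y).symm (x, y)) =
        (∏ i, p.1 (x i)) * ∏ i, (Q (x i)).1 (y i) := by
    simp [pathProb, jointLaw, Equiv.arrowProdEquivProdArrow, Finset.prod_mul_distrib]
  have hnn : 0 ≤ (∏ i, p.1 (x i)) * ∏ i, (Q (x i)).1 (y i) :=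
    mul_nonneg (Finset.prod_nonneg fun i _ => p.2.1 _) (Finset.prod_nonneg fun i _ => Q.nonneg _ _)
  rw [hpath]
  by_cases hy : y ∈ likelySet p Q b (mutualInfo p Q - δ) x
  · rw [if_neg (not_not.2 hy)]
    split_ifs <;> [exact hnn; exact le_rfl]
  rw [if_pos hy]
  rcases hnn.eq_or_lt with h0 | hpos
  · rw [← h0]
    simp
  refine le_of_eq (if_pos ?_).symm
  -- All factors are positive, so the likelihood ratio is `2` to the sum of information densities.
  have hp' : ∀ i, 0 < p.1 (x i) := fun i => (p.2.1 _).lt_of_ne' fun h => hpos.ne' (by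
    rw [Finset.prod_eq_zero (Finset.mem_univ i) h, zero_mul])
  have hQ' : ∀ i, 0 < (Q (x i)).1 (y i) := fun i => (Q.nonneg _ _).lt_of_ne' fun h => hpos.ne' (by
    rw [Finset.prod_eq_zero (f := fun i => (Q (x i)).1 (y i)) (Finset.mem_univ i) h, mul_zero])
  have hq : ∀ i, 0 < ∑ x', p.1 x' * (Q x').1 (y i) := fun i =>
    Finset.sum_pos' (fun x' _ => mul_nonneg (p.2.1 _) (Q.nonneg _ _))
      ⟨x i, Finset.mem_univ _, mul_pos (hp' i) (hQ' i)⟩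
  have hsum : (List.map (infoDensity p Q) (List.ofFn
      ((Equiv.arrowProdEquivProdArrow (Fin b) (fun _ => X) fun _ => Y).symm (x, y)))).sum =
      ∑ i, infoDensity p Q (x i, y i) := by
    rw [List.map_ofFn, List.sum_ofFn]
    rfl
  have hprod : (2 : ℝ) ^ (∑ i, infoDensity p Q (x i, y i)) =
      (∏ i, (Q (x i)).1 (y i)) / ∏ i, ∑ x', p.1 x' * (Q x').1 (y i) := by
    rw [Real.rpow_sum_of_pos two_pos, ← Finset.prod_div_distrib]
    exact Finset.prod_congr rfl fun i _ =>
      Real.rpow_logb two_pos (by norm_num) (div_pos (hQ' i) (hq i))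
  have hlt : ∑ i, infoDensity p Q (x i, y i) < b * (mutualInfo p Q - δ) := by
    rw [← Real.rpow_lt_rpow_left_iff one_lt_two, hprod,
      div_lt_iff₀ (Finset.prod_pos fun i _ => hq i)]
    exact not_le.1 hy
  change (b : ℝ) * δ ≤ |_ - _|
  rw [hsum, abs_sub_comm]
  refine le_trans ?_ (le_abs_self _)
  linarith

theorem sum_prod_mul_prod (p : stdSimplex ℝ X) (Q : DMC X Y) {b : ℕ} (y : Fin b → Y) :
    ∑ x : Fin b → X, (∏ i, p.1 (x i)) * ∏ i, (Q (x i)).1 (y i) =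
      ∏ i, ∑ x', p.1 x' * (Q x').1 (y i) := by
  simp only [← Finset.prod_mul_distrib]
  rw [Finset.prod_univ_sum, Fintype.piFinset_univ]

/-- Channel coding theorem: rates below capacity are achievable, with small maximal error. -/
theorem eventually_exists_code [Nonempty X] (Q : DMC X Y) {ρ : ℝ} (hρ : ρ < capacity Q) {ε : ℝ}
    (hε : 0 < ε) : ∀ᶠ b : ℕ in atTop, ∀ M : ℕ, 0 < M → (M : ℝ) ≤ 2 ^ (b * ρ) →
      ∃ (enc : Fin M → List Y → X) (dec : List Y → Fin M),
        ∀ m, blockProb Q (enc m) b {h | dec h ≠ m} ≤ ε := by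
  classical
  have : Nonempty (stdSimplex ℝ X) := inferInstance
  obtain ⟨p, hp⟩ := exists_lt_of_lt_ciSup hρ
  set δ := (mutualInfo p Q - ρ) / 2 with hδ
  have hδ0 : 0 < δ := by linarith
  set s := ∑ z, (jointLaw p Q ()).1 z * infoDensity p Q z ^ 2 with hs
  have h1 : Tendsto (fun b : ℕ => s / (b * δ ^ 2)) atTop (𝓝 0) :=
    (tendsto_natCast_atTop_atTop.atTop_mul_const (by positivity)).const_div_atTop s
  filter_upwards [h1.eventually_lt_const (half_pos hε),
    (tendsto_two_rpow_neg_mul hδ0).eventually_lt_const (half_pos hε), eventually_gt_atTop 0]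
    with b hb1 hb2 hb0 M hM hMb
  have hΛ : (0 : ℝ) < 2 ^ (b * (mutualInfo p Q - δ)) := by positivity
  have hMΛ : (M : ℝ) / 2 ^ (b * (mutualInfo p Q - δ)) ≤ ε / 2 := by
    refine le_trans ?_ hb2.le
    rw [div_le_iff₀ hΛ, ← Real.rpow_add two_pos]
    refine hMb.trans_eq ?_
    congr 1
    rw [hδ]
    ring
  obtain ⟨c, g, hcg⟩ := exists_code (fun x : Fin b → X => ∏ i, p.1 (x i))
    (fun x => Finset.prod_nonneg fun i _ => p.2.1 _) (sum_prod_eq_one fun _ => p.2.2)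
    (fun x y => ∏ i, (Q (x i)).1 (y i)) (fun x y => Finset.prod_nonneg fun i _ => Q.nonneg _ _)
    (fun x => sum_prod_eq_one fun i => Q.sum_eq_one _) (likelySet p Q b (mutualInfo p Q - δ)) hΛ
    (fun x y hy => by rw [sum_prod_mul_prod]; exact hy) M (ε := ε) (by
      have := sum_likelySet_compl_le p Q hb0 hδ0
      linarith)
  refine exists_enc_dec hM Q c g fun m hm => ?_
  have := hcg m hm
  rwa [Finset.sum_filter] at this

end CompoundFeedback
end

noncomputable section

namespace CompoundFeedback

/-! ### Channels of positive capacity and finite Burnashev exponent -/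

section Channel

variable {X Y : Type*} [Fintype Y] {Q : DMC X Y}

theorem divergence_le_burnashev (a r : X) : divergence (Q a) (Q r) ≤ burnashev Q :=
  le_iSup₂ (f := fun a r => divergence (Q a) (Q r)) a r

variable [Fintype X]

theorem exists_ne_of_capacity_pos (hC : 0 < capacity Q) : ∃ x x', Q x ≠ Q x' := by
  by_contra! hQ
  refine hC.not_ge (Real.iSup_nonpos fun p => le_of_eq ?_)
  refine Finset.sum_eq_zero fun x _ => Finset.sum_eq_zero fun y _ => ?_
  have h1 : ∑ x', p.1 x' * (Q x').1 y = (Q x).1 y := by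
    simp only [fun x' => hQ x' x, ← Finset.sum_mul, p.2.2, one_mul]
  rw [h1]
  by_cases h : (Q x).1 y = 0 <;> simp [h]

theorem divergence_ne_top {p q : stdSimplex ℝ Y} (h : divergence p q ≠ ⊤) :
    (∀ y, q.1 y = 0 → p.1 y = 0) ∧
      divergence p q = ENNReal.ofReal (∑ y, p.1 y * Real.logb 2 (p.1 y / q.1 y)) := by
  by_cases hac : ∀ y, q.1 y = 0 → p.1 y = 0
  · exact ⟨hac, if_pos hac⟩
  · exact absurd (if_neg hac) h

/-- Gibbs' inequality, in strict form. -/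
theorem sum_mul_logb_div_pos {p q : stdSimplex ℝ Y} (hac : ∀ y, q.1 y = 0 → p.1 y = 0)
    (hne : p ≠ q) : 0 < ∑ y, p.1 y * Real.logb 2 (p.1 y / q.1 y) := by
  have hlog2 : 0 < Real.log 2 := Real.log_pos one_lt_two
  have key : ∀ y, p.1 y - q.1 y ≤ p.1 y * Real.log (p.1 y / q.1 y) ∧
      (p.1 y ≠ q.1 y → p.1 y - q.1 y < p.1 y * Real.log (p.1 y / q.1 y)) := by
    intro y
    have hq := q.2.1 y
    rcases (p.2.1 y).eq_or_lt with h0 | hp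
    · rw [← h0]
      refine ⟨by simpa using hq, fun h => ?_⟩
      simpa using hq.lt_of_ne h
    · have hq' : 0 < q.1 y := hq.lt_of_ne' fun h => hp.ne' (hac y h)
      have hinv : Real.log (p.1 y / q.1 y) = -Real.log (q.1 y / p.1 y) := by
        rw [← Real.log_inv, inv_div]
      have hmul : p.1 y * (q.1 y / p.1 y) = q.1 y := by field_simp
      rw [hinv]
      constructor
      · have := mul_le_mul_of_nonneg_left (Real.log_le_sub_one_of_pos (div_pos hq' hp)) hp.le
        linarith
      · intro hpq
        have := mul_lt_mul_of_pos_left (Real.log_lt_sub_one_of_pos (div_pos hq' hp)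
          (by rw [Ne, div_eq_one_iff_eq hp.ne']; exact hpq.symm)) hp
        linarith
  obtain ⟨y, hy⟩ : ∃ y, p.1 y ≠ q.1 y := by
    by_contra! h
    exact hne (Subtype.ext (funext h))
  have h1 := Finset.sum_lt_sum (fun y (_ : y ∈ Finset.univ) => (key y).1)
    ⟨y, Finset.mem_univ y, (key y).2 hy⟩
  rw [Finset.sum_sub_distrib, p.2.2, q.2.2, sub_self] at h1
  simp only [Real.logb, ← mul_div_assoc, ← Finset.sum_div]
  exact div_pos h1 hlog2

theorem burnashev_toReal_pos (hB : burnashev Q ≠ ⊤) (hC : 0 < capacity Q) :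
    0 < (burnashev Q).toReal := by
  obtain ⟨a, r, hne⟩ := exists_ne_of_capacity_pos hC
  have hle := divergence_le_burnashev (Q := Q) a r
  obtain ⟨hac, heq⟩ := divergence_ne_top (ne_top_of_le_ne_top hB hle)
  refine ENNReal.toReal_pos (fun h0 => ?_) hB
  rw [h0, heq] at hle
  exact (ENNReal.ofReal_pos.2 (sum_mul_logb_div_pos hac hne)).not_ge hle

/-- The control symbols. -/
theorem exists_divergence_eq_burnashev (hB : burnashev Q ≠ ⊤) (hC : 0 < capacity Q) :
    ∃ a r, divergence (Q a) (Q r) = burnashev Q ∧ (∀ y, (Q r).1 y = 0 → (Q a).1 y = 0) ∧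
      ∑ y, (Q a).1 y * logRatio Q a r y = (burnashev Q).toReal := by
  have : Nonempty X := ⟨(exists_ne_of_capacity_pos hC).choose⟩
  obtain ⟨a, ha⟩ := exists_eq_ciSup_of_finite (f := fun a => ⨆ r, divergence (Q a) (Q r))
  obtain ⟨r, hr⟩ := exists_eq_ciSup_of_finite (f := fun r => divergence (Q a) (Q r))
  have h1 : divergence (Q a) (Q r) = burnashev Q := hr.trans ha
  obtain ⟨hac, heq⟩ := divergence_ne_top (h1.trans_ne hB)
  refine ⟨a, r, h1, hac, ?_⟩
  have hpos := burnashev_toReal_pos hB hC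
  rw [← h1, heq] at hpos ⊢
  exact (ENNReal.toReal_ofReal (ENNReal.ofReal_pos.1 (ENNReal.toReal_pos_iff.1 hpos).1).le).symm

/-- Since all rows of the channel have the same support, no output is deterministic. -/
theorem exists_pos_lt_one (hB : burnashev Q ≠ ⊤) (hC : 0 < capacity Q) :
    ∃ x y, 0 < (Q x).1 y ∧ (Q x).1 y < 1 := by
  obtain ⟨a, r, hne⟩ := exists_ne_of_capacity_pos hC
  classical
  by_contra! h
  have hac := (divergence_ne_top (ne_top_of_le_ne_top hB (divergence_le_burnashev a r))).1
  obtain ⟨y, hy⟩ : ∃ y, 0 < (Q a).1 y := by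
    by_contra! hle
    have := Finset.sum_nonpos fun y (_ : y ∈ Finset.univ) => hle y
    linarith [Q.sum_eq_one a]
  have hry : 0 < (Q r).1 y := (Q.nonneg r y).lt_of_ne' fun h0 => hy.ne' (hac y h0)
  have point : ∀ x, 0 < (Q x).1 y → ∀ z, (Q x).1 z = if z = y then 1 else 0 := by
    intro x hx z
    have h1 := h x y hx
    have h2 := Q.sum_eq_one x
    have h3 := Finset.add_sum_erase _ (fun z => (Q x).1 z) (Finset.mem_univ y)
    have h4 : 0 ≤ ∑ z ∈ Finset.univ.erase y, (Q x).1 z := Finset.sum_nonneg fun z _ => Q.nonneg x z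
    split_ifs with hz
    · subst hz
      linarith
    · have := Finset.single_le_sum (fun z _ => Q.nonneg x z)
        (Finset.mem_erase.2 ⟨hz, Finset.mem_univ z⟩)
      linarith [Q.nonneg x z]
  exact hne (Subtype.ext (funext fun z => by rw [point a hy, point r hry]))

end Channel

/-! ### Limits of integer parameters -/

theorem tendsto_sqrt_add_one_div :
    Tendsto (fun n : ℕ => ((Nat.sqrt n + 1 : ℕ) : ℝ) / n) atTop (𝓝 0) := by
  have h1 : Tendsto (fun n : ℕ => 1 / √(n : ℝ) + 1 / (n : ℝ)) atTop (𝓝 0) := by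
    simpa using ((Real.tendsto_sqrt_atTop.comp tendsto_natCast_atTop_atTop).const_div_atTop
      (1 : ℝ)).add (tendsto_one_div_atTop_nhds_zero_nat (𝕜 := ℝ))
  refine squeeze_zero (fun n => by positivity) (fun n => ?_) h1
  rw [one_div (√(n : ℝ)), ← Real.sqrt_div_self (x := (n : ℝ)), ← add_div]
  push_cast
  gcongr
  exact Real.nat_sqrt_le_real_sqrt

theorem tendsto_floor_add_one_div {c : ℝ} (hc : 0 ≤ c) :
    Tendsto (fun n : ℕ => ((⌊n * c⌋₊ + 1 : ℕ) : ℝ) / n) atTop (𝓝 c) := by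
  have h1 : Tendsto (fun n : ℕ => c + 1 / (n : ℝ)) atTop (𝓝 c) := by
    simpa using tendsto_const_nhds.add (tendsto_one_div_atTop_nhds_zero_nat (𝕜 := ℝ))
  refine tendsto_of_tendsto_of_tendsto_of_le_of_le' tendsto_const_nhds h1 ?_ ?_
  · filter_upwards [eventually_gt_atTop 0] with n hn
    have hn' : (0 : ℝ) < n := by exact_mod_cast hn
    rw [le_div_iff₀ hn']
    push_cast
    linarith [Nat.lt_floor_add_one (n * c)]
  · filter_upwards [eventually_gt_atTop 0] with n hn
    have hn' : (0 : ℝ) < n := by exact_mod_cast hn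
    rw [div_le_iff₀ hn', add_mul, one_div, inv_mul_cancel₀ hn'.ne']
    push_cast
    linarith [Nat.floor_le (by positivity : 0 ≤ n * c)]

/-- Diagonal argument. -/
theorem exists_tendsto_eventually {P : ℕ → ℕ → Prop} (h : ∀ k, ∀ᶠ n in atTop, P k n) :
    ∃ k : ℕ → ℕ, Tendsto k atTop atTop ∧ ∀ᶠ n in atTop, P (k n) n := by
  classical
  choose N hN using fun k => eventually_atTop.1 (h k)
  refine ⟨fun n => Nat.findGreatest (fun k => ∀ j ≤ k, N j ≤ n) n, ?_, ?_⟩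
  · refine tendsto_atTop.2 fun K => ?_
    filter_upwards [eventually_ge_atTop K,
      eventually_ge_atTop (∑ j ∈ Finset.range (K + 1), N j)] with n hK hn
    refine Nat.le_findGreatest hK fun j hj => le_trans ?_ hn
    exact Finset.single_le_sum (fun _ _ => Nat.zero_le _) (Finset.mem_range.2 (by omega))
  · filter_upwards [eventually_ge_atTop (N 0)] with n hn
    refine hN _ n ?_
    exact Nat.findGreatest_spec (P := fun k => ∀ j ≤ k, N j ≤ n) (Nat.zero_le n)
      (fun j hj => by rwa [Nat.le_zero.1 hj]) _ le_rfl

/-! ### Codebooks with a prescribed amount of randomness -/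

section Codebook

variable {X Y : Type*} [Fintype Y] (Q : DMC X Y)

theorem pathExp_replicate (x : X) (y : Y) (t : ℕ) :
    pathExp Q t (fun _ => x) (({List.replicate t y} : Set (List Y)).indicator 1) =
      (Q x).1 y ^ t := by
  classical
  induction t with
  | zero => simp [pathExp]
  | succ t ih =>
    have h1 : ∀ z, (fun h : List Y =>
        ({List.replicate (t + 1) y} : Set (List Y)).indicator (1 : List Y → ℝ) (z :: h)) =
        fun h => (if z = y then 1 else 0) *
          ({List.replicate t y} : Set (List Y)).indicator 1 h := fun z => by
      funext h
      by_cases hz : z = y <;> simp [Set.indicator, List.replicate_succ, hz]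
    simp only [pathExp, h1, pathExp_const_mul, ih]
    simp [pow_succ']

/-- A codebook can be made to err with a prescribed small probability: first the symbol `x` is
sent `j` times, and if the output is `y` all the time, then message `m₀` is decoded. -/
theorem exists_dithered_code {M : ℕ} (x : X) (y : Y) (j b : ℕ) (enc : Fin M → List Y → X)
    (dec : List Y → Fin M) (m₀ : Fin M) :
    ∃ (enc' : Fin M → List Y → X) (dec' : List Y → Fin M), ∀ m,
      blockProb Q (enc' m) (j + b) {h | dec' h ≠ m} ≤
        (Q x).1 y ^ j + blockProb Q (enc m) b {h | dec h ≠ m} ∧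
      (m ≠ m₀ → (Q x).1 y ^ j ≤ blockProb Q (enc' m) (j + b) {h | dec' h ≠ m}) := by
  classical
  refine ⟨fun m h => if h.length < j then x else enc m (h.drop j),
    fun h => if h.take j = List.replicate j y then m₀ else dec (h.drop j), fun m => ?_⟩
  have hsplit : blockProb Q (fun h => if h.length < j then x else enc m (h.drop j)) (j + b)
      {h | (if h.take j = List.replicate j y then m₀ else dec (h.drop j)) ≠ m} =
      pathExp Q j (fun _ => x) (fun h₁ => pathExp Q b (enc m) (fun h₂ =>
        if (if h₁ = List.replicate j y then m₀ else dec h₂) ≠ m then 1 else 0)) := by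
    rw [blockProb_eq_pathExp, pathExp_split]
    refine pathExp_congr Q (fun h hh => if_pos hh) fun h₁ hh₁ => ?_
    refine pathExp_congr Q (fun h hh => by simp [← hh₁]) fun h₂ _ => ?_
    simp [Set.indicator, ← hh₁]
  rw [hsplit, ← pathExp_replicate]
  constructor
  · rw [← pathExp_const Q j (fun _ => x) (blockProb Q (enc m) b {h | dec h ≠ m}), ← pathExp_add]
    refine pathExp_mono Q fun h₁ _ => ?_
    have hnn := blockProb_nonneg Q (enc m) b {h | dec h ≠ m}
    by_cases h1 : h₁ = List.replicate j y
    · rw [Set.indicator_of_mem (by exact h1), Pi.one_apply]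
      refine (pathExp_le Q fun h₂ _ => ?_).trans (le_add_of_nonneg_right hnn)
      split_ifs <;> norm_num
    · rw [Set.indicator_of_notMem (by exact h1), zero_add, blockProb_eq_pathExp]
      simp only [h1, if_false]
      exact pathExp_mono Q fun h₂ _ => by
        by_cases h2 : dec h₂ = m <;> simp [h2]
  · intro hm
    refine pathExp_mono Q fun h₁ _ => ?_
    by_cases h1 : h₁ = List.replicate j y
    · rw [Set.indicator_of_mem (by exact h1), Pi.one_apply]
      simp [h1, hm.symm]
    · rw [Set.indicator_of_notMem (by exact h1)]
      exact le_pathExp Q fun h₂ _ => by positivity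

variable [Fintype X]

/-- Codebooks whose rate tends to capacity so slowly that the error probability tends to `0`,
although not exponentially fast in `n`. -/
theorem exists_codebooks (hB : burnashev Q ≠ ⊤) (hC : 0 < capacity Q) {β : ℝ} (hβ : 0 ≤ β)
    {M : ℕ → ℕ} (hM : ∀ n, 0 < M n) (hM' : ∀ n, (M n : ℝ) ≤ 2 ^ (n * (β * capacity Q)) + 1) :
    ∃ (b : ℕ → ℕ) (enc : ∀ n, Fin (M n) → List Y → X) (dec : ∀ n, List Y → Fin (M n)) (q : ℕ → ℝ),
      (∀ n : ℕ, n * β < b n) ∧ Tendsto (fun n => (b n : ℝ) / n) atTop (𝓝 β) ∧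
      (∀ ε > 0, ∀ᶠ n in atTop, ∀ m, blockProb Q (enc n m) (b n) {h | dec n h ≠ m} ≤ ε) ∧
      (∀ n, 0 ≤ q n) ∧ (∀ a : ℝ, 0 < a → ∀ᶠ n : ℕ in atTop, 2 ^ (-(n * a)) ≤ q n) ∧
      ∀ n, ∃ m₀, ∀ m, m ≠ m₀ → q n ≤ blockProb Q (enc n m) (b n) {h | dec n h ≠ m} := by
  obtain ⟨x, y, h0, h1⟩ := exists_pos_lt_one hB hC
  have hX : Nonempty X := ⟨x⟩
  set C := capacity Q with hCdef
  set b₀ : ℕ → ℕ → ℕ := fun k n => (⌊n * β⌋₊ + 1) + ⌊(n : ℝ) / (k + 1)⌋₊ with hb₀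
  let P : ℕ → ℕ → Prop := fun k n => ∃ (enc : Fin (M n) → List Y → X) (dec : List Y → Fin (M n)),
    ∀ m, blockProb Q (enc m) (b₀ k n) {h | dec h ≠ m} ≤ 1 / ((k : ℝ) + 1)
  have hP : ∀ k, ∀ᶠ n in atTop, P k n := by
    intro k
    set δ : ℝ := 1 / ((k : ℝ) + 1) with hδ
    have hδ0 : 0 < δ := by positivity
    set ρ : ℝ := C * ((β + δ / 2) / (β + δ)) with hρ
    have hρ0 : 0 < ρ := by positivity
    have hρC : ρ < C := by
      refine mul_lt_of_lt_one_right hC ?_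
      rw [div_lt_one (by positivity)]
      linarith
    have hρ' : (β + δ) * ρ = C * (β + δ / 2) := by
      rw [hρ]
      field_simp
    have hb_low : ∀ n : ℕ, n * (β + δ) - 1 ≤ b₀ k n := by
      intro n
      have e1 := Nat.lt_floor_add_one ((n : ℝ) * β)
      have e2 := Nat.lt_floor_add_one ((n : ℝ) / (k + 1))
      have e3 : (n : ℝ) / (k + 1) = n * δ := by rw [hδ]; ring
      simp only [hb₀]
      push_cast
      linarith
    have hb_top : Tendsto (b₀ k) atTop atTop := by
      rw [← tendsto_natCast_atTop_iff (R := ℝ)]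
      refine tendsto_atTop_mono hb_low (tendsto_atTop_add_const_right _ _ ?_)
      exact tendsto_natCast_atTop_atTop.atTop_mul_const (by positivity)
    have hlarge : ∀ᶠ n : ℕ in atTop, 1 + ρ ≤ n * (C * (δ / 2)) :=
      (tendsto_natCast_atTop_atTop.atTop_mul_const (by positivity)).eventually_ge_atTop _
    filter_upwards [hb_top.eventually (eventually_exists_code Q hρC hδ0), hlarge] with n hn hn'
    refine hn (M n) (hM n) ((hM' n).trans ?_)
    have e1 : (n : ℝ) * (β * C) + 1 ≤ b₀ k n * ρ := by
      have := mul_le_mul_of_nonneg_right (hb_low n) hρ0.le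
      have e2 : ((n : ℝ) * (β + δ) - 1) * ρ = n * (C * (β + δ / 2)) - ρ := by
        rw [← hρ']
        ring
      linarith
    refine le_trans ?_ (Real.rpow_le_rpow_of_exponent_le one_le_two e1)
    rw [Real.rpow_add two_pos, Real.rpow_one]
    have : (1 : ℝ) ≤ 2 ^ ((n : ℝ) * (β * C)) :=
      Real.one_le_rpow one_le_two (by positivity)
    linarith
  obtain ⟨k, hk, hPk⟩ := exists_tendsto_eventually hP
  have hcode : ∀ n, ∃ (enc : Fin (M n) → List Y → X) (dec : List Y → Fin (M n)),
      P (k n) n → ∀ m, blockProb Q (enc m) (b₀ (k n) n) {h | dec h ≠ m} ≤ 1 / ((k n : ℝ) + 1) := by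
    intro n
    by_cases h : P (k n) n
    · obtain ⟨enc, dec, h'⟩ := h
      exact ⟨enc, dec, fun _ => h'⟩
    · exact ⟨fun _ _ => x, fun _ => ⟨0, hM n⟩, fun h' => absurd h' h⟩
  choose enc₀ dec₀ hcode using hcode
  set j : ℕ → ℕ := fun n => Nat.sqrt n + 1 with hj
  choose enc dec hdither using fun n =>
    exists_dithered_code Q x y (j n) (b₀ (k n) n) (enc₀ n) (dec₀ n) ⟨0, hM n⟩
  have hk1 : Tendsto (fun n => 1 / ((k n : ℝ) + 1)) atTop (𝓝 0) :=
    tendsto_one_div_add_atTop_nhds_zero_nat.comp hk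
  have hj_top : Tendsto j atTop atTop :=
    tendsto_atTop_mono (fun n => Nat.le_succ _)
      (tendsto_atTop.2 fun K => (eventually_ge_atTop (K * K)).mono fun n hn => Nat.le_sqrt.2 hn)
  refine ⟨fun n => j n + b₀ (k n) n, enc, dec, fun n => (Q x).1 y ^ j n, ?_, ?_, ?_,
    fun n => by positivity, ?_, fun n => ⟨⟨0, hM n⟩, fun m => (hdither n m).2⟩⟩
  · intro n
    have e1 := Nat.lt_floor_add_one ((n : ℝ) * β)
    simp only [hb₀]
    push_cast
    have e2 : (0 : ℝ) ≤ j n := Nat.cast_nonneg _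
    have e3 : (0 : ℝ) ≤ ⌊(n : ℝ) / (k n + 1)⌋₊ := Nat.cast_nonneg _
    linarith
  · have e1 : Tendsto (fun n : ℕ => (⌊(n : ℝ) / (k n + 1)⌋₊ : ℝ) / n) atTop (𝓝 0) := by
      refine squeeze_zero (fun n => by positivity) (fun n => ?_) hk1
      refine (div_le_div_of_nonneg_right (Nat.floor_le (by positivity)) (Nat.cast_nonneg n)).trans ?_
      rw [div_right_comm]
      exact div_le_div_of_nonneg_right (div_self_le_one _) (by positivity)
    have e2 := tendsto_sqrt_add_one_div.add ((tendsto_floor_add_one_div hβ).add e1)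
    rw [zero_add, add_zero] at e2
    refine e2.congr fun n => ?_
    simp only [hb₀, hj, Nat.cast_add, add_div]
  · intro ε hε
    have e1 : Tendsto (fun n => (Q x).1 y ^ j n + 1 / ((k n : ℝ) + 1)) atTop (𝓝 0) := by
      simpa using ((tendsto_pow_atTop_nhds_zero_of_lt_one h0.le h1).comp hj_top).add hk1
    filter_upwards [e1.eventually_lt_const hε, hPk] with n hn hn' m
    have := (hdither n m).1
    have := hcode n hn' m
    linarith
  · intro a ha
    -- `q ^ (√n)` decays subexponentially.
    have hlim : Tendsto (fun n : ℕ => ((j n : ℕ) : ℝ) / n * Real.logb 2 ((Q x).1 y)) atTop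
        (𝓝 0) := by
      have := tendsto_sqrt_add_one_div.mul_const (Real.logb 2 ((Q x).1 y))
      rwa [zero_mul] at this
    filter_upwards [hlim.eventually_const_lt (neg_lt_zero.2 ha), eventually_gt_atTop 0] with n hn hn0
    have hn0' : (0 : ℝ) < n := by exact_mod_cast hn0
    rw [div_mul_eq_mul_div, lt_div_iff₀ hn0'] at hn
    have e1 : (Q x).1 y ^ j n = 2 ^ (j n * Real.logb 2 ((Q x).1 y)) := by
      rw [mul_comm, Real.rpow_mul_natCast two_pos.le, Real.rpow_logb two_pos (by norm_num) h0]
    rw [e1]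
    exact Real.rpow_le_rpow_of_exponent_le one_le_two (by linarith)

end Codebook

end CompoundFeedback
end

noncomputable section

namespace CompoundFeedback

variable {L : ℕ} {X Y : Type*} [Fintype X] [Fintype Y]

/-! ### The training based scheme: parameters -/

/-- The message sizes are those of `IsTrainingScheme`, possibly increased by one; everything else
is as in `IsTrainingScheme`. A message set that is larger by one has at least two elements also
if the rate is zero. -/
structure IsNearTrainingScheme (Q : Fin L → DMC X Y) (R T : Fin L → ℝ) (r : Fin L)
    (σc : ℕ → ℕ → X) (θc : List Y → Fin L) (D : ℕ → EpochScheme L X Y) : Prop where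
  le_M : ∀ (n : ℕ) l, ⌊(2 : ℝ) ^ ((n : ℝ) * xi Q R T r l * R l)⌋₊ ≤ (D n).M l
  M_le : ∀ (n : ℕ) l, (D n).M l ≤ ⌊(2 : ℝ) ^ ((n : ℝ) * xi Q R T r l * R l)⌋₊ + 1
  am_pos : ∀ n, 0 < (D n).am
  am_lim : Tendsto (fun n => ((D n).am : ℝ) / n) atTop (𝓝 0)
  am_atTop : Tendsto (fun n => (D n).am) atTop atTop
  bm_gt : ∀ (n : ℕ) (l : Fin L), (n : ℝ) * (xi Q R T r l * gam Q R l) < (D n).bm l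
  bm_lim : ∀ l, Tendsto (fun n => ((D n).bm l : ℝ) / n) atTop (𝓝 (xi Q R T r l * gam Q R l))
  ac_pos : ∀ n, 0 < (D n).ac
  ac_lim : Tendsto (fun n => ((D n).ac : ℝ) / n) atTop (𝓝 (zeta Q R T r))
  bc_pos : ∀ n l, 0 < (D n).bc l
  bc_lim : ∀ l, Tendsto (fun n => ((D n).bc l : ℝ) / n) atTop (𝓝 (kappa Q T l * zeta Q R T r))
  training : ∀ l, Tendsto (fun n => (D n).trainingError (Q l) l) atTop (𝓝 0)
  codebook : ∀ l, ∀ ε > 0, ∀ᶠ n in atTop, ∀ m, (D n).codebookError (Q l) l m ≤ ε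
  σc_eq : ∀ n, (D n).σc = σc (D n).ac
  θc_eq : ∀ n, (D n).θc = θc
  control : ∀ n l, divergence (Q l ((D n).xA l)) (Q l ((D n).xR l)) = burnashev (Q l)
  test_accept : ∀ l, Tendsto (fun n => (D n).falseReject (Q l) l) atTop (𝓝 0)
  test_reject : ∀ l, Tendsto (fun n => -log2 (ENNReal.ofReal ((D n).falseAccept (Q l) l)) /
    ((((D n).bc l : ℕ) : ℝ) : EReal)) atTop (𝓝 ((burnashev (Q l) : ℝ≥0∞) : EReal))

theorem IsTrainingScheme.isNearTrainingScheme {Q : Fin L → DMC X Y} {R T : Fin L → ℝ} {r : Fin L}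
    {σc : ℕ → ℕ → X} {θc : List Y → Fin L} {D : ℕ → EpochScheme L X Y}
    (h : IsTrainingScheme Q R T r σc θc D) : IsNearTrainingScheme Q R T r σc θc D where
  le_M n l := (h.M_eq n l).ge
  M_le n l := (h.M_eq n l).le.trans (Nat.le_succ _)
  __ := h

theorem IsNearTrainingScheme.isTrainingScheme {Q : Fin L → DMC X Y} {R T : Fin L → ℝ} {r : Fin L}
    {σc : ℕ → ℕ → X} {θc : List Y → Fin L} {D : ℕ → EpochScheme L X Y}
    (h : IsNearTrainingScheme Q R T r σc θc D)
    (hM : ∀ (n : ℕ) l, (D n).M l = ⌊(2 : ℝ) ^ ((n : ℝ) * xi Q R T r l * R l)⌋₊) :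
    IsTrainingScheme Q R T r σc θc D where
  M_eq := hM
  __ := h

section Parameters

variable {Q : Fin L → DMC X Y} {R T : Fin L → ℝ} (hB : ∀ l, burnashev (Q l) ≠ ⊤)
  (hR : ∀ l, 0 ≤ R l ∧ R l < capacity (Q l)) (hT : ∀ l, 0 < T l)
include hB hR hT

omit hB hT in
theorem capacity_pos (l : Fin L) : 0 < capacity (Q l) := (hR l).1.trans_lt (hR l).2

theorem kappa_pos (l : Fin L) : 0 < kappa Q T l :=
  div_pos (hT l) (burnashev_toReal_pos (hB l) (capacity_pos hR l))

omit hB hT in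
theorem gam_nonneg (l : Fin L) : 0 ≤ gam Q R l := div_nonneg (hR l).1 (capacity_pos hR l).le

omit hB hT in
theorem gam_lt_one (l : Fin L) : gam Q R l < 1 := (div_lt_one (capacity_pos hR l)).2 (hR l).2

theorem zeta_pos (l : Fin L) : 0 < zeta Q R T l :=
  div_pos (sub_pos.2 (gam_lt_one hR l)) (add_pos one_pos (kappa_pos hB hR hT l))

theorem xi_pos (r l : Fin L) : 0 < xi Q R T r l :=
  div_pos (zeta_pos hB hR hT r) (zeta_pos hB hR hT l)

/-- The phases of an epoch over channel `l` add up to the length `n ξ_l`. -/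
theorem xi_eq (r l : Fin L) : 0 + xi Q R T r l * gam Q R l + zeta Q R T r +
    kappa Q T l * zeta Q R T r = xi Q R T r l := by
  have h1 : xi Q R T r l * zeta Q R T l = zeta Q R T r :=
    div_mul_cancel₀ _ (zeta_pos hB hR hT l).ne'
  have h2 : zeta Q R T l * (1 + kappa Q T l) = 1 - gam Q R l :=
    div_mul_cancel₀ _ (add_pos one_pos (kappa_pos hB hR hT l)).ne'
  rw [← h1]
  linear_combination xi Q R T r l * h2

theorem exponentBound_eq (r l : Fin L) :
    exponentBound Q R T l = zeta Q R T r * T l / xi Q R T r l := by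
  have h1 := (zeta_pos hB hR hT r).ne'
  have h2 := (zeta_pos hB hR hT l).ne'
  have h3 := burnashev_toReal_pos (hB l) (capacity_pos hR l)
  have h4 : zeta Q R T r * T l / xi Q R T r l = zeta Q R T l * T l := by
    rw [xi]
    field_simp
  have h5 := hT l
  rw [h4, exponentBound, zeta, kappa, gam]
  have h6 : T l + (burnashev (Q l)).toReal ≠ 0 := by positivity
  have h7 : (burnashev (Q l)).toReal + T l ≠ 0 := by positivity
  have h8 : 1 + T l / (burnashev (Q l)).toReal = ((burnashev (Q l)).toReal + T l) /
      (burnashev (Q l)).toReal := by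
    field_simp
  rw [h8, div_div_eq_mul_div]
  rw [add_comm (T l)]
  field_simp

omit hB hT [Fintype X] hR in
/-- The exponent of re-training errors, in terms of the length of the training sequence. -/
theorem AttainsExponents.eventually_le {σ : ℕ → ℕ → X} {θ : List Y → Fin L}
    (h : AttainsExponents Q σ θ T) (l : Fin L) {a : ℝ} (ha : a < T l) :
    ∀ᶠ N : ℕ in atTop, blockProb (Q l) (fun h => σ N h.length) N {h | θ h ≠ l} ≤
      2 ^ (-(N * a)) := by
  filter_upwards [eventually_le_rpow_of_le_liminf one_pos tendsto_natCast_div_self (h l) (by simpa using ha)] with N hN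
  exact (ENNReal.ofReal_le_ofReal_iff (by positivity)).1 hN

end Parameters

theorem tendsto_natCast_of_tendsto_div {b : ℕ → ℕ} {β : ℝ} (hβ : 0 < β)
    (hb : Tendsto (fun n => (b n : ℝ) / n) atTop (𝓝 β)) : Tendsto b atTop atTop := by
  rw [← tendsto_natCast_atTop_iff (R := ℝ)]
  refine (hb.pos_mul_atTop hβ tendsto_natCast_atTop_atTop).congr' ?_
  filter_upwards [eventually_ne_atTop 0] with n hn
  exact div_mul_cancel₀ _ (by exact_mod_cast hn)

/-! ### The training based scheme: performance -/

namespace IsNearTrainingScheme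

variable {Q : Fin L → DMC X Y} {R T : Fin L → ℝ} {r : Fin L} {σc : ℕ → ℕ → X}
  {θc : List Y → Fin L} {D : ℕ → EpochScheme L X Y} (hB : ∀ l, burnashev (Q l) ≠ ⊤)
  (hR : ∀ l, 0 ≤ R l ∧ R l < capacity (Q l)) (hT : ∀ l, 0 < T l)
  (hatt : AttainsExponents Q σc θc T) (h : IsNearTrainingScheme Q R T r σc θc D)
include hB hR hT h

theorem tendsto_log_size (l : Fin L) :
    Tendsto (fun n => Real.logb 2 ((D n).M l) / n) atTop (𝓝 (xi Q R T r l * R l)) := by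
  set c := xi Q R T r l * R l with hc
  have hc0 : 0 ≤ c := mul_nonneg (xi_pos hB hR hT r l).le (hR l).1
  have hlow : Tendsto (fun n : ℕ => c - 1 / (n : ℝ)) atTop (𝓝 c) := by
    simpa using tendsto_const_nhds.sub (tendsto_one_div_atTop_nhds_zero_nat (𝕜 := ℝ))
  have hupp : Tendsto (fun n : ℕ => c + 1 / (n : ℝ)) atTop (𝓝 c) := by
    simpa using tendsto_const_nhds.add (tendsto_one_div_atTop_nhds_zero_nat (𝕜 := ℝ))
  have key : ∀ n : ℕ, 1 ≤ (2 : ℝ) ^ (n * c) ∧ (2 : ℝ) ^ (n * c - 1) ≤ (D n).M l ∧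
      ((D n).M l : ℝ) ≤ 2 ^ (n * c + 1) := by
    intro n
    have h1 : 1 ≤ (2 : ℝ) ^ (n * c) := Real.one_le_rpow one_le_two (by positivity)
    have h2 := h.le_M n l
    have h3 := h.M_le n l
    rw [mul_assoc, ← hc] at h2 h3
    have h2' : (⌊(2 : ℝ) ^ (n * c)⌋₊ : ℝ) ≤ (D n).M l := by exact_mod_cast h2
    have h3' : ((D n).M l : ℝ) ≤ ⌊(2 : ℝ) ^ (n * c)⌋₊ + 1 := by exact_mod_cast h3
    have h4 := Nat.floor_le (zero_le_one.trans h1)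
    have h5 := Nat.lt_floor_add_one ((2 : ℝ) ^ (n * c))
    have h6 : (1 : ℝ) ≤ ⌊(2 : ℝ) ^ (n * c)⌋₊ := by exact_mod_cast Nat.le_floor (by simpa using h1)
    rw [Real.rpow_sub two_pos, Real.rpow_add two_pos, Real.rpow_one]
    exact ⟨h1, by linarith, by linarith⟩
  refine tendsto_of_tendsto_of_tendsto_of_le_of_le' hlow hupp ?_ ?_
  · filter_upwards [eventually_gt_atTop 0] with n hn
    have hn' : (0 : ℝ) < n := by exact_mod_cast hn
    rw [le_div_iff₀ hn', sub_mul, one_div, inv_mul_cancel₀ hn'.ne', mul_comm,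
      Real.le_logb_iff_rpow_le one_lt_two (by exact_mod_cast (D n).M_pos l)]
    exact (key n).2.1
  · filter_upwards [eventually_gt_atTop 0] with n hn
    have hn' : (0 : ℝ) < n := by exact_mod_cast hn
    rw [div_le_iff₀ hn', add_mul, one_div, inv_mul_cancel₀ hn'.ne', mul_comm,
      Real.logb_le_iff_le_rpow one_lt_two (by exact_mod_cast (D n).M_pos l)]
    exact (key n).2.2

theorem eventually_falseAccept_le (l : Fin L) {a : ℝ} (ha : a < zeta Q R T r * T l) :
    ∀ᶠ n : ℕ in atTop, (D n).falseAccept (Q l) l ≤ 2 ^ (-(n * a)) := by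
  have hlim := h.test_reject l
  rw [← EReal.coe_ennreal_toReal (hB l)] at hlim
  have hBpos := burnashev_toReal_pos (hB l) (capacity_pos hR l)
  have e : zeta Q R T r * T l = (burnashev (Q l)).toReal * (kappa Q T l * zeta Q R T r) := by
    rw [kappa]
    field_simp
  filter_upwards [eventually_le_rpow_of_le_liminf
    (mul_pos (kappa_pos hB hR hT l) (zeta_pos hB hR hT r)) (h.bc_lim l) hlim.liminf_eq.ge
    (by rwa [← e])] with n hn
  exact (ENNReal.ofReal_le_ofReal_iff (by positivity)).1 hn

theorem eventually_le_falseAccept (l : Fin L) {a : ℝ} (ha : zeta Q R T r * T l < a) :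
    ∀ᶠ n : ℕ in atTop, 2 ^ (-(n * a)) ≤ (D n).falseAccept (Q l) l := by
  have hlim := h.test_reject l
  rw [← EReal.coe_ennreal_toReal (hB l)] at hlim
  have hBpos := burnashev_toReal_pos (hB l) (capacity_pos hR l)
  have e : zeta Q R T r * T l = (burnashev (Q l)).toReal * (kappa Q T l * zeta Q R T r) := by
    rw [kappa]
    field_simp
  filter_upwards [eventually_rpow_le_of_limsup_le
    (mul_pos (kappa_pos hB hR hT l) (zeta_pos hB hR hT r)) (h.bc_lim l) hlim.limsup_eq.le
    (by rwa [← e])] with n hn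
  exact (ENNReal.ofReal_le_ofReal_iff (blockProb_nonneg _ _ _ _)).1 hn

include hatt

theorem eventually_retrainingError_le (l : Fin L) {a : ℝ} (ha : a < zeta Q R T r * T l) :
    ∀ᶠ n : ℕ in atTop, (D n).retrainingError (Q l) l ≤ 2 ^ (-(n * a)) := by
  have hζ := zeta_pos hB hR hT r
  obtain ⟨c, hc1, hc2⟩ := exists_between ((div_lt_iff₀' hζ).2 ha)
  filter_upwards [(tendsto_natCast_of_tendsto_div hζ h.ac_lim).eventually
    (hatt.eventually_le l hc2), eventually_le_mul_of_tendsto_div h.ac_lim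
      ((div_lt_iff₀ hζ).1 hc1)] with n h1 h2
  rw [EpochScheme.retrainingError, h.σc_eq, h.θc_eq]
  exact h1.trans (Real.rpow_le_rpow_of_exponent_le one_le_two (by linarith))

theorem tendsto_retrainingError (l : Fin L) :
    Tendsto (fun n => (D n).retrainingError (Q l) l) atTop (𝓝 0) := by
  have hpos := mul_pos (zeta_pos hB hR hT r) (hT l)
  exact tendsto_of_tendsto_of_tendsto_of_le_of_le' tendsto_const_nhds
    (tendsto_two_rpow_neg_mul (half_pos hpos)) (.of_forall fun n => blockProb_nonneg _ _ _ _)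
    (h.eventually_retrainingError_le hB hR hT hatt l (half_lt_self hpos))

/-- Only the exponents of re-training and of the test matter: both equal `ζ_* T_l`, relative to
`n`. -/
theorem isReliableSequence :
    IsReliableSequence Q R (xi Q R T r) (fun l => zeta Q R T r * T l) D where
  am_pos := h.am_pos
  log_size := h.tendsto_log_size hB hR hT
  idealLength l := by
    have := ((h.am_lim.add (h.bm_lim l)).add h.ac_lim).add (h.bc_lim l)
    rw [xi_eq hB hR hT] at this
    refine this.congr fun n => ?_
    simp only [EpochScheme.idealLength, Nat.cast_add, add_div]
  maxLength := by
    have := ((h.am_lim.add (tendsto_finsetSum Finset.univ fun l _ => h.bm_lim l)).add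
      h.ac_lim).add (tendsto_finsetSum Finset.univ fun l _ => h.bc_lim l)
    refine ⟨_, this.congr fun n => ?_⟩
    simp only [EpochScheme.maxLength, Nat.cast_add, Nat.cast_sum, add_div, Finset.sum_div]
  failure l := by
    have hcb : Tendsto (fun n => ⨆ m, (D n).codebookError (Q l) l m) atTop (𝓝 0) := by
      rw [tendsto_order]
      refine ⟨fun a ha => .of_forall fun n => ha.trans_le
        (Real.iSup_nonneg fun m => blockProb_nonneg _ _ _ _), fun a ha => ?_⟩
      filter_upwards [h.codebook l (a / 2) (half_pos ha)] with n hn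
      have : Nonempty (Fin ((D n).M l)) := ⟨⟨0, (D n).M_pos l⟩⟩
      exact (ciSup_le hn).trans_lt (half_lt_self ha)
    have := (((h.training l).add hcb).add
      (h.tendsto_retrainingError hB hR hT hatt l)).add (h.test_accept l)
    simp only [add_zero] at this
    refine ⟨_, this, fun n m => ?_⟩
    gcongr
    exact le_ciSup (Set.finite_range fun m => (D n).codebookError (Q l) l m).bddAbove m
  error l a ha := by
    obtain ⟨a', h1, h2⟩ := exists_between ha
    filter_upwards [h.eventually_retrainingError_le hB hR hT hatt l h2,
      h.eventually_falseAccept_le hB hR hT l h2,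
      (tendsto_two_rpow_neg_mul (sub_pos.2 h1)).eventually_lt_const one_half_pos] with n h3 h4 h5
    have h6 : (2 : ℝ) ^ (-(n * a')) = 2 ^ (-(n * a)) * 2 ^ (-(n * (a' - a))) := by
      rw [← Real.rpow_add two_pos]
      congr 1
      ring
    have h7 := mul_le_mul_of_nonneg_left h5.le (by positivity : (0 : ℝ) ≤ 2 ^ (-(n * a)))
    linarith

/-- If the codebooks err with a probability that is not exponentially small, then the exponent
of the probability of error is not larger than that of the test. -/
theorem eventually_le_errorProb (hM : ∀ n l, 2 ≤ (D n).M l) (l : Fin L) {q : ℕ → ℝ}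
    (hq0 : ∀ n, 0 ≤ q n) (hq : ∀ a : ℝ, 0 < a → ∀ᶠ n : ℕ in atTop, 2 ^ (-(n * a)) ≤ q n)
    (hcb : ∀ n, ∃ m₀, ∀ m, m ≠ m₀ → q n ≤ (D n).codebookError (Q l) l m)
    (μ : ∀ n, stdSimplex ℝ (∀ l, Fin ((D n).M l))) (hμ : ∀ n, UniformMarginals (μ n))
    {a : ℝ} (ha : zeta Q R T r * T l < a) :
    ∀ᶠ n : ℕ in atTop, ENNReal.ofReal (2 ^ (-(n * a))) ≤
      (D n).toCodingScheme.errorProb (Q l) (μ n) := by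
  set e := zeta Q R T r * T l with he
  set d := (a - e) / 3 with hd
  have hd0 : 0 < d := div_pos (sub_pos.2 ha) (by norm_num)
  filter_upwards [h.eventually_le_falseAccept hB hR hT l (a := e + d) (by linarith), hq d hd0,
    (h.training l).eventually_lt_const one_half_pos,
    (h.tendsto_retrainingError hB hR hT hatt l).eventually_lt_const one_half_pos,
    (tendsto_two_rpow_neg_mul hd0).eventually_lt_const (by norm_num : (0 : ℝ) < 1 / 8)]
    with n h1 h2 h3 h4 h5
  obtain ⟨m₀, hm₀⟩ := hcb n
  refine le_trans (ENNReal.ofReal_le_ofReal ?_)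
    (EpochScheme.le_errorProb l (μ n) (h.am_pos n) (hμ n) (hM n l) (hq0 n) m₀ hm₀)
  have h6 : (2 : ℝ) ^ (-(n * a)) =
      2 ^ (-(n * d)) * (2 ^ (-(n * d)) * 2 ^ (-(n * (e + d)))) := by
    rw [← Real.rpow_add two_pos, ← Real.rpow_add two_pos]
    congr 1
    rw [hd]
    ring
  calc (2 : ℝ) ^ (-(n * a)) ≤ 1 / 8 * (2 ^ (-(n * d)) * 2 ^ (-(n * (e + d)))) := by
        rw [h6]
        gcongr
    _ = 1 / 2 * (2 ^ (-(n * d)) / 2) * (1 / 2) * 2 ^ (-(n * (e + d))) := by ring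
    _ ≤ _ := by
        have h3' : (1 : ℝ) / 2 ≤ 1 - (D n).trainingError (Q l) l := by linarith
        have h4' : (1 : ℝ) / 2 ≤ 1 - (D n).retrainingError (Q l) l := by linarith
        have := hq0 n
        gcongr

end IsNearTrainingScheme

/-! ### The training based scheme: existence -/

section Existence

variable {Q : Fin L → DMC X Y} {R T : Fin L → ℝ} (r : Fin L) {σc : ℕ → ℕ → X}
  {θc : List Y → Fin L} (hB : ∀ l, burnashev (Q l) ≠ ⊤)
  (hR : ∀ l, 0 ≤ R l ∧ R l < capacity (Q l)) (hT : ∀ l, 0 < T l)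
  (hatt : AttainsExponents Q σc θc T)
include hB hR hT hatt

/-- Existence of the scheme. The re-training rule also serves for the training phase, and the
codebooks are dithered: their errors are not exponentially rare. -/
theorem exists_isNearTrainingScheme {M : ℕ → Fin L → ℕ} (hM : ∀ n l, 0 < M n l)
    (hM1 : ∀ (n : ℕ) l, ⌊(2 : ℝ) ^ ((n : ℝ) * xi Q R T r l * R l)⌋₊ ≤ M n l)
    (hM2 : ∀ (n : ℕ) l, M n l ≤ ⌊(2 : ℝ) ^ ((n : ℝ) * xi Q R T r l * R l)⌋₊ + 1) :
    ∃ D : ℕ → EpochScheme L X Y, IsNearTrainingScheme Q R T r σc θc D ∧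
      (∀ n l, (D n).M l = M n l) ∧
      ∀ l, ∃ q : ℕ → ℝ, (∀ n, 0 ≤ q n) ∧
        (∀ a : ℝ, 0 < a → ∀ᶠ n : ℕ in atTop, 2 ^ (-(n * a)) ≤ q n) ∧
        ∀ n, ∃ m₀, ∀ m, m ≠ m₀ → q n ≤ (D n).codebookError (Q l) l m := by
  have hC := capacity_pos hR
  have hζ := zeta_pos hB hR hT r
  have hκ := kappa_pos hB hR hT
  have hcode := fun l => exists_codebooks (Q l) (hB l) (hC l)
    (mul_nonneg (xi_pos hB hR hT r l).le (gam_nonneg hR l)) (M := fun n => M n l)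
    (fun n => hM n l) (fun n => by
      have h1 : xi Q R T r l * gam Q R l * capacity (Q l) = xi Q R T r l * R l := by
        rw [mul_assoc, gam, div_mul_cancel₀ _ (hC l).ne']
      have h2 : (M n l : ℝ) ≤ ⌊(2 : ℝ) ^ ((n : ℝ) * xi Q R T r l * R l)⌋₊ + 1 := by
        exact_mod_cast hM2 n l
      refine h2.trans (add_le_add_left ?_ 1)
      rw [h1, ← mul_assoc]
      exact Nat.floor_le (by positivity))
  choose bm enc dec q hbm1 hbm2 hcb hq0 hq1 hq2 using hcode
  choose xA xR hdiv hac hsum using fun l => exists_divergence_eq_burnashev (hB l) (hC l)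
  choose A hA1 hA2 using fun l => exists_test (hac l)
  have hbc_lim : ∀ l, Tendsto (fun n : ℕ =>
      ((⌊n * (kappa Q T l * zeta Q R T r)⌋₊ + 1 : ℕ) : ℝ) / n) atTop
      (𝓝 (kappa Q T l * zeta Q R T r)) := fun l =>
    tendsto_floor_add_one_div (mul_pos (hκ l) hζ).le
  have hbc_top := fun l => tendsto_natCast_of_tendsto_div (mul_pos (hκ l) hζ) (hbc_lim l)
  have ham_top : Tendsto (fun n => Nat.sqrt n + 1) atTop atTop :=
    tendsto_atTop_mono (fun n => Nat.le_succ _)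
      (tendsto_atTop.2 fun K => (eventually_ge_atTop (K * K)).mono fun n hn => Nat.le_sqrt.2 hn)
  let D : ℕ → EpochScheme L X Y := fun n =>
    { M := M n
      M_pos := hM n
      am := Nat.sqrt n + 1
      bm := fun l => bm l n
      ac := ⌊n * zeta Q R T r⌋₊ + 1
      bc := fun l => ⌊n * (kappa Q T l * zeta Q R T r)⌋₊ + 1
      σm := σc (Nat.sqrt n + 1)
      θm := θc
      enc := fun l => enc l n
      dec := fun l => dec l n
      σc := σc (⌊n * zeta Q R T r⌋₊ + 1)
      θc := θc
      xA := xA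
      xR := xR
      accept := fun l => A l (⌊n * (kappa Q T l * zeta Q R T r)⌋₊ + 1) }
  refine ⟨D, ?_, fun _ _ => rfl, fun l => ⟨q l, hq0 l, hq1 l, hq2 l⟩⟩
  exact
    { le_M := hM1
      M_le := hM2
      am_pos := fun n => Nat.succ_pos _
      am_lim := tendsto_sqrt_add_one_div
      am_atTop := ham_top
      bm_gt := fun n l => hbm1 l n
      bm_lim := hbm2
      ac_pos := fun n => Nat.succ_pos _
      ac_lim := tendsto_floor_add_one_div hζ.le
      bc_pos := fun n l => Nat.succ_pos _
      bc_lim := hbc_lim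
      training := fun l => by
        have h1 : Tendsto (fun N : ℕ => blockProb (Q l) (fun h => σc N h.length) N {h | θc h ≠ l})
            atTop (𝓝 0) :=
          tendsto_of_tendsto_of_tendsto_of_le_of_le' tendsto_const_nhds
            (tendsto_two_rpow_neg_mul (half_pos (hT l)))
            (.of_forall fun n => blockProb_nonneg _ _ _ _)
            (hatt.eventually_le l (half_lt_self (hT l)))
        exact h1.comp ham_top
      codebook := hcb
      σc_eq := fun n => rfl
      θc_eq := fun n => rfl
      control := fun n l => hdiv l
      test_accept := fun l => (hA1 l).comp (hbc_top l)
      test_reject := fun l => by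
        have := (hA2 l).comp (hbc_top l)
        rw [hsum, EReal.coe_ennreal_toReal (hB l)] at this
        exact this }

end Existence

end CompoundFeedback
end

theorem mainTheorem2 {L : ℕ} {X Y : Type*} [Fintype X] [Fintype Y]
    (Q : Fin L → CompoundFeedback.DMC X Y) (R : Fin L → ℝ)
    (hB : ∀ l, CompoundFeedback.burnashev (Q l) ≠ ⊤)
    (hR : ∀ l, 0 ≤ R l ∧ R l < CompoundFeedback.capacity (Q l)) :
    (∀ (T : Fin L → ℝ) (σc : ℕ → ℕ → X) (θc : List Y → Fin L) (r : Fin L),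
      (∀ l, 0 < T l) → CompoundFeedback.AttainsExponents Q σc θc T →
      (∃ D : ℕ → CompoundFeedback.EpochScheme L X Y,
        CompoundFeedback.IsTrainingScheme Q R T r σc θc D) ∧
      ∀ D : ℕ → CompoundFeedback.EpochScheme L X Y,
        CompoundFeedback.IsTrainingScheme Q R T r σc θc D →
        ∀ μ : (∀ n, stdSimplex ℝ (∀ l, Fin ((D n).toCodingScheme.M l))),
          (∀ n, CompoundFeedback.UniformMarginals (μ n)) →
          CompoundFeedback.AchievesRate Q R (fun n => (D n).toCodingScheme) μ ∧
          ∀ l, ((CompoundFeedback.exponentBound Q R T l : ℝ) : EReal) ≤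
            Filter.liminf (fun n => (D n).toCodingScheme.exponent (Q l) (μ n)) Filter.atTop) ∧
    (⋃ T ∈ {T ∈ CompoundFeedback.estimationRegion Q | ∀ l, 0 < T l},
        {fun l => ((CompoundFeedback.exponentBound Q R T l : ℝ) : EReal)}) ⊆
      CompoundFeedback.errorExponentRegion Q R := by
  open CompoundFeedback in
  constructor
  · intro T σc θc r hT hatt
    have hfloor : ∀ (n : ℕ) l, 0 < ⌊(2 : ℝ) ^ ((n : ℝ) * xi Q R T r l * R l)⌋₊ := fun n l =>
      Nat.floor_pos.2 (Real.one_le_rpow one_le_two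
        (mul_nonneg (mul_nonneg (Nat.cast_nonneg n) (xi_pos hB hR hT r l).le) (hR l).1))
    refine ⟨?_, fun D hD μ _ => ?_⟩
    · obtain ⟨D, hD, hM, -⟩ := exists_isNearTrainingScheme r hB hR hT hatt hfloor
        (fun _ _ => le_rfl) (fun _ _ => Nat.le_succ _)
      exact ⟨D, hD.isTrainingScheme hM⟩
    · have h := hD.isNearTrainingScheme.isReliableSequence hB hR hT hatt
      refine ⟨h.achievesRate μ (xi_pos hB hR hT r) fun l => mul_pos (zeta_pos hB hR hT r) (hT l),
        fun l => ?_⟩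
      rw [exponentBound_eq hB hR hT r l]
      exact h.le_liminf_exponent μ (xi_pos hB hR hT r) l
  · refine Set.iUnion₂_subset fun T hT => Set.singleton_subset_iff.2 ?_
    obtain ⟨⟨σc, θc, hatt⟩, hT⟩ := hT
    -- Any reference channel will do; the estimation rule provides one.
    obtain ⟨r⟩ : Nonempty (Fin L) := ⟨θc []⟩
    obtain ⟨D, hD, hM, hq⟩ := exists_isNearTrainingScheme r hB hR hT hatt
      (M := fun n l => ⌊(2 : ℝ) ^ ((n : ℝ) * xi Q R T r l * R l)⌋₊ + 1)
      (fun _ _ => Nat.succ_pos _) (fun _ _ => Nat.le_succ _) (fun _ _ => le_rfl)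
    have hM2 : ∀ n l, 2 ≤ (D n).M l := fun n l => by
      rw [hM]
      exact Nat.succ_le_succ (Nat.floor_pos.2 (Real.one_le_rpow one_le_two
        (mul_nonneg (mul_nonneg (Nat.cast_nonneg n) (xi_pos hB hR hT r l).le) (hR l).1)))
    have h := hD.isReliableSequence hB hR hT hatt
    refine ⟨fun n => (D n).toCodingScheme, fun μ hμ => ⟨h.achievesRate μ (xi_pos hB hR hT r)
      fun l => mul_pos (zeta_pos hB hR hT r) (hT l), fun l => ?_⟩⟩
    obtain ⟨q, hq0, hq1, hq2⟩ := hq l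
    beta_reduce
    rw [exponentBound_eq hB hR hT r l]
    exact h.tendsto_exponent μ (xi_pos hB hR hT r) l fun a ha =>
      hD.eventually_le_errorProb hB hR hT hatt hM2 l hq0 hq1 hq2 μ hμ ha
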